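/- **Definitions.** For complex numbers $a,b,c,d,e,f,g$ with $e+f+g-a-b-c-d=1$ put $$L\left[{a,b,c,d\atop e;f,g}\right]=\frac{{}_4F_3\left[{a,b,c,d;\atop e,f,g;}1\right]}{\sin \pi e\,\Gamma(e)\Gamma(f)\Gamma(g)\Gamma(1+a-e)\Gamma(1+b-e)\Gamma(1+c-e)\Gamma(1+d-e)}-\frac{{}_4F_3\left[{1+a-e,1+b-e,1+c-e,1+d-e;\atop 1+f-e,1+g-e,2-e;}1\right]}{\sin \pi e\,\Gamma(a)\Gamma(b)\Gamma(c)\Gamma(d)\Gamma(1+f-e)\Gamma(1+g-e)\Gamma(2-e)},$$ where ${}_4F_3$ is the generalized hypergeometric series and $1/\Gamma$ is regarded as an entire function. Let $V=\{(a,b,c,d,e,f,g)^T\in\mathbb C^7: e+f+g-a-b-c-d=1\}$ and write $L(\vec x)$ for $\vec x=(a,b,c,d,e,f,g)^T\in V$. The formula is meaningful at $\vec x$ when $\sin\pi e\neq0$ and none of the denominator parameters $e,f,g,1+f-e,1+g-e,2-e$ is zero or a negative integer; such a point $\vec x$ is called admissible. Identify $\sigma\in S_7$ with the permutation matrix in $GL(7,\mathbb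 C)$ sending the standard basis vector $e_i$ to $e_{\sigma(i)}$, and let $$A=\begin{pmatrix}1&0&0&0&0&0&0\\0&1&0&0&0&0&0\\0&0&-1&0&0&0&1\\0&0&0&-1&0&0&1\\0&0&-1&-1&1&0&1\\0&0&-1&-1&0&1&1\\0&0&0&0&0&0&1\end{pmatrix},$$ $$\Sigma=\langle(12),(23),(34),(67)\rangle,\qquad G_L=\langle(12),(23),(34),(67),A\rangle\le GL(7,\mathbb C).$$ **Theorem.** 1. $\Sigma\cong S_4\times S_2$, and $\Sigma$ consists of exactly the permutation matrices that lie in $G_L$. 2. There are exactly six double cosets $\Sigma\alpha\Sigma$, $\alpha\in G_L$. The matrices $$I_7,\quad A,\quad ((123)(67)A)^2,\quad ((123)(67)A)^3,\quad ((123)A)^3,\quad ((123)(67)A)^4$$ lie in $G_L$, their double cosets are pairwise disjoint with union $G_L$, and these double cosets have, in this order, $1\cdot48,\ 12\cdot48,\ 12\cdot48,\ 12\cdot48,\ 2\cdot48,\ 1\cdot48$ elements. 3. At every admissible point of $V$ both series in the definition of $L$ converge absolutely. On $V$ the six matrices act, in this order, by sending $(a,b,c,d,e,f,g)^T$ to the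 vector of arguments on the right-hand side of the following relations, and each relation holds whenever the points of $V$ on both of its sides are admissible: $$L\left[{a,b,c,d\atop e;f,g}\right]=L\left[{a,b,c,d\atop e;f,g}\right],$$ $$L\left[{a,b,c,d\atop e;f,g}\right]=L\left[{a,b,g-c,g-d\atop 1+a+b-f;1+a+b-e,g}\right],$$ $$L\left[{a,b,c,d\atop e;f,g}\right]=L\left[{1+a-e,g-c,a,f-c\atop 1+a-c;1+a+b-e,1+a+d-e}\right],$$ $$L\left[{a,b,c,d\atop e;f,g}\right]=L\left[{1+d-e,1+a-e,g-c,g-b\atop 1+g-b-c;1+a+d-e,1+g-e}\right],$$ $$L\left[{a,b,c,d\atop e;f,g}\right]=L\left[{g-a,g-b,g-c,g-d\atop 1+g-f;1+g-e,g}\right],$$ $$L\left[{a,b,c,d\atop e;f,g}\right]=L\left[{1+c-e,1+d-e,1+a-e,1+b-e\atop 2-e;1+g-e,1+f-e}\right].$$ 4. Every $\alpha\in G_L$ maps $V$ into $V$ and satisfies $L(\vec x)=L(\alpha\vec x)$ whenever $\vec x\in V$ and both $\vec x$ and $\alpha\vec x$ are admissible. Moreover, $\alpha=\sigma\rho\tau$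 for some $\sigma,\tau\in\Sigma$ and one of the six matrices $\rho$ above, so that on $V$ the substitution $\vec x\mapsto\alpha\vec x$ arises from one of the six listed substitutions by permuting the variables $a,b,c,d$ and $f,g$ (by $\tau$) and by permuting the first four entries and the last two entries of the result (by $\sigma$). -/

import Mathlib

open Matrix

namespace SaalschutzL

noncomputable section

/-- The `n`-th term `(a₁)ₙ ⋯ (aₚ₊₁)ₙ / (n! (b₁)ₙ ⋯ (bₚ)ₙ) zⁿ` of a hypergeometric series,
where `(a)ₙ = a (a + 1) ⋯ (a + n - 1)` is the rising factorial. -/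
def hypTerm {p : ℕ} (a : Fin (p + 1) → ℂ) (b : Fin p → ℂ) (z : ℂ) (n : ℕ) : ℂ :=
  (∏ i, (ascPochhammer ℂ n).eval (a i)) /
    ((n.factorial : ℂ) * ∏ j, (ascPochhammer ℂ n).eval (b j)) * z ^ n

/-- The hypergeometric series of type `ₚ₊₁Fₚ`. -/
def hyp {p : ℕ} (a : Fin (p + 1) → ℂ) (b : Fin p → ℂ) (z : ℂ) : ℂ :=
  ∑' n, hypTerm a b z n

/-- The function `L(a,b,c,d;e;f,g)`. Since `Complex.Gamma` takes the value `0` at its poles and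
division by `0` gives `0`, a factor `1 / Γ(s)` is the entire function `1 / Γ` at every `s`. -/
def L (a b c d e f g : ℂ) : ℂ :=
  hyp ![a, b, c, d] ![e, f, g] 1 /
      (Complex.sin (Real.pi * e) * Complex.Gamma e * Complex.Gamma f * Complex.Gamma g *
        Complex.Gamma (1 + a - e) * Complex.Gamma (1 + b - e) *
        Complex.Gamma (1 + c - e) * Complex.Gamma (1 + d - e)) -
    hyp ![1 + a - e, 1 + b - e, 1 + c - e, 1 + d - e] ![1 + f - e, 1 + g - e, 2 - e] 1 /
      (Complex.sin (Real.pi * e) *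
        Complex.Gamma a * Complex.Gamma b * Complex.Gamma c * Complex.Gamma d *
        Complex.Gamma (1 + f - e) * Complex.Gamma (1 + g - e) * Complex.Gamma (2 - e))

/-- `L` as a function of the vector `(a, b, c, d, e, f, g)`. -/
def Lvec (x : Fin 7 → ℂ) : ℂ := L (x 0) (x 1) (x 2) (x 3) (x 4) (x 5) (x 6)

/-- The affine hyperplane `e + f + g - a - b - c - d = 1` in `ℂ⁷`. -/
def V : Set (Fin 7 → ℂ) :=
  {x | x 4 + x 5 + x 6 - x 0 - x 1 - x 2 - x 3 = 1}

/-- The points of `ℂ⁷` at which the formula for `L` is meaningful: no denominator parameter of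
the two series is zero or a negative integer, and `sin πe ≠ 0`. -/
def Admissible (x : Fin 7 → ℂ) : Prop :=
  Complex.sin (Real.pi * x 4) ≠ 0 ∧
    ∀ n : ℕ, x 4 ≠ -(n : ℂ) ∧ x 5 ≠ -(n : ℂ) ∧ x 6 ≠ -(n : ℂ) ∧
      1 + x 5 - x 4 ≠ -(n : ℂ) ∧ 1 + x 6 - x 4 ≠ -(n : ℂ) ∧ 2 - x 4 ≠ -(n : ℂ)

/-- The permutation matrix of `σ`, which maps the standard basis vector `eᵢ` to `e_{σ i}`.
The indices `1, …, 7` of the mathematical text are `0, …, 6` here. -/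
def perm : Equiv.Perm (Fin 7) →* GL (Fin 7) ℂ :=
  (Matrix.permMatrixHom (n := Fin 7) (R := ℂ)).toHomUnits

/-- The matrix underlying `A`. -/
def matA : Matrix (Fin 7) (Fin 7) ℂ :=
  !![1, 0,  0,  0, 0, 0, 0;
     0, 1,  0,  0, 0, 0, 0;
     0, 0, -1,  0, 0, 0, 1;
     0, 0,  0, -1, 0, 0, 1;
     0, 0, -1, -1, 1, 0, 1;
     0, 0, -1, -1, 0, 1, 1;
     0, 0,  0,  0, 0, 0, 1]

theorem matA_mul_self : matA * matA = 1 := by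
  ext i j
  fin_cases i <;> fin_cases j <;>
    simp [matA, Matrix.mul_apply, Fin.sum_univ_succ]

/-- The matrix `A` as an element of `GL(7, ℂ)`. -/
def A : GL (Fin 7) ℂ := ⟨matA, matA, matA_mul_self, matA_mul_self⟩

/-- `Σ = ⟨(12), (23), (34), (67)⟩`. -/
def Sig : Subgroup (GL (Fin 7) ℂ) :=
  Subgroup.closure
    {perm (Equiv.swap 0 1), perm (Equiv.swap 1 2), perm (Equiv.swap 2 3), perm (Equiv.swap 5 6)}

/-- `G_L = ⟨(12), (23), (34), (67), A⟩`. -/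
def invGroup : Subgroup (GL (Fin 7) ℂ) :=
  Subgroup.closure
    {perm (Equiv.swap 0 1), perm (Equiv.swap 1 2), perm (Equiv.swap 2 3), perm (Equiv.swap 5 6), A}

/-- The double coset `Σ α Σ`. -/
def dcoset (α : GL (Fin 7) ℂ) : Set (GL (Fin 7) ℂ) :=
  DoubleCoset.doubleCoset α (Sig : Set (GL (Fin 7) ℂ)) (Sig : Set (GL (Fin 7) ℂ))

/-- The matrices `I`, `A`, `((123)(67)A)²`, `((123)(67)A)³`, `((123)A)³`, `((123)(67)A)⁴`. -/
def rep : Fin 6 → GL (Fin 7) ℂ :=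
  ![1, A,
    (perm (c[0, 1, 2] * c[5, 6]) * A) ^ 2,
    (perm (c[0, 1, 2] * c[5, 6]) * A) ^ 3,
    (perm c[0, 1, 2] * A) ^ 3,
    (perm (c[0, 1, 2] * c[5, 6]) * A) ^ 4]

/-- The right-hand sides of the six listed invariance relations, as vectors of arguments. -/
def rhs (a b c d e f g : ℂ) : Fin 6 → Fin 7 → ℂ :=
  ![![a, b, c, d, e, f, g],
    ![a, b, g - c, g - d, 1 + a + b - f, 1 + a + b - e, g],
    ![1 + a - e, g - c, a, f - c, 1 + a - c, 1 + a + b - e, 1 + a + d - e],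
    ![1 + d - e, 1 + a - e, g - c, g - b, 1 + g - b - c, 1 + a + d - e, 1 + g - e],
    ![g - a, g - b, g - c, g - d, 1 + g - f, 1 + g - e, g],
    ![1 + c - e, 1 + d - e, 1 + a - e, 1 + b - e, 2 - e, 1 + g - e, 1 + f - e]]

/-- The `i`-th right-hand side as a function of the vector `(a, b, c, d, e, f, g)`. -/
def rhsVec (i : Fin 6) (x : Fin 7 → ℂ) : Fin 7 → ℂ :=
  rhs (x 0) (x 1) (x 2) (x 3) (x 4) (x 5) (x 6) i

/-- The action of a matrix on `ℂ⁷` (column vectors). -/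
def act (α : GL (Fin 7) ℂ) (x : Fin 7 → ℂ) : Fin 7 → ℂ :=
  (α : Matrix (Fin 7) (Fin 7) ℂ) *ᵥ x

end

end SaalschutzL

/-! The proof has an analytic half, the invariance of `L`, and a finite half, the double cosets.
Transpositions only permute the parameters of the two series, so the one substantial relation is
that for `A`: c and d are reflected to g - c and g - d, while e and f move by u = g - c - d.

For that relation the factor Γ(c+n)Γ(d+n)/(Γ(g+n) n!) of a ₄F₃ term is expanded by Euler's
transformation, which turns the ₄F₃ into a double series with balanced ₃F₂(1) inner sums. The
nonterminating Saalschütz theorem (`saal_formula`) gives each inner sum as a Gamma product plus a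
second ₃F₂. The Gamma products resum to a ₄F₃ with reflected parameters; the second ₃F₂'s leave two
Gauss series coupled by a Gamma quotient in j - k (`fourTerm_half`). Applied to the first series of
the reflected `L` and to the second series of the original one, this yields the same coupled series
up to a factor: Γ-reflection and interchange of summation swap the two Gauss series. In the two-term
combination it cancels (`fourDiff_reflect`).

`saal_formula` itself holds because its two ₃F₂ series obey the same inhomogeneous first-order
recurrence. Their difference is therefore a Gamma product times a constant, which Gauss's theorem
identifies asymptotically.

All this needs parameters in general position. Points of V whose real parts satisfy no integral
affine relation beyond the forced one form a set stable under the generators, so invariance passes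
to all of G_L there (`Lvec_act_of_generic`). Balanced series converge locally uniformly, so `Lvec`
is continuous on V at admissible points (`tendsto_Lvec`); generic points accumulate at every point
of V along a line of transcendental direction, and `Lvec_act` follows.

For the double cosets, a finite check shows that the six candidates are permuted among themselves by
right multiplication by `A` in the weak sense that each product lands in one of them
(`dcoset_mul_A`), so their union is G_L. The row vector (1,1,1,1,0,-1,-1) has stabilizer Σ, so right
cosets Σα correspond to the vectors of its orbit and double cosets to Σ-orbits of these; this
separates and counts them. -/

namespace SaalschutzL

/-! ### Asymptotics of quotients of Gamma functions -/

open Filter Topology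

/-- A complex number that is not an integer. -/
def NonInt (z : ℂ) : Prop := ∀ n : ℤ, z ≠ n

theorem NonInt.congr {z w : ℂ} (h : NonInt z) (n : ℤ) (hw : w = z + n) : NonInt w := by
  intro m hm
  apply h (m - n)
  push_cast
  rw [← hm, hw]
  ring

theorem NonInt.neg_congr {z w : ℂ} (h : NonInt z) (n : ℤ) (hw : w = n - z) : NonInt w := by
  intro m hm
  apply h (n - m)
  push_cast
  rw [← hm, hw]
  ring

theorem NonInt.add_nat {z : ℂ} (h : NonInt z) (n : ℕ) : NonInt (z + n) :=
  h.congr n (by push_cast; ring)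

theorem NonInt.not_pole {z : ℂ} (h : NonInt z) (m : ℕ) : z ≠ -m := by
  have := h (-m)
  push_cast at this
  exact this

theorem NonInt.ne_zero {z : ℂ} (h : NonInt z) : z ≠ 0 := by
  simpa using h 0

theorem NonInt.Gamma_ne_zero {z : ℂ} (h : NonInt z) : Complex.Gamma z ≠ 0 :=
  Complex.Gamma_ne_zero h.not_pole

theorem NonInt.sin_ne_zero {z : ℂ} (h : NonInt z) : Complex.sin (Real.pi * z) ≠ 0 := by
  rw [Ne, Complex.sin_eq_zero_iff]
  rintro ⟨k, hk⟩
  apply h k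
  have : (Real.pi : ℂ) ≠ 0 := by exact_mod_cast Real.pi_ne_zero
  apply mul_left_cancel₀ this
  rw [hk]
  ring

theorem not_pole_one (m : ℕ) : (1 : ℂ) ≠ -m := by
  intro h
  have := congrArg Complex.re h
  simp at this
  have h2 : (0 : ℝ) ≤ m := by positivity
  linarith

theorem not_pole_add_nat {z : ℂ} (h : ∀ m : ℕ, z ≠ -m) (n : ℕ) : ∀ m : ℕ, z + n ≠ -m := by
  intro m hm
  apply h (m + n)
  push_cast
  linear_combination hm

theorem add_nat_ne_zero {z : ℂ} (h : ∀ m : ℕ, z ≠ -m) (n : ℕ) : z + n ≠ 0 := by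
  intro hm
  exact h n (by linear_combination hm)

theorem Gamma_add_nat_ne_zero {z : ℂ} (h : ∀ m : ℕ, z ≠ -m) (n : ℕ) :
    Complex.Gamma (z + n) ≠ 0 :=
  Complex.Gamma_ne_zero (not_pole_add_nat h n)

theorem Gamma_add_nat_succ {z : ℂ} (h : ∀ m : ℕ, z ≠ -m) (n : ℕ) :
    Complex.Gamma (z + (n + 1 : ℕ)) = (z + n) * Complex.Gamma (z + n) := by
  rw [← Complex.Gamma_add_one _ (add_nat_ne_zero h n)]
  push_cast
  ring_nf

theorem Gamma_one_add_nat (n : ℕ) : Complex.Gamma (1 + n) = n.factorial := by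
  rw [add_comm, Complex.Gamma_nat_eq_factorial]

theorem Gamma_add_nat_eq_prod {z : ℂ} (h : ∀ m : ℕ, z ≠ -m) (n : ℕ) :
    Complex.Gamma (z + n) = Complex.Gamma z * ∏ j ∈ Finset.range n, (z + j) := by
  induction n with
  | zero => simp
  | succ n ih =>
    rw [Gamma_add_nat_succ h, ih, Finset.prod_range_succ]
    ring

theorem tendsto_add_nat_div (z w : ℂ) :
    Tendsto (fun n : ℕ => (z + n) / (w + n)) atTop (𝓝 1) := by
  have h := tendsto_add_mul_div_add_mul_atTop_nhds (𝕜 := ℂ) z w (1 : ℂ) (d := 1) one_ne_zero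
  simpa using h

/-- The quotient of two Gamma functions along the natural numbers is asymptotic to a power. -/
theorem tendsto_Gamma_ratio {z w : ℂ} (hz : ∀ m : ℕ, z ≠ -m) (hw : ∀ m : ℕ, w ≠ -m) :
    Tendsto (fun n : ℕ => Complex.Gamma (z + n) / Complex.Gamma (w + n) *
      ((n + 1 : ℕ) : ℂ) ^ (w - z)) atTop (𝓝 1) := by
  have hΓz := Complex.Gamma_ne_zero hz
  have hΓw := Complex.Gamma_ne_zero hw
  have h1 : Tendsto (fun n : ℕ => (Complex.GammaSeq w n / Complex.Gamma w) /
      (Complex.GammaSeq z n / Complex.Gamma z)) atTop (𝓝 1) := by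
    have hw1 := (Complex.GammaSeq_tendsto_Gamma w).div_const (Complex.Gamma w)
    have hz1 := (Complex.GammaSeq_tendsto_Gamma z).div_const (Complex.Gamma z)
    rw [div_self hΓw] at hw1
    rw [div_self hΓz] at hz1
    have h := hw1.div hz1 one_ne_zero
    rw [div_one] at h
    exact h
  -- The index n + 1 keeps the base of the complex power nonzero. The denominator product then runs
  -- two factors past Γ(s + n), and `h3` and `h4` compensate for these.
  have h2 := (tendsto_add_atTop_iff_nat 1).mpr h1
  have h3 := tendsto_add_nat_div w z
  have h4 := (tendsto_add_atTop_iff_nat 1).mpr h3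
  have h5 := (h2.mul h3).mul h4
  rw [one_mul, one_mul] at h5
  refine h5.congr fun n => ?_
  have hn : ((n + 1 : ℕ) : ℂ) ≠ 0 := by exact_mod_cast Nat.succ_ne_zero n
  have hP : ∀ {s : ℂ}, (∀ m : ℕ, s ≠ -m) →
      Complex.GammaSeq s (n + 1) / Complex.Gamma s =
        ((n + 1 : ℕ) : ℂ) ^ s * (n + 1).factorial /
          (Complex.Gamma (s + n) * (s + n) * (s + (n + 1 : ℕ))) := by
    intro s hs
    have hΓ := Complex.Gamma_ne_zero hs
    have e1 := Gamma_add_nat_eq_prod hs (n + 1 + 1)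
    rw [Gamma_add_nat_succ hs, Gamma_add_nat_succ hs] at e1
    have hne := Gamma_add_nat_ne_zero hs (n + 1 + 1)
    rw [Gamma_add_nat_eq_prod hs] at hne
    rw [Complex.GammaSeq, div_div, mul_comm _ (Complex.Gamma s), ← e1]
    congr 1
    ring
  rw [hP hz, hP hw, Complex.cpow_sub _ _ hn]
  have a1 := Gamma_add_nat_ne_zero hz n
  have a2 := Gamma_add_nat_ne_zero hw n
  have a3 := add_nat_ne_zero hz n
  have a4 := add_nat_ne_zero hw n
  have a5 := add_nat_ne_zero hz (n + 1)
  have a6 := add_nat_ne_zero hw (n + 1)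
  have a7 : (((n + 1).factorial : ℕ) : ℂ) ≠ 0 := by exact_mod_cast Nat.factorial_ne_zero _
  have a8 : ((n + 1 : ℕ) : ℂ) ^ z ≠ 0 := by
    rw [Complex.cpow_ne_zero_iff]; exact Or.inl hn
  field_simp

theorem norm_succ_cpow (n : ℕ) (s : ℂ) :
    ‖((n + 1 : ℕ) : ℂ) ^ s‖ = ((n : ℝ) + 1) ^ s.re := by
  rw [Complex.norm_natCast_cpow_of_pos (Nat.succ_pos n)]
  push_cast
  rfl

theorem Gamma_ratio_bound {z w : ℂ} (hz : ∀ m : ℕ, z ≠ -m) (hw : ∀ m : ℕ, w ≠ -m) :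
    ∃ C : ℝ, 0 < C ∧ ∀ n : ℕ, ‖Complex.Gamma (z + n) / Complex.Gamma (w + n)‖ ≤
      C * ((n : ℝ) + 1) ^ (z - w).re := by
  have hb := (tendsto_Gamma_ratio hz hw).norm.bddAbove_range
  obtain ⟨C, hC⟩ := hb
  refine ⟨max C 1, by positivity, fun n => ?_⟩
  have h1 : ‖Complex.Gamma (z + n) / Complex.Gamma (w + n) * ((n + 1 : ℕ) : ℂ) ^ (w - z)‖ ≤ C :=
    hC ⟨n, rfl⟩
  rw [norm_mul, norm_succ_cpow] at h1
  have hp : (0 : ℝ) < (n : ℝ) + 1 := by positivity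
  have h2 : (z - w).re = -(w - z).re := by simp
  rw [h2, Real.rpow_neg hp.le, ← div_eq_mul_inv, le_div_iff₀ (by positivity)]
  exact h1.trans (le_max_left _ _)

theorem summable_succ_rpow {s : ℝ} (hs : s < -1) :
    Summable fun n : ℕ => ((n : ℝ) + 1) ^ s := by
  have := (summable_nat_add_iff 1).mpr (Real.summable_nat_rpow.mpr hs)
  simpa using this

end SaalschutzL

/-! ### Gauss's summation theorem -/

namespace SaalschutzL

open Filter Topology

theorem tendsto_Gamma_ratio₂ {a b c d : ℂ} (ha : ∀ m : ℕ, a ≠ -m) (hb : ∀ m : ℕ, b ≠ -m)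
    (hc : ∀ m : ℕ, c ≠ -m) (hd : ∀ m : ℕ, d ≠ -m) :
    Tendsto (fun n : ℕ => Complex.Gamma (a + n) * Complex.Gamma (b + n) /
      (Complex.Gamma (c + n) * Complex.Gamma (d + n)) *
      ((n + 1 : ℕ) : ℂ) ^ (c + d - a - b)) atTop (𝓝 1) := by
  have h := (tendsto_Gamma_ratio ha hc).mul (tendsto_Gamma_ratio hb hd)
  rw [one_mul] at h
  refine h.congr fun n => ?_
  have hn : ((n + 1 : ℕ) : ℂ) ≠ 0 := by exact_mod_cast Nat.succ_ne_zero n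
  rw [show c + d - a - b = (c - a) + (d - b) by ring, Complex.cpow_add _ _ hn]
  ring

theorem tendsto_Gamma_ratio₃ {a b c d e f : ℂ} (ha : ∀ m : ℕ, a ≠ -m) (hb : ∀ m : ℕ, b ≠ -m)
    (hc : ∀ m : ℕ, c ≠ -m) (hd : ∀ m : ℕ, d ≠ -m) (he : ∀ m : ℕ, e ≠ -m)
    (hf : ∀ m : ℕ, f ≠ -m) :
    Tendsto (fun n : ℕ => Complex.Gamma (a + n) * Complex.Gamma (b + n) * Complex.Gamma (c + n) /
      (Complex.Gamma (d + n) * Complex.Gamma (e + n) * Complex.Gamma (f + n)) *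
      ((n + 1 : ℕ) : ℂ) ^ (d + e + f - a - b - c)) atTop (𝓝 1) := by
  have h := (tendsto_Gamma_ratio₂ ha hb hd he).mul (tendsto_Gamma_ratio hc hf)
  rw [one_mul] at h
  refine h.congr fun n => ?_
  have hn : ((n + 1 : ℕ) : ℂ) ≠ 0 := by exact_mod_cast Nat.succ_ne_zero n
  rw [show d + e + f - a - b - c = (d + e - a - b) + (f - c) by ring, Complex.cpow_add _ _ hn]
  ring

theorem Gamma_ratio₂_bound {a b c d : ℂ} (ha : ∀ m : ℕ, a ≠ -m) (hb : ∀ m : ℕ, b ≠ -m)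
    (hc : ∀ m : ℕ, c ≠ -m) (hd : ∀ m : ℕ, d ≠ -m) :
    ∃ C : ℝ, 0 < C ∧ ∀ n : ℕ, ‖Complex.Gamma (a + n) * Complex.Gamma (b + n) /
      (Complex.Gamma (c + n) * Complex.Gamma (d + n))‖ ≤
      C * ((n : ℝ) + 1) ^ (a + b - c - d).re := by
  obtain ⟨C, hC, h1⟩ := Gamma_ratio_bound ha hc
  obtain ⟨D, hD, h2⟩ := Gamma_ratio_bound hb hd
  refine ⟨C * D, by positivity, fun n => ?_⟩
  have hp : (0 : ℝ) < (n : ℝ) + 1 := by positivity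
  rw [mul_div_mul_comm, norm_mul]
  calc _ ≤ (C * ((n : ℝ) + 1) ^ (a - c).re) * (D * ((n : ℝ) + 1) ^ (b - d).re) :=
        mul_le_mul (h1 n) (h2 n) (norm_nonneg _) (by positivity)
    _ = C * D * ((n : ℝ) + 1) ^ (a + b - c - d).re := by
        rw [show (a + b - c - d).re = (a - c).re + (b - d).re by simp; ring, Real.rpow_add hp]
        ring

theorem Gamma_ratio₃_bound {a b c d e f : ℂ} (ha : ∀ m : ℕ, a ≠ -m) (hb : ∀ m : ℕ, b ≠ -m)
    (hc : ∀ m : ℕ, c ≠ -m) (hd : ∀ m : ℕ, d ≠ -m) (he : ∀ m : ℕ, e ≠ -m)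
    (hf : ∀ m : ℕ, f ≠ -m) :
    ∃ C : ℝ, 0 < C ∧ ∀ n : ℕ,
      ‖Complex.Gamma (a + n) * Complex.Gamma (b + n) * Complex.Gamma (c + n) /
      (Complex.Gamma (d + n) * Complex.Gamma (e + n) * Complex.Gamma (f + n))‖ ≤
      C * ((n : ℝ) + 1) ^ (a + b + c - d - e - f).re := by
  obtain ⟨C, hC, h1⟩ := Gamma_ratio₂_bound ha hb hd he
  obtain ⟨D, hD, h2⟩ := Gamma_ratio_bound hc hf
  refine ⟨C * D, by positivity, fun n => ?_⟩
  have hp : (0 : ℝ) < (n : ℝ) + 1 := by positivity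
  rw [mul_div_mul_comm, norm_mul]
  calc _ ≤ (C * ((n : ℝ) + 1) ^ (a + b - d - e).re) * (D * ((n : ℝ) + 1) ^ (c - f).re) :=
        mul_le_mul (h1 n) (h2 n) (norm_nonneg _) (by positivity)
    _ = C * D * ((n : ℝ) + 1) ^ (a + b + c - d - e - f).re := by
        rw [show (a + b + c - d - e - f).re = (a + b - d - e).re + (c - f).re by simp; ring,
          Real.rpow_add hp]
        ring

/-- The boundary value l matters: it is 0 in the Gauss recurrence and 1 in the Saalschütz
recurrence. -/
theorem tsum_of_telescoping {f G : ℕ → ℂ} {l : ℂ} (hf : Summable f)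
    (h : ∀ n, f n = G (n + 1) - G n) (hG : Tendsto G atTop (𝓝 l)) :
    ∑' n, f n = l - G 0 := by
  refine tendsto_nhds_unique hf.hasSum.tendsto_sum_nat ?_
  have : (fun n => ∑ i ∈ Finset.range n, f i) = fun n => G n - G 0 := by
    funext n
    rw [Finset.sum_congr rfl fun i _ => h i, Finset.sum_range_sub]
  rw [this]
  exact hG.sub_const _

/-- The terms `Γ(a + n) Γ(c + n) / (Γ(e + n) n!)` of a `₂F₁` series at `1`. -/
noncomputable def gaussTerm (a c e : ℂ) (n : ℕ) : ℂ :=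
  Complex.Gamma (a + n) * Complex.Gamma (c + n) / (Complex.Gamma (e + n) * Complex.Gamma (1 + n))

theorem gaussTerm_bound {a c e : ℂ} (ha : NonInt a) (hc : NonInt c) (he : NonInt e) :
    ∃ C : ℝ, 0 < C ∧ ∀ n : ℕ, ‖gaussTerm a c e n‖ ≤
      C * ((n : ℝ) + 1) ^ (a + c - e - 1).re :=
  Gamma_ratio₂_bound ha.not_pole hc.not_pole he.not_pole not_pole_one

theorem summable_gaussTerm {a c e : ℂ} (ha : NonInt a) (hc : NonInt c) (he : NonInt e)
    (h : 0 < (e - a - c).re) : Summable (gaussTerm a c e) := by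
  obtain ⟨C, hC, hb⟩ := gaussTerm_bound ha hc he
  refine Summable.of_norm_bounded ((summable_succ_rpow ?_).mul_left C) hb
  simp at h ⊢
  linarith

theorem gaussTerm_succ {a c e : ℂ} (ha : NonInt a) (hc : NonInt c) (he : NonInt e) (n : ℕ) :
    gaussTerm a c e (n + 1) =
      gaussTerm a c e n * ((a + n) * (c + n) / ((e + n) * (1 + n))) := by
  unfold gaussTerm
  rw [Gamma_add_nat_succ ha.not_pole, Gamma_add_nat_succ hc.not_pole,
    Gamma_add_nat_succ he.not_pole, Gamma_add_nat_succ not_pole_one]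
  rw [← mul_div_mul_comm]
  congr 1 <;> ring

theorem gaussTerm_shift {a c e : ℂ} (he : NonInt e) (n : ℕ) :
    gaussTerm a c (e + 1) n = gaussTerm a c e n / (e + n) := by
  unfold gaussTerm
  have := Gamma_add_nat_succ he.not_pole n
  rw [show e + 1 + (n : ℂ) = e + (n + 1 : ℕ) by push_cast; ring, this, div_div]
  congr 1
  ring

/-- The termwise difference of the two sides telescopes, with certificate n times the n-th term at
e. The boundary term is O(n^(-Re(e-a-c))), hence tends to 0. -/
theorem gauss_rec {a c e : ℂ} (ha : NonInt a) (hc : NonInt c) (he : NonInt e)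
    (h : 0 < (e - a - c).re) :
    (e - a) * (e - c) * ∑' n, gaussTerm a c (e + 1) n =
      (e - a - c) * ∑' n, gaussTerm a c e n := by
  have he1 : NonInt (e + 1) := by simpa using he.add_nat 1
  have s1 := summable_gaussTerm ha hc he h
  have s2 := summable_gaussTerm ha hc he1 (by simp at h ⊢; linarith)
  have key := tsum_of_telescoping (f := fun n => (e - a) * (e - c) * gaussTerm a c (e + 1) n -
    (e - a - c) * gaussTerm a c e n) (G := fun n => n * gaussTerm a c e n) (l := 0)
    ((s2.mul_left _).sub (s1.mul_left _)) ?_ ?_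
  · rw [(s2.mul_left _).tsum_sub (s1.mul_left _), tsum_mul_left, tsum_mul_left] at key
    simp only [Nat.cast_zero, zero_mul, sub_zero] at key
    exact sub_eq_zero.mp key
  · intro n
    have h1 := add_nat_ne_zero he.not_pole n
    have h2 := add_nat_ne_zero not_pole_one n
    rw [gaussTerm_succ ha hc he, gaussTerm_shift he]
    push_cast
    have h2' : (n : ℂ) + 1 ≠ 0 := by rwa [add_comm]
    field_simp
    ring
  · obtain ⟨C, hC, hb⟩ := gaussTerm_bound ha hc he
    have hlim : Tendsto (fun n : ℕ => C * ((n : ℝ) + 1) ^ (-(e - a - c).re)) atTop (𝓝 0) := by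
      have h1 := (tendsto_rpow_neg_atTop h).comp
        (tendsto_atTop_add_const_right atTop (1 : ℝ) tendsto_natCast_atTop_atTop)
      simpa using h1.const_mul C
    refine squeeze_zero_norm (fun n => ?_) hlim
    have hp : (0 : ℝ) < (n : ℝ) + 1 := by positivity
    rw [norm_mul, Complex.norm_natCast]
    calc (n : ℝ) * ‖gaussTerm a c e n‖
        ≤ ((n : ℝ) + 1) * (C * ((n : ℝ) + 1) ^ (a + c - e - 1).re) :=
          mul_le_mul (by linarith) (hb n) (norm_nonneg _) hp.le
      _ = C * ((n : ℝ) + 1) ^ (-(e - a - c).re) := by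
          rw [show -(e - a - c).re = 1 + (a + c - e - 1).re by simp; ring, Real.rpow_add hp,
            Real.rpow_one]
          ring

/-- As e moves to infinity only the term n = 0 survives, the n-th being of order N^(-n). This fixes
the constant left open by the recurrence. -/
theorem tendsto_gauss_shift {a c e : ℂ} (ha : NonInt a) (hc : NonInt c) (he : NonInt e)
    (h : 0 < (e - a - c).re) :
    Tendsto (fun N : ℕ => Complex.Gamma (e + N) * ∑' n, gaussTerm a c (e + N) n) atTop
      (𝓝 (Complex.Gamma a * Complex.Gamma c)) := by
  -- From N₀ on, e + N has positive real part, so |e + N + j| increases with N and the summand at N₀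
  -- dominates all later ones.
  obtain ⟨N₀, hN₀⟩ := exists_nat_gt (-e.re)
  have he0 := he.add_nat N₀
  have hs0 := summable_gaussTerm ha hc he0 (by
    simp at h ⊢
    have : (0 : ℝ) ≤ N₀ := by positivity
    linarith)
  have hlim : ∑' n : ℕ, (if n = 0 then Complex.Gamma a * Complex.Gamma c else 0) =
      Complex.Gamma a * Complex.Gamma c := tsum_ite_eq 0 _
  rw [← hlim]
  simp_rw [← tsum_mul_left]
  refine tendsto_tsum_of_dominated_convergence
    (bound := fun n => ‖Complex.Gamma (e + N₀) * gaussTerm a c (e + N₀) n‖)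
    (hs0.mul_left _).norm ?_ ?_
  · intro n
    have e1 : ∀ N : ℕ, Complex.Gamma (e + N) * gaussTerm a c (e + N) n =
        Complex.Gamma (a + n) * Complex.Gamma (c + n) / Complex.Gamma (1 + n) *
          (Complex.Gamma (e + N) / Complex.Gamma (e + n + N)) := by
      intro N
      rw [gaussTerm, show e + (N : ℂ) + n = e + n + N by ring]
      rw [mul_div_assoc', div_mul_div_comm]
      congr 1 <;> ring
    simp_rw [e1]
    split_ifs with hn
    · subst hn
      have : ∀ N : ℕ, Complex.Gamma (e + N) / Complex.Gamma (e + (0 : ℕ) + N) = 1 := by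
        intro N
        rw [Nat.cast_zero, add_zero, div_self (Gamma_add_nat_ne_zero he.not_pole N)]
      simp_rw [this]
      simp [Complex.Gamma_one]
    · obtain ⟨C, hC, hb⟩ := Gamma_ratio_bound he.not_pole (he.add_nat n).not_pole
      have hz : Tendsto (fun N : ℕ => Complex.Gamma (e + N) / Complex.Gamma (e + n + N)) atTop
          (𝓝 0) := by
        have hlim : Tendsto (fun N : ℕ => C * ((N : ℝ) + 1) ^ (-(n : ℝ))) atTop (𝓝 0) := by
          have h1 := (tendsto_rpow_neg_atTop (y := (n : ℝ)) (by
            exact_mod_cast Nat.pos_of_ne_zero hn)).comp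
            (tendsto_atTop_add_const_right atTop (1 : ℝ) tendsto_natCast_atTop_atTop)
          simpa using h1.const_mul C
        refine squeeze_zero_norm (fun N => ?_) hlim
        have := hb N
        simpa using this
      simpa using hz.const_mul _
  · filter_upwards [eventually_ge_atTop N₀] with N hN n
    have e1 : ∀ M : ℕ, Complex.Gamma (e + M) * gaussTerm a c (e + M) n =
        Complex.Gamma (a + n) * Complex.Gamma (c + n) / Complex.Gamma (1 + n) *
          (∏ j ∈ Finset.range n, (e + M + j))⁻¹ := by
      intro M
      rw [gaussTerm, Gamma_add_nat_eq_prod (he.add_nat M).not_pole n]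
      have := (he.add_nat M).Gamma_ne_zero
      have h2 := Gamma_add_nat_ne_zero (he.add_nat M).not_pole n
      rw [Gamma_add_nat_eq_prod (he.add_nat M).not_pole n] at h2
      have h3 := right_ne_zero_of_mul h2
      have h4 := Gamma_add_nat_ne_zero not_pole_one n
      field_simp
    rw [e1, e1, norm_mul, norm_mul]
    refine mul_le_mul_of_nonneg_left ?_ (norm_nonneg _)
    rw [norm_inv, norm_inv, norm_prod, norm_prod]
    have hpos : ∀ j : ℕ, 0 < ‖e + (N₀ : ℂ) + j‖ := fun j =>
      norm_pos_iff.mpr (add_nat_ne_zero (he.add_nat N₀).not_pole j)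
    refine inv_anti₀ (Finset.prod_pos fun j _ => hpos j)
      (Finset.prod_le_prod (fun j _ => norm_nonneg _) fun j _ => ?_)
    rw [Complex.norm_def, Complex.norm_def]
    apply Real.sqrt_le_sqrt
    rw [Complex.normSq_apply, Complex.normSq_apply]
    have hN' : (N₀ : ℝ) ≤ N := by exact_mod_cast hN
    have hj : (0 : ℝ) ≤ j := by positivity
    simp only [Complex.add_re, Complex.natCast_re, Complex.add_im, Complex.natCast_im]
    nlinarith

/-- Gauss's summation theorem. -/
theorem gauss_sum {a c e : ℂ} (ha : NonInt a) (hc : NonInt c) (he : NonInt e)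
    (hea : NonInt (e - a)) (hec : NonInt (e - c)) (h2 : NonInt (e - a - c))
    (h : 0 < (e - a - c).re) :
    ∑' n, gaussTerm a c e n =
      Complex.Gamma a * Complex.Gamma c * Complex.Gamma (e - a - c) /
        (Complex.Gamma (e - a) * Complex.Gamma (e - c)) := by
  set S := ∑' n, gaussTerm a c e n with hS
  -- The recurrence solved in closed form; letting N → ∞ then determines S.
  have hrec : ∀ N : ℕ, ∑' n, gaussTerm a c (e + N) n = S *
      (Complex.Gamma (e - a) * Complex.Gamma (e - c) / Complex.Gamma (e - a - c)) *
      (Complex.Gamma (e - a - c + N) / (Complex.Gamma (e - a + N) * Complex.Gamma (e - c + N))) := by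
    intro N
    induction N with
    | zero =>
      have h3 := hea.Gamma_ne_zero
      have h4 := hec.Gamma_ne_zero
      have h5 := h2.Gamma_ne_zero
      simp only [Nat.cast_zero, add_zero]
      rw [← hS]
      field_simp
    | succ N ih =>
      have hr := gauss_rec ha hc (he.add_nat N) (by
        simp at h ⊢
        have : (0 : ℝ) ≤ N := by positivity
        linarith)
      rw [ih] at hr
      rw [Gamma_add_nat_succ hea.not_pole, Gamma_add_nat_succ hec.not_pole,
        Gamma_add_nat_succ h2.not_pole]
      rw [show e + ((N + 1 : ℕ) : ℂ) = e + N + 1 by push_cast; ring]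
      have h3 := add_nat_ne_zero hea.not_pole N
      have h4 := add_nat_ne_zero hec.not_pole N
      rw [show e + (N : ℂ) - a = e - a + N by ring, show e + (N : ℂ) - c = e - c + N by ring,
        show e - a + (N : ℂ) - c = e - a - c + N by ring] at hr
      apply mul_left_cancel₀ (mul_ne_zero h3 h4)
      rw [hr]
      have h6 := Gamma_add_nat_ne_zero hea.not_pole N
      have h7 := Gamma_add_nat_ne_zero hec.not_pole N
      have h8 := h2.Gamma_ne_zero
      field_simp
  have t1 := tendsto_gauss_shift ha hc he h
  have t2 := (tendsto_Gamma_ratio₂ he.not_pole h2.not_pole hea.not_pole hec.not_pole).const_mul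
    (S * (Complex.Gamma (e - a) * Complex.Gamma (e - c) / Complex.Gamma (e - a - c)))
  have e1 := tendsto_nhds_unique t1 (t2.congr fun N => by
    rw [hrec, show e - a + (e - c) - e - (e - a - c) = 0 by ring, Complex.cpow_zero]
    ring)
  have h3 := hea.Gamma_ne_zero
  have h4 := hec.Gamma_ne_zero
  have h5 := h2.Gamma_ne_zero
  rw [e1]
  field_simp

end SaalschutzL

/-! ### The nonterminating Saalschütz theorem -/

namespace SaalschutzL

open Filter Topology

/-- The terms `Γ(a + n) Γ(b + n) Γ(c + n) / (Γ(e + n) Γ(f + n) n!)` of a `₃F₂` series at `1`. -/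
noncomputable def saalTerm (a b c e f : ℂ) (n : ℕ) : ℂ :=
  Complex.Gamma (a + n) * Complex.Gamma (b + n) * Complex.Gamma (c + n) /
    (Complex.Gamma (e + n) * Complex.Gamma (f + n) * Complex.Gamma (1 + n))

/-- Parameters of a Saalschützian `₃F₂` series in general position. -/
structure SaalGeneric (a b c e f : ℂ) : Prop where
  bal : e + f = a + b + c + 1
  na : NonInt a
  nb : NonInt b
  nc : NonInt c
  ne : NonInt e
  nf : NonInt f
  ea : NonInt (e - a)
  eb : NonInt (e - b)
  ec : NonInt (e - c)
  fa : NonInt (f - a)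
  fb : NonInt (f - b)
  fc : NonInt (f - c)
  fe : NonInt (f - e)

namespace SaalGeneric

variable {a b c e f : ℂ}

theorem dual (h : SaalGeneric a b c e f) :
    SaalGeneric (1 + a - e) (1 + b - e) (1 + c - e) (2 - e) (1 + f - e) where
  bal := by linear_combination h.bal
  na := h.ea.neg_congr 1 (by push_cast; ring)
  nb := h.eb.neg_congr 1 (by push_cast; ring)
  nc := h.ec.neg_congr 1 (by push_cast; ring)
  ne := h.ne.neg_congr 2 (by push_cast; ring)
  nf := h.fe.congr 1 (by push_cast; ring)
  ea := h.na.neg_congr 1 (by push_cast; ring)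
  eb := h.nb.neg_congr 1 (by push_cast; ring)
  ec := h.nc.neg_congr 1 (by push_cast; ring)
  fa := h.fa.congr 0 (by push_cast; ring)
  fb := h.fb.congr 0 (by push_cast; ring)
  fc := h.fc.congr 0 (by push_cast; ring)
  fe := h.nf.congr (-1) (by push_cast; ring)

theorem swap (h : SaalGeneric a b c e f) : SaalGeneric b a c e f where
  bal := by linear_combination h.bal
  na := h.nb
  nb := h.na
  nc := h.nc
  ne := h.ne
  nf := h.nf
  ea := h.eb
  eb := h.ea
  ec := h.ec
  fa := h.fb
  fb := h.fa
  fc := h.fc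
  fe := h.fe

theorem shift (h : SaalGeneric a b c e f) (m : ℤ) : SaalGeneric a (b + m) c e (f + m) where
  bal := by linear_combination h.bal
  na := h.na
  nb := h.nb.congr m (by ring)
  nc := h.nc
  ne := h.ne
  nf := h.nf.congr m (by ring)
  ea := h.ea
  eb := h.eb.congr (-m) (by push_cast; ring)
  ec := h.ec
  fa := h.fa.congr m (by ring)
  fb := h.fb.congr 0 (by push_cast; ring)
  fc := h.fc.congr m (by ring)
  fe := h.fe.congr m (by ring)

end SaalGeneric

theorem saalTerm_swap (a b c e f : ℂ) : saalTerm a b c e f = saalTerm b a c e f := by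
  funext n
  unfold saalTerm
  ring

variable {a b c e f : ℂ}

theorem summable_saalTerm (h : SaalGeneric a b c e f) : Summable (saalTerm a b c e f) := by
  obtain ⟨C, hC, hb⟩ := Gamma_ratio₃_bound h.na.not_pole h.nb.not_pole h.nc.not_pole h.ne.not_pole
    h.nf.not_pole not_pole_one
  refine Summable.of_norm_bounded ((summable_succ_rpow ?_).mul_left C) hb
  have : a + b + c - e - f - 1 = -2 := by linear_combination -h.bal
  rw [this]
  norm_num

theorem saalTerm_succ (h : SaalGeneric a b c e f) (n : ℕ) :
    saalTerm a b c e f (n + 1) = saalTerm a b c e f n *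
      ((a + n) * (b + n) * (c + n) / ((e + n) * (f + n) * (1 + n))) := by
  unfold saalTerm
  rw [Gamma_add_nat_succ h.na.not_pole, Gamma_add_nat_succ h.nb.not_pole,
    Gamma_add_nat_succ h.nc.not_pole, Gamma_add_nat_succ h.ne.not_pole,
    Gamma_add_nat_succ h.nf.not_pole, Gamma_add_nat_succ not_pole_one]
  rw [← mul_div_mul_comm]
  congr 1 <;> ring

theorem saalTerm_shift (h : SaalGeneric a b c e f) (n : ℕ) :
    saalTerm a (b + 1) c e (f + 1) n = saalTerm a b c e f n * ((b + n) / (f + n)) := by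
  unfold saalTerm
  have h1 := Gamma_add_nat_succ h.nb.not_pole n
  have h2 := Gamma_add_nat_succ h.nf.not_pole n
  rw [show b + 1 + (n : ℂ) = b + (n + 1 : ℕ) by push_cast; ring, h1,
    show f + 1 + (n : ℂ) = f + (n + 1 : ℕ) by push_cast; ring, h2, ← mul_div_mul_comm]
  congr 1 <;> ring

/-- The combination telescopes with certificate n(e+n-1) times the n-th term. Balance makes the
terms asymptotic to n^(-2), so the boundary term tends to 1 and the relation is inhomogeneous. -/
theorem saal_rec (h : SaalGeneric a b c e f) :
    (f - a) * (f - c) * ∑' n, saalTerm a (b + 1) c e (f + 1) n -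
      b * (1 + b - e) * ∑' n, saalTerm a b c e f n = 1 := by
  have s1 := summable_saalTerm h
  have s2 := summable_saalTerm (h.shift 1)
  rw [Int.cast_one] at s2
  have key := tsum_of_telescoping
    (f := fun n => (f - a) * (f - c) * saalTerm a (b + 1) c e (f + 1) n -
      b * (1 + b - e) * saalTerm a b c e f n)
    (G := fun n => n * (e + n - 1) * saalTerm a b c e f n) (l := 1)
    ((s2.mul_left _).sub (s1.mul_left _)) ?_ ?_
  · rw [(s2.mul_left _).tsum_sub (s1.mul_left _), tsum_mul_left, tsum_mul_left] at key
    simpa using key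
  · intro n
    have h1 := add_nat_ne_zero h.ne.not_pole n
    have h2 := add_nat_ne_zero not_pole_one n
    have h3 := add_nat_ne_zero h.nf.not_pole n
    rw [saalTerm_succ h, saalTerm_shift h]
    push_cast
    have h2' : (n : ℂ) + 1 ≠ 0 := by rwa [add_comm]
    have he : e = a + b + c + 1 - f := by linear_combination h.bal
    have : (n + 1 : ℂ) * (e + (n + 1) - 1) *
        (saalTerm a b c e f n * ((a + n) * (b + n) * (c + n) / ((e + n) * (f + n) * (1 + n)))) =
        saalTerm a b c e f n * ((a + n) * (b + n) * (c + n) / (f + n)) := by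
      field_simp
      ring
    rw [this]
    field_simp
    rw [he]
    ring
  · have t1 := tendsto_Gamma_ratio₃ h.na.not_pole h.nb.not_pole h.nc.not_pole h.ne.not_pole
      h.nf.not_pole not_pole_one
    have t2 := tendsto_add_nat_div 0 1
    have t3 := tendsto_add_nat_div (e - 1) 1
    have t4 := (t1.mul t2).mul t3
    rw [one_mul, one_mul] at t4
    refine t4.congr fun n => ?_
    have hexp : e + f + 1 - a - b - c = ((2 : ℕ) : ℂ) := by
      push_cast
      linear_combination h.bal
    have h2 := add_nat_ne_zero not_pole_one n
    rw [hexp, Complex.cpow_natCast, saalTerm]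
    push_cast
    have h2' : (n : ℂ) + 1 ≠ 0 := by rwa [add_comm]
    rw [zero_add, add_comm 1 (n : ℂ)] at *
    field_simp
    ring

/-- The difference of the two series in the nonterminating Saalschütz formula. -/
noncomputable def saalDiff (a b c e f : ℂ) : ℂ :=
  ∑' n, saalTerm a b c e f n -
    ∑' n, saalTerm (1 + a - e) (1 + b - e) (1 + c - e) (2 - e) (1 + f - e) n

/-- Passing to the dual parameters fixes f - a and f - c and exchanges b with 1 + b - e. Both series
thus obey the same recurrence with the same right-hand side 1, which drops out of the difference. -/
theorem saalDiff_rec (h : SaalGeneric a b c e f) :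
    (f - a) * (f - c) * saalDiff a (b + 1) c e (f + 1) =
      b * (1 + b - e) * saalDiff a b c e f := by
  have h1 := saal_rec h
  have h2 := saal_rec h.dual
  unfold saalDiff
  rw [show 1 + (b + 1) - e = 1 + b - e + 1 by ring, show 1 + (f + 1) - e = 1 + f - e + 1 by ring]
  linear_combination h1 - h2

theorem saalDiff_shift (h : SaalGeneric a b c e f) (N : ℕ) :
    saalDiff a (b + N) c e (f + N) = saalDiff a b c e f *
      (Complex.Gamma (f - a) * Complex.Gamma (f - c) /
        (Complex.Gamma b * Complex.Gamma (1 + b - e))) *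
      (Complex.Gamma (b + N) * Complex.Gamma (1 + b - e + N) /
        (Complex.Gamma (f - a + N) * Complex.Gamma (f - c + N))) := by
  have hbe := h.dual.nb
  induction N with
  | zero =>
    have h3 := h.fa.Gamma_ne_zero
    have h4 := h.fc.Gamma_ne_zero
    have h5 := h.nb.Gamma_ne_zero
    have h6 := hbe.Gamma_ne_zero
    simp only [Nat.cast_zero, add_zero]
    field_simp
  | succ N ih =>
    have hr := saalDiff_rec (h.shift N)
    rw [Int.cast_natCast, ih] at hr
    rw [Gamma_add_nat_succ h.nb.not_pole, Gamma_add_nat_succ hbe.not_pole,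
      Gamma_add_nat_succ h.fa.not_pole, Gamma_add_nat_succ h.fc.not_pole]
    rw [show b + ((N + 1 : ℕ) : ℂ) = b + N + 1 by push_cast; ring,
      show f + ((N + 1 : ℕ) : ℂ) = f + N + 1 by push_cast; ring]
    have h3 := add_nat_ne_zero h.fa.not_pole N
    have h4 := add_nat_ne_zero h.fc.not_pole N
    rw [show f + (N : ℂ) - a = f - a + N by ring, show f + (N : ℂ) - c = f - c + N by ring,
      show 1 + (b + (N : ℂ)) - e = 1 + b - e + N by ring] at hr
    apply mul_left_cancel₀ (mul_ne_zero h3 h4)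
    rw [hr]
    have h6 := Gamma_add_nat_ne_zero h.fa.not_pole N
    have h7 := Gamma_add_nat_ne_zero h.fc.not_pole N
    have h8 := h.nb.Gamma_ne_zero
    have h9 := hbe.Gamma_ne_zero
    field_simp

/-- For large N the quotient Γ(b+N+n)/Γ(f+N+n) behaves like N^(b-f) for each fixed n, leaving a
Gauss series. -/
theorem tendsto_saal_shift (h : SaalGeneric a b c e f) (hre : (f - b).re ≤ 0) :
    Tendsto (fun N : ℕ => ((N + 1 : ℕ) : ℂ) ^ (f - b) * ∑' n, saalTerm a (b + N) c e (f + N) n)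
      atTop (𝓝 (∑' n, gaussTerm a c e n)) := by
  simp_rw [← tsum_mul_left]
  obtain ⟨C, hC, hb⟩ := gaussTerm_bound h.na h.nc h.ne
  obtain ⟨D, hD, hd⟩ := Gamma_ratio_bound h.nb.not_pole h.nf.not_pole
  have e1 : ∀ N n : ℕ, ((N + 1 : ℕ) : ℂ) ^ (f - b) * saalTerm a (b + N) c e (f + N) n =
      gaussTerm a c e n * (Complex.Gamma (b + (N + n : ℕ)) / Complex.Gamma (f + (N + n : ℕ)) *
        ((N + 1 : ℕ) : ℂ) ^ (f - b)) := by
    intro N n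
    rw [saalTerm, gaussTerm, mul_comm, ← mul_assoc, ← mul_div_mul_comm]
    push_cast
    rw [add_assoc b, add_assoc f]
    congr 2 <;> ring
  simp_rw [e1]
  refine tendsto_tsum_of_dominated_convergence
    (bound := fun n : ℕ => C * D * ((n : ℝ) + 1) ^ (-2 : ℝ))
    ((summable_succ_rpow (by norm_num)).mul_left _) ?_ (Eventually.of_forall fun N n => ?_)
  · intro n
    have t1 := tendsto_Gamma_ratio (h.nb.add_nat n).not_pole (h.nf.add_nat n).not_pole
    rw [show f + (n : ℂ) - (b + n) = f - b by ring] at t1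
    have t2 := t1.const_mul (gaussTerm a c e n)
    rw [mul_one] at t2
    refine t2.congr fun N => ?_
    push_cast
    rw [add_assoc b, add_assoc f, add_comm (n : ℂ)]
  · have hn : (0 : ℝ) < (n : ℝ) + 1 := by positivity
    have hN : (0 : ℝ) < (N : ℝ) + 1 := by positivity
    rw [norm_mul, norm_mul, norm_succ_cpow]
    set β : ℝ := -(f - b).re with hβ
    have hβ0 : 0 ≤ β := by linarith
    have hd' := hd (N + n)
    rw [show (b - f).re = β by simp [hβ]] at hd'
    -- N + n + 1 ≤ (N+1)(n+1), so the growth in N is absorbed by the prefactor. The factor (n+1)^β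
    -- meets Gauss terms of order -2 - β, which gives a bound uniform in N of order -2.
    have h3 : (((N + n : ℕ) : ℝ) + 1) ^ β ≤ ((N : ℝ) + 1) ^ β * ((n : ℝ) + 1) ^ β := by
      rw [← Real.mul_rpow hN.le hn.le]
      apply Real.rpow_le_rpow (by positivity) _ hβ0
      push_cast
      have : (0 : ℝ) ≤ (N : ℝ) * n := by positivity
      nlinarith
    have h4 : ((N : ℝ) + 1) ^ (f - b).re = (((N : ℝ) + 1) ^ β)⁻¹ := by
      rw [← Real.rpow_neg hN.le, hβ, neg_neg]
    have h5 : (0 : ℝ) < ((N : ℝ) + 1) ^ β := by positivity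
    have hexp : (a + c - e - 1).re = -2 - β := by
      have : a + c - e - 1 = (f - b) - 2 := by linear_combination -h.bal
      rw [this, hβ]
      simp
      ring
    have hb' := hb n
    rw [hexp] at hb'
    rw [h4]
    calc ‖gaussTerm a c e n‖ * (‖Complex.Gamma (b + (N + n : ℕ)) / Complex.Gamma (f + (N + n : ℕ))‖ *
          (((N : ℝ) + 1) ^ β)⁻¹)
        ≤ (C * ((n : ℝ) + 1) ^ (-2 - β)) * ((D * (((N : ℝ) + 1) ^ β * ((n : ℝ) + 1) ^ β)) *
          (((N : ℝ) + 1) ^ β)⁻¹) := by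
          gcongr
          exact hd'.trans (by gcongr)
      _ = C * D * (((n : ℝ) + 1) ^ (-2 - β) * ((n : ℝ) + 1) ^ β) := by
          field_simp
      _ = C * D * ((n : ℝ) + 1) ^ (-2 : ℝ) := by
          rw [← Real.rpow_add hn]
          ring_nf

theorem Gamma_one_sub_inv {z : ℂ} (h : NonInt z) :
    (Complex.Gamma (1 - z))⁻¹ = Complex.Gamma z * Complex.sin (Real.pi * z) / Real.pi := by
  have h1 := Complex.Gamma_mul_Gamma_one_sub z
  have h2 := h.sin_ne_zero
  have h3 : NonInt (1 - z) := h.neg_congr 1 (by push_cast; ring)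
  have h4 := h3.Gamma_ne_zero
  have hπ : (Real.pi : ℂ) ≠ 0 := by exact_mod_cast Real.pi_ne_zero
  rw [eq_div_iff h2] at h1
  rw [inv_eq_one_div, div_eq_div_iff h4 hπ]
  linear_combination -h1

/-- The limit of the solved recurrence, times N^(f-b), is compared with the difference of the two
limiting Gauss sums. The condition on Re(f-b) serves both the domination and, since e - a - c = 1 -
(f - b), the convergence of the Gauss series. -/
theorem saal_formula_base (h : SaalGeneric a b c e f) (hre : (f - b).re ≤ 0) :
    saalDiff a b c e f = Complex.sin (Real.pi * e) / Real.pi *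
      (Complex.Gamma a * Complex.Gamma b * Complex.Gamma c *
        Complex.Gamma (1 + a - e) * Complex.Gamma (1 + b - e) * Complex.Gamma (1 + c - e)) /
      (Complex.Gamma (f - a) * Complex.Gamma (f - b) * Complex.Gamma (f - c)) := by
  have hd := h.dual
  have hbal := h.bal
  have t1 := tendsto_saal_shift h hre
  have t2 := tendsto_saal_shift hd (by
    rw [show 1 + f - e - (1 + b - e) = f - b by ring]; exact hre)
  rw [show 1 + f - e - (1 + b - e) = f - b by ring] at t2
  have hω : NonInt (e - a - c) := h.fb.neg_congr 1 (by push_cast; linear_combination hbal)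
  have hωre : 0 < (e - a - c).re := by
    have : e - a - c = 1 - (f - b) := by linear_combination hbal
    rw [this, Complex.sub_re, Complex.one_re]
    linarith
  have hω' : 2 - e - (1 + a - e) - (1 + c - e) = e - a - c := by ring
  rw [gauss_sum h.na h.nc h.ne h.ea h.ec hω hωre] at t1
  rw [gauss_sum hd.na hd.nc hd.ne hd.ea hd.ec (by rw [hω']; exact hω) (by rw [hω']; exact hωre),
    hω'] at t2
  have t3 := (tendsto_Gamma_ratio₂ h.nb.not_pole hd.nb.not_pole h.fa.not_pole h.fc.not_pole).const_mul
    (saalDiff a b c e f * (Complex.Gamma (f - a) * Complex.Gamma (f - c) /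
        (Complex.Gamma b * Complex.Gamma (1 + b - e))))
  have key := tendsto_nhds_unique (t1.sub t2) (t3.congr fun N => by
    rw [← mul_assoc, ← saalDiff_shift h N, ← mul_sub, saalDiff,
      show f - a + (f - c) - b - (1 + b - e) = f - b by linear_combination hbal,
      show 1 + (b + (N : ℂ)) - e = 1 + b - e + N by ring,
      show 1 + (f + (N : ℂ)) - e = 1 + f - e + N by ring]
    ring)
  have hπ : (Real.pi : ℂ) ≠ 0 := by exact_mod_cast Real.pi_ne_zero
  have r1 := Gamma_one_sub_inv hd.na
  have r2 := Gamma_one_sub_inv hd.nc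
  have r3 := Gamma_one_sub_inv h.na
  have r4 := Gamma_one_sub_inv h.nc
  have r5 := Gamma_one_sub_inv hω
  rw [show 1 - (1 + a - e) = e - a by ring] at r1
  rw [show 1 - (1 + c - e) = e - c by ring] at r2
  rw [show 1 - (e - a - c) = f - b by linear_combination -hbal] at r5
  rw [show 2 - e - (1 + a - e) = 1 - a by ring, show 2 - e - (1 + c - e) = 1 - c by ring] at key
  -- Once the reciprocal Gammas are reflected, this identity merges the two Gauss values into one
  -- product.
  have trig : Complex.sin (Real.pi * (1 + a - e)) * Complex.sin (Real.pi * (1 + c - e)) -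
      Complex.sin (Real.pi * a) * Complex.sin (Real.pi * c) =
      Complex.sin (Real.pi * e) * Complex.sin (Real.pi * (e - a - c)) := by
    have e1 : ∀ x : ℂ, Complex.sin (Real.pi * (1 + x - e)) = Complex.sin (Real.pi * e - Real.pi * x) := by
      intro x
      rw [show (Real.pi : ℂ) * (1 + x - e) = Real.pi - (Real.pi * e - Real.pi * x) by ring,
        Complex.sin_pi_sub]
    rw [e1, e1, show (Real.pi : ℂ) * (e - a - c) = Real.pi * e - Real.pi * a - Real.pi * c by ring]
    simp only [Complex.sin_sub, Complex.cos_sub]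
    have p1 := Complex.sin_sq_add_cos_sq (Real.pi * e)
    linear_combination (Complex.sin (Real.pi * a) * Complex.sin (Real.pi * c)) * p1
  have h3 := h.fa.Gamma_ne_zero
  have h4 := h.fc.Gamma_ne_zero
  have h5 := h.nb.Gamma_ne_zero
  have h6 := hd.nb.Gamma_ne_zero
  have e2 : saalDiff a b c e f = (Complex.Gamma b * Complex.Gamma (1 + b - e) /
      (Complex.Gamma (f - a) * Complex.Gamma (f - c))) *
      (saalDiff a b c e f * (Complex.Gamma (f - a) * Complex.Gamma (f - c) /
        (Complex.Gamma b * Complex.Gamma (1 + b - e))) * 1) := by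
    field_simp
  rw [e2, ← key]
  simp only [div_eq_mul_inv, mul_inv]
  rw [r1, r2, r3, r4, r5]
  generalize Complex.sin (Real.pi * (1 + a - e)) = s₁ at trig ⊢
  generalize Complex.sin (Real.pi * (1 + c - e)) = s₂ at trig ⊢
  generalize Complex.sin (Real.pi * a) = s₃ at trig ⊢
  generalize Complex.sin (Real.pi * c) = s₄ at trig ⊢
  generalize Complex.sin (Real.pi * e) = s₅ at trig ⊢
  generalize Complex.sin (Real.pi * (e - a - c)) = s₆ at trig ⊢
  field_simp
  linear_combination (Complex.Gamma a * Complex.Gamma c * Complex.Gamma (e - a - c) *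
    Complex.Gamma (1 + a - e) * Complex.Gamma (1 + c - e)) * trig

/-- The nonterminating form of Saalschütz's theorem. -/
theorem saal_formula (h : SaalGeneric a b c e f) :
    saalDiff a b c e f = Complex.sin (Real.pi * e) / Real.pi *
      (Complex.Gamma a * Complex.Gamma b * Complex.Gamma c *
        Complex.Gamma (1 + a - e) * Complex.Gamma (1 + b - e) * Complex.Gamma (1 + c - e)) /
      (Complex.Gamma (f - a) * Complex.Gamma (f - b) * Complex.Gamma (f - c)) := by
  obtain ⟨N, hN⟩ := exists_nat_ge (f - b).re
  induction N generalizing a b c e f with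
  | zero => exact saal_formula_base h (by simpa using hN)
  | succ N ih =>
    -- Lowering a and f together keeps the balance and lowers Re(f - b) by 1. The recurrence, with a
    -- in the role of b, transports the formula back.
    have h1 : SaalGeneric (a - 1) b c e (f - 1) := by
      have := (h.swap.shift (-1)).swap
      simpa [sub_eq_add_neg] using this
    have h2 := ih h1 (by
      push_cast at hN
      simp at hN ⊢
      linarith)
    have h3 := saalDiff_rec h1.swap
    have hs : ∀ x y z u v : ℂ, saalDiff x y z u v = saalDiff y x z u v := by
      intro x y z u v
      rw [saalDiff, saalDiff, saalTerm_swap, saalTerm_swap (1 + x - u)]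
    rw [sub_add_cancel, sub_add_cancel, hs b a, hs b (a - 1), h2] at h3
    have fb := h1.fb
    have fc := h1.fc
    apply mul_left_cancel₀ (mul_ne_zero fb.ne_zero fc.ne_zero)
    rw [h3]
    have g1 := Complex.Gamma_add_one _ h1.na.ne_zero
    have g2 := Complex.Gamma_add_one _ h1.dual.na.ne_zero
    have g3 := Complex.Gamma_add_one _ fb.ne_zero
    have g4 := Complex.Gamma_add_one _ fc.ne_zero
    rw [show a - 1 + 1 = a by ring] at g1
    rw [show 1 + (a - 1) - e + 1 = 1 + a - e by ring] at g2
    rw [show f - 1 - b + 1 = f - b by ring] at g3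
    rw [show f - 1 - c + 1 = f - c by ring] at g4
    rw [g1, g2, g3, g4, show f - 1 - (a - 1) = f - a by ring]
    have k1 := fb.Gamma_ne_zero
    have k2 := fc.Gamma_ne_zero
    have k3 := h.fa.Gamma_ne_zero
    have k4 := fb.ne_zero
    have k5 := fc.ne_zero
    have hπ : (Real.pi : ℂ) ≠ 0 := by exact_mod_cast Real.pi_ne_zero
    field_simp

end SaalschutzL

/-! ### Euler's transformation on coefficients -/

namespace SaalschutzL

open Filter Topology

/-- The coefficients of Euler's transformation `F(a,b;c;z) = (1-z)^(c-a-b) F(c-a,c-b;c;z)`: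
a form of the terminating Saalschütz theorem, stated by means of the recurrences
satisfied by the coefficients of the three series. -/
theorem euler_convolution {a b c w : ℂ} (hw : w = a + b - c) (hc : ∀ m : ℕ, c ≠ -m)
    {p q r : ℕ → ℂ} (hp : ∀ m : ℕ, (m + 1 : ℂ) * p (m + 1) = (w + m) * p m)
    (hq : ∀ k : ℕ, (c + k) * (k + 1) * q (k + 1) = (c - a + k) * (c - b + k) * q k)
    (hr : ∀ n : ℕ, (c + n) * (n + 1) * r (n + 1) = (a + n) * (b + n) * r n)
    (h0 : p 0 * q 0 = r 0) (n : ℕ) :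
    ∑ x ∈ Finset.HasAntidiagonal.antidiagonal n, q x.1 * p x.2 = r n := by
  rw [Finset.Nat.sum_antidiagonal_eq_sum_range_succ (fun i j => q i * p j)]
  induction n with
  | zero => simpa [mul_comm] using h0
  | succ n ih =>
    have hcn := add_nat_ne_zero hc n
    have hn : (n + 1 : ℂ) ≠ 0 := by exact_mod_cast Nat.succ_ne_zero n
    apply mul_left_cancel₀ (mul_ne_zero hcn hn)
    rw [hr, ← ih]
    -- Telescoping certificate: `G` vanishes at 0, and `G (n + 1)` is minus the summand k = n + 1,
    -- scaled by (c+n)(n+1), that the sum over k ≤ n omits.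
    let G : ℕ → ℂ := fun k => -(k * (c + k - 1) * q k * p (n + 1 - k))
    have key : ∀ k ∈ Finset.range (n + 1),
        (c + n) * (n + 1) * (q k * p (n + 1 - k)) - (a + n) * (b + n) * (q k * p (n - k)) =
          G (k + 1) - G k := by
      intro k hk
      have hk' : k ≤ n := Nat.lt_succ_iff.mp (Finset.mem_range.mp hk)
      obtain ⟨m, rfl⟩ := Nat.exists_eq_add_of_le hk'
      have e1 : k + m + 1 - k = m + 1 := by omega
      have e2 : k + m - k = m := by omega
      have e3 : k + m + 1 - (k + 1) = m := by omega
      simp only [G, e1, e2, e3]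
      have hm : (m + 1 : ℂ) ≠ 0 := by exact_mod_cast Nat.succ_ne_zero m
      have hp' : p (m + 1) = (w + m) * p m / (m + 1) := by
        rw [eq_div_iff hm, ← hp]; ring
      have hq' := hq k
      push_cast
      rw [show c + (k + 1 : ℂ) - 1 = c + k by ring]
      rw [show -((k + 1 : ℂ) * (c + k) * q (k + 1) * p m) =
        -((c + k) * (k + 1) * q (k + 1)) * p m by ring, hq', hp', hw]
      field_simp
      ring
    have hsum := Finset.sum_congr rfl key
    rw [Finset.sum_range_sub, Finset.sum_sub_distrib, ← Finset.mul_sum, ← Finset.mul_sum] at hsum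
    rw [Finset.sum_range_succ]
    simp only [G, Nat.cast_zero, Nat.sub_self] at hsum
    rw [Nat.sub_self]
    push_cast at hsum
    linear_combination hsum

theorem gaussTerm_rec {a b c : ℂ} (ha : NonInt a) (hb : NonInt b) (hc : NonInt c) (n : ℕ) :
    (c + n) * (n + 1) * gaussTerm a b c (n + 1) = (a + n) * (b + n) * gaussTerm a b c n := by
  rw [gaussTerm_succ ha hb hc]
  have h1 := add_nat_ne_zero hc.not_pole n
  have h2 := add_nat_ne_zero not_pole_one n
  rw [add_comm (n : ℂ) 1]
  field_simp

theorem binomTerm_rec {u : ℂ} (hu : NonInt u) (m : ℕ) :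
    (m + 1 : ℂ) * (Complex.Gamma (u + (m + 1 : ℕ)) / Complex.Gamma (1 + (m + 1 : ℕ))) =
      (u + m) * (Complex.Gamma (u + m) / Complex.Gamma (1 + m)) := by
  rw [Gamma_add_nat_succ hu.not_pole, Gamma_add_nat_succ not_pole_one]
  have h2 := add_nat_ne_zero not_pole_one m
  have h3 := Gamma_add_nat_ne_zero not_pole_one m
  rw [add_comm (m : ℂ) 1]
  field_simp

/-- Euler's transformation with Gamma normalization: Γ(u+m)/(Γ(u) m!) are the coefficients of
(1-z)^(-u), and the remaining prefactor matches the constant terms. -/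
theorem gaussTerm_convolution {a b c u : ℂ} (hu : u = a + b - c) (ha : NonInt a) (hb : NonInt b)
    (hc : NonInt c) (hca : NonInt (c - a)) (hcb : NonInt (c - b)) (hu' : NonInt u) (n : ℕ) :
    gaussTerm a b c n = Complex.Gamma a * Complex.Gamma b /
      (Complex.Gamma (c - a) * Complex.Gamma (c - b) * Complex.Gamma u) *
      ∑ x ∈ Finset.HasAntidiagonal.antidiagonal n, gaussTerm (c - a) (c - b) c x.1 *
        (Complex.Gamma (u + x.2) / Complex.Gamma (1 + x.2)) := by
  set κ := Complex.Gamma a * Complex.Gamma b /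
      (Complex.Gamma (c - a) * Complex.Gamma (c - b) * Complex.Gamma u) with hκ
  have g1 := hca.Gamma_ne_zero
  have g2 := hcb.Gamma_ne_zero
  have g3 := hu'.Gamma_ne_zero
  have g4 := hc.Gamma_ne_zero
  rw [Finset.mul_sum]
  rw [← euler_convolution (p := fun m => κ * (Complex.Gamma (u + m) / Complex.Gamma (1 + m)))
    (q := gaussTerm (c - a) (c - b) c) (r := gaussTerm a b c) hu hc.not_pole ?_
    (fun k => gaussTerm_rec hca hcb hc k) (fun k => gaussTerm_rec ha hb hc k) ?_ n]
  · refine Finset.sum_congr rfl fun x _ => ?_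
    ring
  · intro m
    linear_combination κ * binomTerm_rec hu' m
  · simp only [gaussTerm, hκ, Nat.cast_zero, add_zero, Complex.Gamma_one]
    field_simp

end SaalschutzL

/-! ### The one-sided transformation of a balanced ₄F₃ series -/

namespace SaalschutzL

open Filter Topology

/-- The terms of a `₄F₃` series at `1`, normalized by Gamma functions. -/
noncomputable def fourTerm (a b c d e f g : ℂ) (n : ℕ) : ℂ :=
  Complex.Gamma (a + n) * Complex.Gamma (b + n) * Complex.Gamma (c + n) * Complex.Gamma (d + n) /
    (Complex.Gamma (e + n) * Complex.Gamma (f + n) * Complex.Gamma (g + n) *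
      Complex.Gamma (1 + n))

/-- The kernel coupling the two Gauss series in the remainder of the one-sided transformation. -/
noncomputable def kernel (s t : ℂ) (k j : ℕ) : ℂ :=
  Complex.Gamma (s + (j - k)) / Complex.Gamma (t + (j - k))

theorem sin_pi_mul_add_int (z : ℂ) (m : ℤ) :
    Complex.sin (Real.pi * (z + m)) = (-1) ^ m * Complex.sin (Real.pi * z) := by
  have := m.cast_negOnePow ℂ ▸ Complex.sin_antiperiodic.add_int_mul_eq (x := Real.pi * z) m
  rw [← this]
  ring_nf

theorem Gamma_ratio_reflect {s t : ℂ} (hs : NonInt s) (ht : NonInt t) (m : ℤ) :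
    Complex.Gamma (s + m) / Complex.Gamma (t + m) =
      Complex.sin (Real.pi * t) / Complex.sin (Real.pi * s) *
        (Complex.Gamma (1 - t - m) / Complex.Gamma (1 - s - m)) := by
  have hsm : NonInt (s + m) := hs.congr m rfl
  have htm : NonInt (t + m) := ht.congr m rfl
  have r1 := Gamma_one_sub_inv hsm
  have r2 := Gamma_one_sub_inv htm
  rw [sin_pi_mul_add_int] at r1 r2
  rw [show 1 - t - (m : ℂ) = 1 - (t + m) by ring, show 1 - s - (m : ℂ) = 1 - (s + m) by ring]
  have h1 := hsm.Gamma_ne_zero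
  have h2 := htm.Gamma_ne_zero
  have h3 : NonInt (1 - (s + m)) := hsm.neg_congr 1 (by push_cast; ring)
  have h4 : NonInt (1 - (t + m)) := htm.neg_congr 1 (by push_cast; ring)
  have h3' := h3.Gamma_ne_zero
  have h4' := h4.Gamma_ne_zero
  have h5 := hs.sin_ne_zero
  have h6 := ht.sin_ne_zero
  have hπ : (Real.pi : ℂ) ≠ 0 := by exact_mod_cast Real.pi_ne_zero
  have hsgn : ((-1 : ℂ) ^ m) ≠ 0 := zpow_ne_zero _ (by norm_num)
  generalize Complex.sin (Real.pi * s) = x at *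
  generalize Complex.sin (Real.pi * t) = y at *
  generalize ((-1 : ℂ) ^ m) = ε at *
  rw [eq_div_iff hπ, inv_mul_eq_iff_eq_mul₀ (by assumption)] at r1 r2
  rw [div_mul_div_comm, div_eq_div_iff h2 (mul_ne_zero h5 h3')]
  apply mul_left_cancel₀ hsgn
  linear_combination r2 - r1

/-- Γ-reflection swaps k and j at the cost of a constant: the signs (-1)^(j-k) of the two sines
cancel. This symmetry later identifies two remainders. -/
theorem kernel_reflect {s t : ℂ} (hs : NonInt s) (ht : NonInt t) (k j : ℕ) :
    kernel s t k j = Complex.sin (Real.pi * t) / Complex.sin (Real.pi * s) *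
      kernel (1 - t) (1 - s) j k := by
  have := Gamma_ratio_reflect hs ht ((j : ℤ) - k)
  push_cast at this
  rw [kernel, this, kernel]
  ring_nf

/-- The bound is deliberately symmetric in j and k. Since s - t is unchanged under (s, t) ↦ (1 - t,
1 - s), reflection carries it to the case j ≤ k. -/
theorem kernel_bound_of_le {s t : ℂ} (hs : NonInt s) (ht : NonInt t) :
    ∃ C : ℝ, 0 < C ∧ ∀ k j : ℕ, k ≤ j → ‖kernel s t k j‖ ≤
      C * (((j : ℝ) + 1) ^ max (s - t).re 0 * ((k : ℝ) + 1) ^ max (s - t).re 0) := by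
  obtain ⟨C, hC, hb⟩ := Gamma_ratio_bound hs.not_pole ht.not_pole
  refine ⟨C, hC, fun k j hkj => ?_⟩
  obtain ⟨m, rfl⟩ := Nat.exists_eq_add_of_le hkj
  have e1 : kernel s t k (k + m) = Complex.Gamma (s + m) / Complex.Gamma (t + m) := by
    rw [kernel]
    push_cast
    rw [add_sub_cancel_left]
  rw [e1]
  refine (hb m).trans ?_
  refine mul_le_mul_of_nonneg_left ?_ hC.le
  set M := max (s - t).re 0 with hM
  have hm : (1 : ℝ) ≤ (m : ℝ) + 1 := by linarith [(Nat.cast_nonneg m : (0 : ℝ) ≤ m)]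
  have hk : (1 : ℝ) ≤ ((k : ℝ) + 1) ^ M :=
    Real.one_le_rpow (by linarith [(Nat.cast_nonneg k : (0 : ℝ) ≤ k)]) (le_max_right _ _)
  calc ((m : ℝ) + 1) ^ (s - t).re ≤ ((m : ℝ) + 1) ^ M :=
        Real.rpow_le_rpow_of_exponent_le hm (le_max_left _ _)
    _ ≤ (((k + m : ℕ) : ℝ) + 1) ^ M := by
        apply Real.rpow_le_rpow (by positivity) _ (le_max_right _ _)
        push_cast
        linarith [(Nat.cast_nonneg k : (0 : ℝ) ≤ k)]
    _ ≤ (((k + m : ℕ) : ℝ) + 1) ^ M * ((k : ℝ) + 1) ^ M :=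
        le_mul_of_one_le_right (by positivity) hk

theorem kernel_bound {s t : ℂ} (hs : NonInt s) (ht : NonInt t) :
    ∃ C : ℝ, 0 < C ∧ ∀ k j : ℕ, ‖kernel s t k j‖ ≤
      C * (((j : ℝ) + 1) ^ max (s - t).re 0 * ((k : ℝ) + 1) ^ max (s - t).re 0) := by
  obtain ⟨C, hC, hb⟩ := kernel_bound_of_le hs ht
  obtain ⟨D, hD, hd⟩ := kernel_bound_of_le (s := 1 - t) (t := 1 - s)
    (ht.neg_congr 1 (by push_cast; ring)) (hs.neg_congr 1 (by push_cast; ring))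
  set R := ‖Complex.sin (Real.pi * t) / Complex.sin (Real.pi * s)‖ with hR
  have hR0 : 0 ≤ R := norm_nonneg _
  refine ⟨C + R * D, by positivity, fun k j => ?_⟩
  set X := ((j : ℝ) + 1) ^ max (s - t).re 0 * ((k : ℝ) + 1) ^ max (s - t).re 0 with hX
  have hX0 : 0 ≤ X := by positivity
  rcases le_total k j with h | h
  · refine (hb k j h).trans (mul_le_mul_of_nonneg_right ?_ hX0)
    have : 0 ≤ R * D := by positivity
    linarith
  · rw [kernel_reflect hs ht, norm_mul]
    have h1 := hd j k h
    rw [show (1 - t - (1 - s)) = s - t by ring, mul_comm (((k : ℝ) + 1) ^ _)] at h1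
    calc R * ‖kernel (1 - t) (1 - s) j k‖ ≤ R * (D * X) := mul_le_mul_of_nonneg_left h1 hR0
      _ ≤ (C + R * D) * X := by
          have : 0 ≤ C * X := by positivity
          linarith

theorem summable_rpow_prod {s t : ℝ} (hs : s < -1) (ht : t < -1) (C : ℝ) :
    Summable fun x : ℕ × ℕ => C * (((x.1 : ℝ) + 1) ^ s * ((x.2 : ℝ) + 1) ^ t) :=
  ((summable_succ_rpow hs).mul_of_nonneg (summable_succ_rpow ht) (fun n => by positivity)
    fun n => by positivity).mul_left C

/-- Absolute convergence of the double series of two Gauss series coupled by a kernel. -/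
theorem summable_kernel {a b c a' b' c' s t : ℂ} (ha : NonInt a) (hb : NonInt b) (hc : NonInt c)
    (ha' : NonInt a') (hb' : NonInt b') (hc' : NonInt c') (hs : NonInt s) (ht : NonInt t)
    {w : ℂ} (h : a + b - c = -w) (h' : a' + b' - c' = -w) (hst : s - t = w - 1) (hw : 0 < w.re) :
    Summable fun x : ℕ × ℕ =>
      gaussTerm a b c x.1 * (gaussTerm a' b' c' x.2 * kernel s t x.1 x.2) := by
  obtain ⟨C, hC, h1⟩ := gaussTerm_bound ha hb hc
  obtain ⟨D, hD, h2⟩ := gaussTerm_bound ha' hb' hc'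
  obtain ⟨K, hK, h3⟩ := kernel_bound hs ht
  set M := max (s - t).re 0 with hM
  -- Both Re w - 1 and 0 are below Re w. Hence the exponent -Re w - 1 + M in each index is below -1.
  have hMw : M < w.re := by
    rw [hM, hst]
    simp [hw]
  refine Summable.of_norm_bounded (summable_rpow_prod (s := -w.re - 1 + M) (t := -w.re - 1 + M)
    (by linarith) (by linarith) (C * D * K)) ?_
  rintro ⟨k, j⟩
  have hk : (0 : ℝ) < (k : ℝ) + 1 := by positivity
  have hj : (0 : ℝ) < (j : ℝ) + 1 := by positivity
  have e1 : (a + b - c - 1).re = -w.re - 1 := by rw [h]; simp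
  have e2 : (a' + b' - c' - 1).re = -w.re - 1 := by rw [h']; simp
  have h1' := h1 k
  have h2' := h2 j
  rw [e1] at h1'
  rw [e2] at h2'
  simp only [norm_mul]
  calc _ ≤ (C * ((k : ℝ) + 1) ^ (-w.re - 1)) * ((D * ((j : ℝ) + 1) ^ (-w.re - 1)) *
        (K * (((j : ℝ) + 1) ^ M * ((k : ℝ) + 1) ^ M))) := by
        gcongr
        exact h3 k j
    _ = C * D * K * (((k : ℝ) + 1) ^ (-w.re - 1 + M) * ((j : ℝ) + 1) ^ (-w.re - 1 + M)) := by
        rw [Real.rpow_add hk, Real.rpow_add hj]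
        ring

/-- Parameters in general position for the one-sided transformation. -/
structure HalfGeneric (a b c d e f g w : ℂ) : Prop where
  bal : e + f + g = a + b + c + d + 1
  hw : w = c + d - g
  re_pos : 0 < w.re
  na : NonInt a
  nb : NonInt b
  nc : NonInt c
  nd : NonInt d
  ne : NonInt e
  nf : NonInt f
  ng : NonInt g
  nw : NonInt w
  gc : NonInt (g - c)
  gd : NonInt (g - d)
  ew : NonInt (e - w)
  fw : NonInt (f - w)
  ea : NonInt (e - a)
  eb : NonInt (e - b)
  fa : NonInt (f - a)
  fb : NonInt (f - b)
  fe : NonInt (f - e)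

variable {a b c d e f g w : ℂ}

theorem HalfGeneric.saal (h : HalfGeneric a b c d e f g w) (k : ℕ) :
    SaalGeneric w (a + k) (b + k) (e + k) (f + k) where
  bal := by linear_combination h.bal - h.hw
  na := h.nw
  nb := h.na.add_nat k
  nc := h.nb.add_nat k
  ne := h.ne.add_nat k
  nf := h.nf.add_nat k
  ea := h.ew.congr k (by push_cast; ring)
  eb := h.ea.congr 0 (by push_cast; ring)
  ec := h.eb.congr 0 (by push_cast; ring)
  fa := h.fw.congr k (by push_cast; ring)
  fb := h.fa.congr 0 (by push_cast; ring)
  fc := h.fb.congr 0 (by push_cast; ring)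
  fe := h.fe.congr 0 (by push_cast; ring)

theorem sin_add_nat_ratio (x y : ℂ) (k : ℕ) :
    Complex.sin (Real.pi * (x + k)) / Complex.sin (Real.pi * (y + k)) =
      Complex.sin (Real.pi * x) / Complex.sin (Real.pi * y) := by
  have h1 := sin_pi_mul_add_int x k
  have h2 := sin_pi_mul_add_int y k
  rw [Int.cast_natCast] at h1 h2
  rw [h1, h2, mul_div_mul_left]
  exact zpow_ne_zero _ (by norm_num)

/-- Reflecting Γ(1+w-e-k) leaves a quotient of sines independent of k, so k enters only through four
Gammas. These are what turns the outer Gauss terms into ₄F₃ terms. -/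
theorem HalfGeneric.saal_eval (h : HalfGeneric a b c d e f g w) (k : ℕ) :
    saalDiff w (a + k) (b + k) (e + k) (f + k) =
      Complex.sin (Real.pi * e) / Complex.sin (Real.pi * (e - w)) *
      (Complex.Gamma w * Complex.Gamma (1 + a - e) * Complex.Gamma (1 + b - e) /
        (Complex.Gamma (f - a) * Complex.Gamma (f - b))) *
      (Complex.Gamma (a + k) * Complex.Gamma (b + k) /
        (Complex.Gamma (e - w + k) * Complex.Gamma (f - w + k))) := by
  have hew : NonInt (e - w + k) := h.ew.add_nat k
  have r := Complex.Gamma_mul_Gamma_one_sub (e - w + k)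
  have hΓ := hew.Gamma_ne_zero
  have hsin := hew.sin_ne_zero
  have hπ : (Real.pi : ℂ) ≠ 0 := by exact_mod_cast Real.pi_ne_zero
  have r' : Complex.Gamma (1 + w - (e + k)) =
      Real.pi / (Complex.sin (Real.pi * (e - w + k)) * Complex.Gamma (e - w + k)) := by
    rw [show 1 + w - (e + k) = 1 - (e - w + k) by ring, eq_div_iff (mul_ne_zero hsin hΓ)]
    rw [eq_div_iff hsin] at r
    linear_combination r
  rw [saal_formula (h.saal k), r', ← sin_add_nat_ratio e (e - w) k,
    show 1 + (a + k) - (e + k) = 1 + a - e by ring, show 1 + (b + k) - (e + k) = 1 + b - e by ring,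
    show f + k - w = f - w + k by ring, show f + (k : ℂ) - (a + k) = f - a by ring,
    show f + (k : ℂ) - (b + k) = f - b by ring]
  generalize Complex.sin (Real.pi * (e + k)) = x
  generalize Complex.sin (Real.pi * (e - w + k)) = y at *
  have h1 := h.fa.Gamma_ne_zero
  have h2 := h.fb.Gamma_ne_zero
  have h3 := (h.fw.add_nat k).Gamma_ne_zero
  field_simp

/-- The terms of the double series obtained by expanding a `₄F₃` series by Euler's transformation. -/
noncomputable def doubleTerm (a b c d e f g w : ℂ) (x : ℕ × ℕ) : ℂ :=
  gaussTerm (g - c) (g - d) g x.1 * saalTerm w (a + x.1) (b + x.1) (e + x.1) (f + x.1) x.2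

theorem doubleTerm_eq (x : ℕ × ℕ) :
    doubleTerm a b c d e f g w x = gaussTerm (g - c) (g - d) g x.1 *
      (Complex.Gamma (w + x.2) / Complex.Gamma (1 + x.2)) *
      (Complex.Gamma (a + (x.1 + x.2 : ℕ)) * Complex.Gamma (b + (x.1 + x.2 : ℕ)) /
        (Complex.Gamma (e + (x.1 + x.2 : ℕ)) * Complex.Gamma (f + (x.1 + x.2 : ℕ)))) := by
  rw [doubleTerm, saalTerm]
  push_cast
  simp only [← add_assoc]
  ring

/-- The factor in k + m is bounded by its value at m. The exponents become -Re w - 1 in k and (Re w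
- 1) + (-Re w - 1) = -2 in m, so `re_pos` suffices. -/
theorem summable_doubleTerm (h : HalfGeneric a b c d e f g w) :
    Summable (doubleTerm a b c d e f g w) := by
  obtain ⟨C, hC, h1⟩ := gaussTerm_bound h.gc h.gd h.ng
  obtain ⟨D, hD, h2⟩ := Gamma_ratio_bound h.nw.not_pole not_pole_one
  obtain ⟨K, hK, h3⟩ := Gamma_ratio₂_bound h.na.not_pole h.nb.not_pole h.ne.not_pole h.nf.not_pole
  have hpos := h.re_pos
  refine Summable.of_norm_bounded (summable_rpow_prod (s := -w.re - 1) (t := -2)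
    (by linarith) (by norm_num) (C * D * K)) ?_
  rintro ⟨k, m⟩
  have hm : (0 : ℝ) < (m : ℝ) + 1 := by positivity
  have e1 : (g - c + (g - d) - g - 1).re = -w.re - 1 := by rw [h.hw]; simp; ring
  have e2 : (w - 1).re = w.re - 1 := by simp
  have e3 : (a + b - e - f).re = -w.re - 1 := by
    rw [show a + b - e - f = -w - 1 by linear_combination -h.bal + h.hw]; simp
  have h1' := h1 k
  have h2' := h2 m
  have h3' := h3 (k + m)
  rw [e1] at h1'
  rw [e2] at h2'
  rw [e3] at h3'
  have h4 : (((k + m : ℕ) : ℝ) + 1) ^ (-w.re - 1) ≤ ((m : ℝ) + 1) ^ (-w.re - 1) := by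
    apply Real.rpow_le_rpow_of_nonpos hm _ (by linarith)
    push_cast
    linarith [(Nat.cast_nonneg k : (0 : ℝ) ≤ k)]
  rw [doubleTerm_eq, norm_mul, norm_mul]
  calc _ ≤ (C * ((k : ℝ) + 1) ^ (-w.re - 1)) * (D * ((m : ℝ) + 1) ^ (w.re - 1)) *
        (K * ((m : ℝ) + 1) ^ (-w.re - 1)) := by
        gcongr
        exact h3'.trans (by gcongr)
    _ = C * D * K * (((k : ℝ) + 1) ^ (-w.re - 1) *
          (((m : ℝ) + 1) ^ (w.re - 1) * ((m : ℝ) + 1) ^ (-w.re - 1))) := by ring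
    _ = C * D * K * (((k : ℝ) + 1) ^ (-w.re - 1) * ((m : ℝ) + 1) ^ (-2 : ℝ)) := by
        rw [← Real.rpow_add hm]
        ring_nf

/-- Each n-th term is an antidiagonal sum by Euler's transformation; absolute convergence permits
regrouping by rows. -/
theorem tsum_fourTerm_eq_double (h : HalfGeneric a b c d e f g w) :
    ∑' n, fourTerm a b c d e f g n =
      Complex.Gamma c * Complex.Gamma d /
        (Complex.Gamma (g - c) * Complex.Gamma (g - d) * Complex.Gamma w) *
      ∑' k, ∑' m, doubleTerm a b c d e f g w (k, m) := by
  have hs := summable_doubleTerm h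
  have hs' : Summable fun x : Σ n : ℕ, Finset.HasAntidiagonal.antidiagonal n =>
      doubleTerm a b c d e f g w (Finset.HasAntidiagonal.sigmaAntidiagonalEquivProd x) :=
    Finset.HasAntidiagonal.sigmaAntidiagonalEquivProd.summable_iff.mpr hs
  rw [← hs.tsum_prod, ← Finset.HasAntidiagonal.sigmaAntidiagonalEquivProd.tsum_eq,
    hs'.tsum_sigma' (fun n => (hasSum_fintype _).summable), ← tsum_mul_left]
  refine tsum_congr fun n => ?_
  have e1 : fourTerm a b c d e f g n = gaussTerm c d g n *
      (Complex.Gamma (a + n) * Complex.Gamma (b + n) /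
        (Complex.Gamma (e + n) * Complex.Gamma (f + n))) := by
    rw [fourTerm, gaussTerm]
    ring
  rw [e1, gaussTerm_convolution h.hw h.nc h.nd h.ng h.gc h.gd h.nw, tsum_fintype,
    mul_assoc, Finset.sum_mul]
  congr 1
  rw [Finset.univ_eq_attach, ← Finset.sum_attach]
  refine Finset.sum_congr rfl fun x _ => ?_
  have hx := Finset.HasAntidiagonal.mem_antidiagonal.mp x.2
  rw [Finset.HasAntidiagonal.sigmaAntidiagonalEquivProd_apply, doubleTerm_eq, hx]

theorem summable_fourTerm (h : e + f + g = a + b + c + d + 1) (na : NonInt a) (nb : NonInt b)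
    (nc : NonInt c) (nd : NonInt d) (ne : NonInt e) (nf : NonInt f) (ng : NonInt g) :
    Summable (fourTerm a b c d e f g) := by
  obtain ⟨C, hC, h1⟩ := Gamma_ratio₃_bound na.not_pole nb.not_pole nc.not_pole
    ne.not_pole nf.not_pole ng.not_pole
  obtain ⟨D, hD, h2⟩ := Gamma_ratio_bound nd.not_pole not_pole_one
  refine Summable.of_norm_bounded
    ((summable_succ_rpow (s := -2) (by norm_num)).mul_left (C * D)) fun n => ?_
  have hn : (0 : ℝ) < (n : ℝ) + 1 := by positivity
  rw [fourTerm, mul_div_mul_comm, norm_mul]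
  calc _ ≤ (C * ((n : ℝ) + 1) ^ (a + b + c - e - f - g).re) * (D * ((n : ℝ) + 1) ^ (d - 1).re) :=
        mul_le_mul (h1 n) (h2 n) (norm_nonneg _) (by positivity)
    _ = C * D * ((n : ℝ) + 1) ^ (-2 : ℝ) := by
        have : (a + b + c - e - f - g).re + (d - 1).re = -2 := by
          rw [← Complex.add_re, show a + b + c - e - f - g + (d - 1) = -2 by
            linear_combination -h]
          simp
        rw [← this, Real.rpow_add hn]
        ring

/-- One-sided transformation of a balanced `₄F₃` series. -/
theorem fourTerm_half (h : HalfGeneric a b c d e f g w) :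
    ∑' n, fourTerm a b c d e f g n =
      Complex.sin (Real.pi * e) * Complex.Gamma c * Complex.Gamma d * Complex.Gamma (1 + a - e) *
          Complex.Gamma (1 + b - e) /
        (Complex.sin (Real.pi * (e - w)) * Complex.Gamma (g - c) * Complex.Gamma (g - d) *
          Complex.Gamma (f - a) * Complex.Gamma (f - b)) *
        ∑' n, fourTerm a b (g - c) (g - d) (e - w) (f - w) g n +
      Complex.Gamma c * Complex.Gamma d /
        (Complex.Gamma (g - c) * Complex.Gamma (g - d) * Complex.Gamma w) *
        ∑' k, ∑' j, gaussTerm (g - c) (g - d) g k *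
          (gaussTerm (1 + a - e) (1 + b - e) (1 + f - e) j *
            kernel (1 + w - e) (2 - e) k j) := by
  set Q := Complex.sin (Real.pi * e) / Complex.sin (Real.pi * (e - w)) *
      (Complex.Gamma w * Complex.Gamma (1 + a - e) * Complex.Gamma (1 + b - e) /
        (Complex.Gamma (f - a) * Complex.Gamma (f - b))) with hQ
  have hs := summable_doubleTerm h
  have hs4 : Summable (fourTerm a b (g - c) (g - d) (e - w) (f - w) g) :=
    summable_fourTerm (by linear_combination h.bal - 2 * h.hw) h.na h.nb h.gc h.gd h.ew h.fw h.ng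
  -- In the dual ₃F₂ only 1+w-e-k and 2-e-k depend on k. They form the kernel, while the rest is a
  -- Gauss term in j.
  have e1 : ∀ k : ℕ, ∑' m, doubleTerm a b c d e f g w (k, m) =
      Q * fourTerm a b (g - c) (g - d) (e - w) (f - w) g k +
      ∑' j, gaussTerm (g - c) (g - d) g k *
          (gaussTerm (1 + a - e) (1 + b - e) (1 + f - e) j *
            kernel (1 + w - e) (2 - e) k j) := by
    intro k
    have h1 := h.saal_eval k
    rw [← hQ, saalDiff, sub_eq_iff_eq_add] at h1
    simp only [doubleTerm]
    rw [tsum_mul_left, h1, tsum_mul_left, mul_add]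
    congr 1
    · rw [gaussTerm, fourTerm]
      ring
    · congr 1
      refine tsum_congr fun j => ?_
      rw [saalTerm, gaussTerm, kernel]
      rw [show 1 + w - (e + k) + (j : ℂ) = 1 + w - e + (j - k) by ring,
        show 2 - (e + k) + (j : ℂ) = 2 - e + (j - k) by ring,
        show 1 + (a + k) - (e + k) + (j : ℂ) = 1 + a - e + j by ring,
        show 1 + (b + k) - (e + k) + (j : ℂ) = 1 + b - e + j by ring,
        show 1 + (f + k) - (e + k) + (j : ℂ) = 1 + f - e + j by ring]
      ring
  have hs1 := hs.prod
  have hs2 : Summable fun k => ∑' j, gaussTerm (g - c) (g - d) g k *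
          (gaussTerm (1 + a - e) (1 + b - e) (1 + f - e) j *
            kernel (1 + w - e) (2 - e) k j) := by
    have := hs1.sub (hs4.mul_left Q)
    refine this.congr fun k => ?_
    rw [e1]
    ring
  rw [tsum_fourTerm_eq_double h, tsum_congr e1, (hs4.mul_left Q).tsum_add hs2, tsum_mul_left,
    mul_add, ← mul_assoc]
  congr 2
  have h1 := h.nw.Gamma_ne_zero
  have h6 := h.ew.sin_ne_zero
  rw [hQ]
  generalize Complex.sin (Real.pi * (e - w)) = y at *
  generalize Complex.sin (Real.pi * e) = x
  have h2 := h.fa.Gamma_ne_zero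
  have h3 := h.fb.Gamma_ne_zero
  have h4 := h.gc.Gamma_ne_zero
  have h5 := h.gd.Gamma_ne_zero
  field_simp

end SaalschutzL

/-! ### Invariance of L under the reflection A -/

namespace SaalschutzL

open Filter Topology

/-- Parameters in general position for the reflection `c ↦ g - c`, `d ↦ g - d`,
`e ↦ e + (g - c - d)`, `f ↦ f + (g - c - d)`. -/
structure ReflGeneric (a b c d e f g : ℂ) : Prop where
  bal : e + f + g = a + b + c + d + 1
  na : NonInt a
  nb : NonInt b
  nc : NonInt c
  nd : NonInt d
  ne : NonInt e
  nf : NonInt f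
  ng : NonInt g
  ea : NonInt (e - a)
  eb : NonInt (e - b)
  ec : NonInt (e - c)
  ed : NonInt (e - d)
  fa : NonInt (f - a)
  fb : NonInt (f - b)
  gc : NonInt (g - c)
  gd : NonInt (g - d)
  fe : NonInt (f - e)
  ge : NonInt (g - e)
  nu : NonInt (g - c - d)
  eu : NonInt (e + (g - c - d))
  fu : NonInt (f + (g - c - d))
  geu : NonInt (g - (e + (g - c - d)))

variable {a b c d e f g : ℂ}

theorem ReflGeneric.reflect (h : ReflGeneric a b c d e f g) :
    ReflGeneric a b (g - c) (g - d) (e + (g - c - d)) (f + (g - c - d)) g where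
  bal := by linear_combination h.bal
  na := h.na
  nb := h.nb
  nc := h.gc
  nd := h.gd
  ne := h.eu
  nf := h.fu
  ng := h.ng
  ea := h.fb.neg_congr 1 (by push_cast; linear_combination h.bal)
  eb := h.fa.neg_congr 1 (by push_cast; linear_combination h.bal)
  ec := h.ed.congr 0 (by push_cast; ring)
  ed := h.ec.congr 0 (by push_cast; ring)
  fa := h.eb.neg_congr 1 (by push_cast; linear_combination h.bal)
  fb := h.ea.neg_congr 1 (by push_cast; linear_combination h.bal)
  gc := h.nc.congr 0 (by push_cast; ring)
  gd := h.nd.congr 0 (by push_cast; ring)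
  fe := h.fe.congr 0 (by push_cast; ring)
  ge := h.geu
  nu := h.nu.neg_congr 0 (by push_cast; ring)
  eu := h.ne.congr 0 (by push_cast; ring)
  fu := h.nf.congr 0 (by push_cast; ring)
  geu := h.ge.congr 0 (by push_cast; ring)

theorem ReflGeneric.half (h : ReflGeneric a b c d e f g) (hre : 0 < (g - c - d).re) :
    HalfGeneric a b (g - c) (g - d) (e + (g - c - d)) (f + (g - c - d)) g (g - c - d) where
  bal := h.reflect.bal
  hw := by ring
  re_pos := hre
  na := h.na
  nb := h.nb
  nc := h.gc
  nd := h.gd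
  ne := h.eu
  nf := h.fu
  ng := h.ng
  nw := h.nu
  gc := h.reflect.gc
  gd := h.reflect.gd
  ew := h.ne.congr 0 (by push_cast; ring)
  fw := h.nf.congr 0 (by push_cast; ring)
  ea := h.reflect.ea
  eb := h.reflect.eb
  fa := h.reflect.fa
  fb := h.reflect.fb
  fe := h.reflect.fe

/-- The second series of `L`, ordered so that 1+a-e, 1+b-e and 1+f-e take the roles of c, d and g.
Its w is then again g - c - d. -/
theorem ReflGeneric.half_dual (h : ReflGeneric a b c d e f g) (hre : 0 < (g - c - d).re) :
    HalfGeneric (1 + c - e) (1 + d - e) (1 + a - e) (1 + b - e) (2 - e) (1 + g - e) (1 + f - e)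
      (g - c - d) where
  bal := by linear_combination h.bal
  hw := by linear_combination h.bal
  re_pos := hre
  na := h.ec.neg_congr 1 (by push_cast; ring)
  nb := h.ed.neg_congr 1 (by push_cast; ring)
  nc := h.ea.neg_congr 1 (by push_cast; ring)
  nd := h.eb.neg_congr 1 (by push_cast; ring)
  ne := h.ne.neg_congr 2 (by push_cast; ring)
  nf := h.ge.congr 1 (by push_cast; ring)
  ng := h.fe.congr 1 (by push_cast; ring)
  nw := h.nu
  gc := h.fa.congr 0 (by push_cast; ring)
  gd := h.fb.congr 0 (by push_cast; ring)
  ew := h.eu.neg_congr 2 (by push_cast; ring)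
  fw := h.geu.congr 1 (by push_cast; ring)
  ea := h.nc.neg_congr 1 (by push_cast; ring)
  eb := h.nd.neg_congr 1 (by push_cast; ring)
  fa := h.gc.congr 0 (by push_cast; ring)
  fb := h.gd.congr 0 (by push_cast; ring)
  fe := h.ng.congr (-1) (by push_cast; ring)

/-- The two-term combination of Gamma-normalized `₄F₃` series underlying `L`. -/
noncomputable def fourDiff (a b c d e f g : ℂ) : ℂ :=
  ∑' n, fourTerm a b c d e f g n -
    ∑' n, fourTerm (1 + a - e) (1 + b - e) (1 + c - e) (1 + d - e) (1 + f - e) (1 + g - e) (2 - e) n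

/-- The one-sided transformation relates the first series of the reflected parameters to that of the
original ones, and the second series of the original parameters to that of the reflected ones. The
two remainders are proportional and cancel. -/
theorem fourDiff_reflect (h : ReflGeneric a b c d e f g) (hre : 0 < (g - c - d).re) :
    Complex.sin (Real.pi * e) * Complex.Gamma c * Complex.Gamma d * Complex.Gamma (1 + a - e) *
        Complex.Gamma (1 + b - e) *
        fourDiff a b (g - c) (g - d) (e + (g - c - d)) (f + (g - c - d)) g =
      Complex.sin (Real.pi * (e + (g - c - d))) * Complex.Gamma (g - c) * Complex.Gamma (g - d) *
        Complex.Gamma (f - a) * Complex.Gamma (f - b) * fourDiff a b c d e f g := by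
  have bal := h.bal
  have H1 := fourTerm_half (h.half hre)
  have H2 := fourTerm_half (h.half_dual hre)
  set u := g - c - d with hu
  rw [show e + u - u = e by ring, show f + u - u = f by ring, show g - (g - c) = c by ring,
    show g - (g - d) = d by ring, show 1 + a - (e + u) = f - b by rw [hu]; linear_combination -bal,
    show 1 + b - (e + u) = f - a by rw [hu]; linear_combination -bal,
    show f + u - a = 1 + b - e by rw [hu]; linear_combination bal,
    show f + u - b = 1 + a - e by rw [hu]; linear_combination bal,
    show 1 + (f + u) - (e + u) = 1 + f - e by ring, show 1 + u - (e + u) = 1 - e by ring,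
    ] at H1
  rw [show 1 + f - e - (1 + a - e) = f - a by ring, show 1 + f - e - (1 + b - e) = f - b by ring,
    show 1 + (1 + c - e) - (2 - e) = c by ring, show 1 + (1 + d - e) - (2 - e) = d by ring,
    show 1 + g - e - (1 + c - e) = g - c by ring, show 1 + g - e - (1 + d - e) = g - d by ring,
    show 1 + (1 + g - e) - (2 - e) = g by ring, show 2 - (2 - e) = e by ring,
    show 1 + u - (2 - e) = e + u - 1 by ring] at H2
  have hsw : ∀ n, fourTerm (1 + c - e) (1 + d - e) (f - a) (f - b) (2 - e - u) (1 + g - e - u)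
      (1 + f - e) n = fourTerm (1 + a - (e + u)) (1 + b - (e + u)) (1 + (g - c) - (e + u))
        (1 + (g - d) - (e + u)) (1 + (f + u) - (e + u)) (1 + g - (e + u)) (2 - (e + u)) n := by
    intro n
    rw [show 1 + a - (e + u) = f - b by rw [hu]; linear_combination -bal,
      show 1 + b - (e + u) = f - a by rw [hu]; linear_combination -bal,
      show 1 + (g - c) - (e + u) = 1 + d - e by rw [hu]; ring,
      show 1 + (g - d) - (e + u) = 1 + c - e by rw [hu]; ring,
      show 1 + (f + u) - (e + u) = 1 + f - e by ring,
      show 1 + g - (e + u) = 1 + g - e - u by ring, show 2 - (e + u) = 2 - e - u by ring]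
    unfold fourTerm
    ring
  have hsw2 : ∀ n, fourTerm (1 + c - e) (1 + d - e) (1 + a - e) (1 + b - e) (2 - e) (1 + g - e)
      (1 + f - e) n = fourTerm (1 + a - e) (1 + b - e) (1 + c - e) (1 + d - e) (1 + f - e)
        (1 + g - e) (2 - e) n := by
    intro n
    unfold fourTerm
    ring
  rw [tsum_congr hsw, tsum_congr hsw2] at H2
  have hs1 : NonInt (1 - e) := h.ne.neg_congr 1 (by push_cast; ring)
  have ht1 : NonInt (2 - (e + u)) := h.eu.neg_congr 2 (by push_cast; ring)
  have h1fe : NonInt (1 + f - e) := h.fe.congr 1 (by push_cast; ring)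
  have hs2 : NonInt (e + u - 1) := h.eu.congr (-1) (by push_cast; ring)
  have hsum := summable_kernel h.nc h.nd h.ng h.fb h.fa h1fe hs1 ht1 (w := u)
    (by rw [hu]; ring) (by rw [hu]; linear_combination bal) (by ring) hre
  -- The two remainders contain the same Gauss series with k and j exchanged; Fubini and the kernel
  -- reflection identify them. The minus sign comes from sin π(e+u-1).
  have hcomm : ∑' k, ∑' j, gaussTerm (f - a) (f - b) (1 + f - e) k *
      (gaussTerm c d g j * kernel (e + u - 1) e k j) =
      -(Complex.sin (Real.pi * e) / Complex.sin (Real.pi * (e + u))) *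
      ∑' k, ∑' j, gaussTerm c d g k *
        (gaussTerm (f - b) (f - a) (1 + f - e) j * kernel (1 - e) (2 - (e + u)) k j) := by
    have hk : ∀ k j, kernel (e + u - 1) e k j =
        -(Complex.sin (Real.pi * e) / Complex.sin (Real.pi * (e + u))) *
          kernel (1 - e) (2 - (e + u)) j k := by
      intro k j
      rw [kernel_reflect hs2 h.ne, show 1 - (e + u - 1) = 2 - (e + u) by ring]
      have := sin_pi_mul_add_int (e + u) (-1)
      push_cast at this
      rw [show e + u - 1 = e + u + -1 by ring, this]
      simp [div_neg]
    have hg : ∀ k, gaussTerm (f - a) (f - b) (1 + f - e) k =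
        gaussTerm (f - b) (f - a) (1 + f - e) k := by
      intro k
      unfold gaussTerm
      ring
    rw [← hsum.tsum_comm (f := fun k j => gaussTerm c d g k *
        (gaussTerm (f - b) (f - a) (1 + f - e) j * kernel (1 - e) (2 - (e + u)) k j)),
      ← tsum_mul_left]
    refine tsum_congr fun k => ?_
    rw [← tsum_mul_left]
    refine tsum_congr fun j => ?_
    rw [hk, hg]
    ring
  rw [hcomm] at H2
  have e2 : ∀ z : ℂ, Complex.sin (Real.pi * (2 - z)) = -Complex.sin (Real.pi * z) := by
    intro z
    rw [show (Real.pi : ℂ) * (2 - z) = 2 * Real.pi - Real.pi * z by ring,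
      Complex.sin_two_pi_sub]
  rw [show 2 - e - u = 2 - (e + u) by ring, e2, e2] at H2
  have s1 := h.ne.sin_ne_zero
  have s2 := h.eu.sin_ne_zero
  rw [← hu] at s2
  unfold fourDiff
  rw [H1, H2]
  have g1 := h.nc.Gamma_ne_zero
  have g2 := h.nd.Gamma_ne_zero
  have g3 := h.gc.Gamma_ne_zero
  have g4 := h.gd.Gamma_ne_zero
  have g5 := h.fa.Gamma_ne_zero
  have g6 := h.fb.Gamma_ne_zero
  have g7 : Complex.Gamma (1 + a - e) ≠ 0 :=
    (h.ea.neg_congr 1 (by push_cast; ring) : NonInt (1 + a - e)).Gamma_ne_zero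
  have g8 : Complex.Gamma (1 + b - e) ≠ 0 :=
    (h.eb.neg_congr 1 (by push_cast; ring) : NonInt (1 + b - e)).Gamma_ne_zero
  have g9 := h.nu.Gamma_ne_zero
  rw [← hu] at g9
  generalize ∑' k, ∑' j, gaussTerm c d g k *
        (gaussTerm (f - b) (f - a) (1 + f - e) j * kernel (1 - e) (2 - (e + u)) k j) = D
  generalize ∑' n, fourTerm a b c d e f g n = X
  generalize ∑' n, fourTerm (1 + a - (e + u)) (1 + b - (e + u)) (1 + (g - c) - (e + u))
        (1 + (g - d) - (e + u)) (1 + (f + u) - (e + u)) (1 + g - (e + u)) (2 - (e + u)) n = Y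
  generalize Complex.sin (Real.pi * e) = σ at *
  generalize Complex.sin (Real.pi * (e + u)) = σ' at *
  generalize Complex.Gamma c = γ₁ at *
  generalize Complex.Gamma d = γ₂ at *
  generalize Complex.Gamma (g - c) = γ₃ at *
  generalize Complex.Gamma (g - d) = γ₄ at *
  generalize Complex.Gamma (f - a) = γ₅ at *
  generalize Complex.Gamma (f - b) = γ₆ at *
  generalize Complex.Gamma (1 + a - e) = γ₇ at *
  generalize Complex.Gamma (1 + b - e) = γ₈ at *
  generalize Complex.Gamma u = γ₉ at *
  field_simp
  ring

theorem hypTerm_four (a b c d e f g : ℂ) (n : ℕ) :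
    hypTerm ![a, b, c, d] ![e, f, g] 1 n =
      ((ascPochhammer ℂ n).eval a * (ascPochhammer ℂ n).eval b * (ascPochhammer ℂ n).eval c *
        (ascPochhammer ℂ n).eval d) /
      ((n.factorial : ℂ) * ((ascPochhammer ℂ n).eval e * (ascPochhammer ℂ n).eval f *
        (ascPochhammer ℂ n).eval g)) := by
  rw [hypTerm, one_pow, mul_one, Fin.prod_univ_three]
  congr 1
  exact Fin.prod_univ_four _

theorem hyp_eq_fourTerm (na : NonInt a) (nb : NonInt b) (nc : NonInt c) (nd : NonInt d)
    (ne : NonInt e) (nf : NonInt f) (ng : NonInt g) :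
    hyp ![a, b, c, d] ![e, f, g] 1 =
      Complex.Gamma e * Complex.Gamma f * Complex.Gamma g /
        (Complex.Gamma a * Complex.Gamma b * Complex.Gamma c * Complex.Gamma d) *
      ∑' n, fourTerm a b c d e f g n := by
  rw [hyp, ← tsum_mul_left]
  refine tsum_congr fun n => ?_
  rw [hypTerm_four, ← Complex.Gamma_add_nat_div_Gamma_eq _ na.not_pole,
    ← Complex.Gamma_add_nat_div_Gamma_eq _ nb.not_pole,
    ← Complex.Gamma_add_nat_div_Gamma_eq _ nc.not_pole,
    ← Complex.Gamma_add_nat_div_Gamma_eq _ nd.not_pole,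
    ← Complex.Gamma_add_nat_div_Gamma_eq _ ne.not_pole,
    ← Complex.Gamma_add_nat_div_Gamma_eq _ nf.not_pole,
    ← Complex.Gamma_add_nat_div_Gamma_eq _ ng.not_pole, fourTerm, Gamma_one_add_nat]
  have g1 := na.Gamma_ne_zero
  have g2 := nb.Gamma_ne_zero
  have g3 := nc.Gamma_ne_zero
  have g4 := nd.Gamma_ne_zero
  have g5 := (ne.add_nat n).Gamma_ne_zero
  have g6 := (nf.add_nat n).Gamma_ne_zero
  have g7 := (ng.add_nat n).Gamma_ne_zero
  have g8 := ne.Gamma_ne_zero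
  have g9 := nf.Gamma_ne_zero
  have g10 := ng.Gamma_ne_zero
  have g11 : ((n.factorial : ℕ) : ℂ) ≠ 0 := by exact_mod_cast Nat.factorial_ne_zero n
  field_simp

theorem L_eq_fourDiff (h : ReflGeneric a b c d e f g) :
    L a b c d e f g = fourDiff a b c d e f g /
      (Complex.sin (Real.pi * e) *
        (Complex.Gamma a * Complex.Gamma b * Complex.Gamma c * Complex.Gamma d) *
        (Complex.Gamma (1 + a - e) * Complex.Gamma (1 + b - e) * Complex.Gamma (1 + c - e) *
          Complex.Gamma (1 + d - e))) := by
  have ia : NonInt (1 + a - e) := h.ea.neg_congr 1 (by push_cast; ring)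
  have ib : NonInt (1 + b - e) := h.eb.neg_congr 1 (by push_cast; ring)
  have ic : NonInt (1 + c - e) := h.ec.neg_congr 1 (by push_cast; ring)
  have id : NonInt (1 + d - e) := h.ed.neg_congr 1 (by push_cast; ring)
  have jf : NonInt (1 + f - e) := h.fe.congr 1 (by push_cast; ring)
  have jg : NonInt (1 + g - e) := h.ge.congr 1 (by push_cast; ring)
  have je : NonInt (2 - e) := h.ne.neg_congr 2 (by push_cast; ring)
  rw [L, hyp_eq_fourTerm h.na h.nb h.nc h.nd h.ne h.nf h.ng,
    hyp_eq_fourTerm ia ib ic id jf jg je, fourDiff]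
  have g1 := h.na.Gamma_ne_zero
  have g2 := h.nb.Gamma_ne_zero
  have g3 := h.nc.Gamma_ne_zero
  have g4 := h.nd.Gamma_ne_zero
  have g5 := h.ne.Gamma_ne_zero
  have g6 := h.nf.Gamma_ne_zero
  have g7 := h.ng.Gamma_ne_zero
  have g8 := ia.Gamma_ne_zero
  have g9 := ib.Gamma_ne_zero
  have g10 := ic.Gamma_ne_zero
  have g11 := id.Gamma_ne_zero
  have g12 := jf.Gamma_ne_zero
  have g13 := jg.Gamma_ne_zero
  have g14 := je.Gamma_ne_zero
  have hs := h.ne.sin_ne_zero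
  generalize Complex.sin (Real.pi * e) = σ at *
  field_simp

theorem L_reflect_of_pos (h : ReflGeneric a b c d e f g) (hre : 0 < (g - c - d).re) :
    L a b c d e f g = L a b (g - c) (g - d) (e + (g - c - d)) (f + (g - c - d)) g := by
  have bal := h.bal
  have key := fourDiff_reflect h hre
  rw [L_eq_fourDiff h, L_eq_fourDiff h.reflect]
  set u := g - c - d with hu
  rw [show 1 + a - (e + u) = f - b by rw [hu]; linear_combination -bal,
      show 1 + b - (e + u) = f - a by rw [hu]; linear_combination -bal,
      show 1 + (g - c) - (e + u) = 1 + d - e by rw [hu]; ring,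
      show 1 + (g - d) - (e + u) = 1 + c - e by rw [hu]; ring]
  have s1 := h.ne.sin_ne_zero
  have s2 := h.eu.sin_ne_zero
  rw [← hu] at s2
  have g1 := h.nc.Gamma_ne_zero
  have g2 := h.nd.Gamma_ne_zero
  have g3 := h.gc.Gamma_ne_zero
  have g4 := h.gd.Gamma_ne_zero
  have g5 := h.fa.Gamma_ne_zero
  have g6 := h.fb.Gamma_ne_zero
  have g7 : Complex.Gamma (1 + a - e) ≠ 0 :=
    (h.ea.neg_congr 1 (by push_cast; ring) : NonInt (1 + a - e)).Gamma_ne_zero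
  have g8 : Complex.Gamma (1 + b - e) ≠ 0 :=
    (h.eb.neg_congr 1 (by push_cast; ring) : NonInt (1 + b - e)).Gamma_ne_zero
  have g9 : Complex.Gamma (1 + c - e) ≠ 0 :=
    (h.ec.neg_congr 1 (by push_cast; ring) : NonInt (1 + c - e)).Gamma_ne_zero
  have g10 : Complex.Gamma (1 + d - e) ≠ 0 :=
    (h.ed.neg_congr 1 (by push_cast; ring) : NonInt (1 + d - e)).Gamma_ne_zero
  have g11 := h.na.Gamma_ne_zero
  have g12 := h.nb.Gamma_ne_zero
  generalize Complex.sin (Real.pi * e) = σ at *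
  generalize Complex.sin (Real.pi * (e + u)) = σ' at *
  rw [div_eq_div_iff (by simp [*]) (by simp [*])]
  linear_combination (-(Complex.Gamma a * Complex.Gamma b * Complex.Gamma (1 + c - e) *
    Complex.Gamma (1 + d - e))) * key

/-- The reflection is an involution that negates g - c - d, so a negative real part reduces to a
positive one. -/
theorem L_reflect (h : ReflGeneric a b c d e f g) (hre : (g - c - d).re ≠ 0) :
    L a b c d e f g = L a b (g - c) (g - d) (e + (g - c - d)) (f + (g - c - d)) g := by
  rcases lt_or_gt_of_ne hre with h1 | h1
  · have := L_reflect_of_pos h.reflect (by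
      rw [show g - (g - c) - (g - d) = -(g - c - d) by ring, Complex.neg_re]
      linarith)
    rw [this]
    congr 1 <;> ring
  · exact L_reflect_of_pos h h1

end SaalschutzL

/-! ### Absolute convergence and continuity of L at admissible points -/

namespace SaalschutzL

open Filter Topology

theorem ascPochhammer_eval_ne_zero {z : ℂ} (hz : ∀ m : ℕ, z ≠ -m) (n : ℕ) :
    (ascPochhammer ℂ n).eval z ≠ 0 := by
  rw [← Complex.Gamma_add_nat_div_Gamma_eq z hz]
  exact div_ne_zero (Gamma_add_nat_ne_zero hz n) (Complex.Gamma_ne_zero hz)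

/-- The terms of a `₄F₃` series at `1`. -/
noncomputable def balTerm (a b c d e f g : ℂ) (n : ℕ) : ℂ :=
  ((ascPochhammer ℂ n).eval a * (ascPochhammer ℂ n).eval b * (ascPochhammer ℂ n).eval c *
    (ascPochhammer ℂ n).eval d) /
  ((n.factorial : ℂ) * ((ascPochhammer ℂ n).eval e * (ascPochhammer ℂ n).eval f *
    (ascPochhammer ℂ n).eval g))

theorem balTerm_succ (a b c d e f g : ℂ) (n : ℕ) :
    balTerm a b c d e f g (n + 1) = balTerm a b c d e f g n *
      ((a + n) * (b + n) * (c + n) * (d + n) / ((n + 1) * ((e + n) * (f + n) * (g + n)))) := by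
  simp only [balTerm, ascPochhammer_succ_eval, Nat.factorial_succ]
  rw [div_mul_div_comm]
  push_cast
  congr 1 <;> ring

section

variable {X : Type*} {l : Filter X} {a b c d e f g : X → ℂ} {a₀ b₀ c₀ d₀ e₀ f₀ g₀ : ℂ}

theorem norm_ge_half {z : ℂ} {M : ℝ} (hz : ‖z‖ ≤ M) {k : ℕ} (hk : 2 * M ≤ k) :
    (k : ℝ) / 2 ≤ ‖z + k‖ := by
  have h1 := norm_sub_le (z + k) z
  rw [add_sub_cancel_left, Complex.norm_natCast] at h1
  linarith

/-- Locally uniform version of the asymptotics of the quotient of consecutive terms of a balanced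
series. -/
theorem eventually_ratio_le (ha : Tendsto a l (𝓝 a₀)) (hb : Tendsto b l (𝓝 b₀))
    (hc : Tendsto c l (𝓝 c₀)) (hd : Tendsto d l (𝓝 d₀)) (he : Tendsto e l (𝓝 e₀))
    (hf : Tendsto f l (𝓝 f₀)) (hg : Tendsto g l (𝓝 g₀))
    (bal : ∀ x, e x + f x + g x = a x + b x + c x + d x + 1) :
    ∃ K : ℕ, 1 ≤ K ∧ ∀ᶠ x in l, ∀ k : ℕ, K ≤ k →
      ‖(a x + k) * (b x + k) * (c x + k) * (d x + k) /
        ((k + 1) * ((e x + k) * (f x + k) * (g x + k)))‖ ≤ ((k : ℝ) - 1 / 2) / (k + 1) := by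
  -- The coefficients of k², k and 1 in numerator - (k-1)(e+k)(f+k)(g+k). The k³ coefficient
  -- vanishes by balance, so the ratio of terms is (k - 1 + O(1/k))/(k+1).
  let α : X → ℂ := fun x => (a x * b x + a x * c x + a x * d x + b x * c x + b x * d x + c x * d x) -
    (e x * f x + e x * g x + f x * g x) + (e x + f x + g x)
  let β : X → ℂ := fun x => (a x * b x * c x + a x * b x * d x + a x * c x * d x + b x * c x * d x) -
    e x * f x * g x + (e x * f x + e x * g x + f x * g x)
  let γ : X → ℂ := fun x => a x * b x * c x * d x + e x * f x * g x
  have hα : ∃ A, ∀ᶠ x in l, ‖α x‖ ≤ A := by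
    have : Tendsto α l (𝓝 _) := ((((((((ha.mul hb).add (ha.mul hc)).add (ha.mul hd)).add
      (hb.mul hc)).add (hb.mul hd)).add (hc.mul hd)).sub
      (((he.mul hf).add (he.mul hg)).add (hf.mul hg))).add ((he.add hf).add hg))
    exact ⟨_, this.norm.eventually_le_const (lt_add_one _)⟩
  have hβ : ∃ A, ∀ᶠ x in l, ‖β x‖ ≤ A := by
    have : Tendsto β l (𝓝 _) := (((((((ha.mul hb).mul hc).add ((ha.mul hb).mul hd)).add
      ((ha.mul hc).mul hd)).add ((hb.mul hc).mul hd)).sub ((he.mul hf).mul hg)).add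
      (((he.mul hf).add (he.mul hg)).add (hf.mul hg)))
    exact ⟨_, this.norm.eventually_le_const (lt_add_one _)⟩
  have hγ : ∃ A, ∀ᶠ x in l, ‖γ x‖ ≤ A := by
    have : Tendsto γ l (𝓝 _) := (((ha.mul hb).mul hc).mul hd).add ((he.mul hf).mul hg)
    exact ⟨_, this.norm.eventually_le_const (lt_add_one _)⟩
  obtain ⟨A, hA⟩ := hα
  obtain ⟨B, hB⟩ := hβ
  obtain ⟨C, hC⟩ := hγ
  have hM : ∃ M, ∀ᶠ x in l, ‖e x‖ ≤ M ∧ ‖f x‖ ≤ M ∧ ‖g x‖ ≤ M := by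
    refine ⟨max (‖e₀‖ + 1) (max (‖f₀‖ + 1) (‖g₀‖ + 1)), ?_⟩
    filter_upwards [he.norm.eventually_le_const (lt_add_one _),
      hf.norm.eventually_le_const (lt_add_one _),
      hg.norm.eventually_le_const (lt_add_one _)] with x h1 h2 h3
    exact ⟨h1.trans (le_max_left _ _), h2.trans ((le_max_left _ _).trans (le_max_right _ _)),
      h3.trans ((le_max_right _ _).trans (le_max_right _ _))⟩
  obtain ⟨M, hM⟩ := hM
  -- 2M makes each of the three factors at least k/2, so their product has norm W ≥ k³/8; 16(A+B+C)
  -- then makes the remainder at most W/2.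
  obtain ⟨K, hK⟩ := exists_nat_ge (max (2 * M) (16 * (A + B + C)))
  refine ⟨K + 1, by omega, ?_⟩
  filter_upwards [hA, hB, hC, hM] with x hA hB hC ⟨he', hf', hg'⟩ k hk
  have hkK : (K : ℝ) + 1 ≤ k := by exact_mod_cast hk
  have hk2 : 2 * M ≤ k := by linarith [le_max_left (2 * M) (16 * (A + B + C))]
  have hk3 : 16 * (A + B + C) ≤ k := by linarith [le_max_right (2 * M) (16 * (A + B + C))]
  have hk1 : (1 : ℝ) ≤ k := by linarith [(Nat.cast_nonneg K : (0 : ℝ) ≤ K)]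
  set W := ‖(e x + k) * (f x + k) * (g x + k)‖ with hW
  have hWge : (k : ℝ) ^ 3 / 8 ≤ W := by
    rw [hW, norm_mul, norm_mul]
    have h1 := norm_ge_half he' hk2
    have h2 := norm_ge_half hf' hk2
    have h3 := norm_ge_half hg' hk2
    calc (k : ℝ) ^ 3 / 8 = (k : ℝ) / 2 * (k / 2) * (k / 2) := by ring
      _ ≤ _ := by gcongr
  have hWpos : 0 < W := lt_of_lt_of_le (by positivity) hWge
  have hN : (a x + k) * (b x + k) * (c x + k) * (d x + k) =
      ((k : ℂ) - 1) * ((e x + k) * (f x + k) * (g x + k)) +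
        (α x * k ^ 2 + β x * k + γ x) := by
    simp only [α, β, γ]
    linear_combination (-(k : ℂ) ^ 3) * bal x
  have hR : ‖α x * k ^ 2 + β x * k + γ x‖ ≤ (A + B + C) * (k : ℝ) ^ 2 := by
    have hA0 := (norm_nonneg _).trans hA
    have hB0 := (norm_nonneg _).trans hB
    have hC0 := (norm_nonneg _).trans hC
    refine (norm_add₃_le).trans ?_
    rw [norm_mul, norm_mul, norm_pow, Complex.norm_natCast]
    have h1 : (k : ℝ) ≤ (k : ℝ) ^ 2 := by nlinarith
    have h2 : (1 : ℝ) ≤ (k : ℝ) ^ 2 := by nlinarith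
    calc _ ≤ A * (k : ℝ) ^ 2 + B * (k : ℝ) ^ 2 + C * (k : ℝ) ^ 2 := by
          gcongr
          exact hC.trans (le_mul_of_one_le_right hC0 h2)
      _ = _ := by ring
  have hR2 : (A + B + C) * (k : ℝ) ^ 2 ≤ W / 2 := by
    have : 16 * (A + B + C) * (k : ℝ) ^ 2 ≤ k * (k : ℝ) ^ 2 := by gcongr
    nlinarith
  have hn1 : ‖(k : ℂ) + 1‖ = (k : ℝ) + 1 := by
    have := Complex.norm_natCast (k + 1)
    push_cast at this
    exact this
  have hn2 : ‖(k : ℂ) - 1‖ = (k : ℝ) - 1 := by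
    have h := Complex.norm_real ((k : ℝ) - 1)
    push_cast at h
    rw [h, Real.norm_of_nonneg (by linarith)]
  rw [norm_div, norm_mul ((k : ℂ) + 1), ← hW, hn1, hN]
  have : ‖((k : ℂ) - 1) * ((e x + k) * (f x + k) * (g x + k)) +
        (α x * k ^ 2 + β x * k + γ x)‖ ≤ ((k : ℝ) - 1 / 2) * W := by
    refine (norm_add_le _ _).trans ?_
    rw [norm_mul, ← hW, hn2]
    linarith
  rw [div_le_div_iff₀ (by positivity) (by positivity)]
  calc _ ≤ ((k : ℝ) - 1 / 2) * W * (k + 1) := by gcongr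
    _ = _ := by ring

/-- Raabe's test with an explicit constant: by Bernoulli's inequality the ratio is at most
(n/(n+1))^(3/2), so t n · n^(3/2) is nonincreasing from K on. -/
theorem raabe_bound {t : ℕ → ℝ} {K : ℕ} (hK : 1 ≤ K) (h0 : ∀ n, 0 ≤ t n)
    (h : ∀ n, K ≤ n → t (n + 1) ≤ t n * (((n : ℝ) - 1 / 2) / (n + 1))) (n : ℕ) (hn : K ≤ n) :
    t n ≤ t K * (K : ℝ) ^ (3 / 2 : ℝ) * (n : ℝ) ^ (-(3 / 2) : ℝ) := by
  have hpos : ∀ n, K ≤ n → (0 : ℝ) < n := fun n hn => by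
    exact_mod_cast lt_of_lt_of_le hK hn
  have key : t n * (n : ℝ) ^ (3 / 2 : ℝ) ≤ t K * (K : ℝ) ^ (3 / 2 : ℝ) := by
    induction n, hn using Nat.le_induction with
    | base => exact le_rfl
    | succ n hn ih =>
      refine le_trans ?_ ih
      have hn0 := hpos n hn
      have hb := one_add_mul_self_le_rpow_one_add (s := -1 / ((n : ℝ) + 1))
        (by rw [le_div_iff₀ (by positivity)]; linarith) (p := 3 / 2) (by norm_num)
      have e1 : 1 + -1 / ((n : ℝ) + 1) = n / (n + 1) := by field_simp; ring
      have e2 : 1 + 3 / 2 * (-1 / ((n : ℝ) + 1)) = ((n : ℝ) - 1 / 2) / (n + 1) := by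
        field_simp; ring
      rw [e1, e2, Real.div_rpow hn0.le (by positivity)] at hb
      push_cast
      calc t (n + 1) * ((n : ℝ) + 1) ^ (3 / 2 : ℝ)
          ≤ t n * ((n : ℝ) ^ (3 / 2 : ℝ) / ((n : ℝ) + 1) ^ (3 / 2 : ℝ)) *
              ((n : ℝ) + 1) ^ (3 / 2 : ℝ) := by
            gcongr
            exact (h n hn).trans (mul_le_mul_of_nonneg_left hb (h0 n))
        _ = t n * (n : ℝ) ^ (3 / 2 : ℝ) := by
            have : (0 : ℝ) < ((n : ℝ) + 1) ^ (3 / 2 : ℝ) := by positivity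
            field_simp
  have hn0 := hpos n hn
  rw [Real.rpow_neg hn0.le, ← div_eq_mul_inv, le_div_iff₀ (by positivity)]
  exact key

theorem tendsto_ascPochhammer (ha : Tendsto a l (𝓝 a₀)) (n : ℕ) :
    Tendsto (fun x => (ascPochhammer ℂ n).eval (a x)) l (𝓝 ((ascPochhammer ℂ n).eval a₀)) :=
  ((ascPochhammer ℂ n).continuous.tendsto a₀).comp ha

theorem tendsto_balTerm (ha : Tendsto a l (𝓝 a₀)) (hb : Tendsto b l (𝓝 b₀))
    (hc : Tendsto c l (𝓝 c₀)) (hd : Tendsto d l (𝓝 d₀)) (he : Tendsto e l (𝓝 e₀))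
    (hf : Tendsto f l (𝓝 f₀)) (hg : Tendsto g l (𝓝 g₀)) (pe : ∀ m : ℕ, e₀ ≠ -m)
    (pf : ∀ m : ℕ, f₀ ≠ -m) (pg : ∀ m : ℕ, g₀ ≠ -m) (n : ℕ) :
    Tendsto (fun x => balTerm (a x) (b x) (c x) (d x) (e x) (f x) (g x) n) l
      (𝓝 (balTerm a₀ b₀ c₀ d₀ e₀ f₀ g₀ n)) := by
  refine Tendsto.div ((((tendsto_ascPochhammer ha n).mul (tendsto_ascPochhammer hb n)).mul
    (tendsto_ascPochhammer hc n)).mul (tendsto_ascPochhammer hd n))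
    ((((tendsto_ascPochhammer he n).mul (tendsto_ascPochhammer hf n)).mul
      (tendsto_ascPochhammer hg n)).const_mul _) ?_
  refine mul_ne_zero (by exact_mod_cast Nat.factorial_ne_zero n) ?_
  exact mul_ne_zero (mul_ne_zero (ascPochhammer_eval_ne_zero pe n)
    (ascPochhammer_eval_ne_zero pf n)) (ascPochhammer_eval_ne_zero pg n)

/-- Locally uniform absolute convergence of balanced `₄F₃` series at `1`. -/
theorem exists_summable_bound (ha : Tendsto a l (𝓝 a₀)) (hb : Tendsto b l (𝓝 b₀))
    (hc : Tendsto c l (𝓝 c₀)) (hd : Tendsto d l (𝓝 d₀)) (he : Tendsto e l (𝓝 e₀))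
    (hf : Tendsto f l (𝓝 f₀)) (hg : Tendsto g l (𝓝 g₀)) (pe : ∀ m : ℕ, e₀ ≠ -m)
    (pf : ∀ m : ℕ, f₀ ≠ -m) (pg : ∀ m : ℕ, g₀ ≠ -m)
    (bal : ∀ x, e x + f x + g x = a x + b x + c x + d x + 1) :
    ∃ B : ℕ → ℝ, Summable B ∧ ∀ᶠ x in l, ∀ n,
      ‖balTerm (a x) (b x) (c x) (d x) (e x) (f x) (g x) n‖ ≤ B n := by
  obtain ⟨K, hK, hr⟩ := eventually_ratio_le ha hb hc hd he hf hg bal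
  -- The slack 1 lets finitely many convergent terms be bounded simultaneously near the limit; the
  -- tail follows from Raabe's test.
  set t : ℕ → ℝ := fun n => ‖balTerm a₀ b₀ c₀ d₀ e₀ f₀ g₀ n‖ + 1 with ht
  have ht0 : ∀ n, 0 ≤ t n := fun n => by positivity
  refine ⟨fun n => (if n ∈ Finset.range K then t n else 0) +
    t K * (K : ℝ) ^ (3 / 2 : ℝ) * (n : ℝ) ^ (-(3 / 2) : ℝ), ?_, ?_⟩
  · refine Summable.add (summable_of_ne_finset_zero (s := Finset.range K) fun n hn => if_neg hn) ?_
    exact (Real.summable_nat_rpow.mpr (by norm_num)).mul_left _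
  · have hev : ∀ᶠ x in l, ∀ n ∈ Finset.range (K + 1),
        ‖balTerm (a x) (b x) (c x) (d x) (e x) (f x) (g x) n‖ ≤ t n := by
      rw [Filter.eventually_all_finset]
      intro n _
      exact (tendsto_balTerm ha hb hc hd he hf hg pe pf pg n).norm.eventually_le_const
        (lt_add_one _)
    filter_upwards [hr, hev] with x hx hx2 n
    by_cases hn : n < K
    · rw [if_pos (Finset.mem_range.mpr hn)]
      have h1 := hx2 n (Finset.mem_range.mpr (by omega))
      have h2 : 0 ≤ t K * (K : ℝ) ^ (3 / 2 : ℝ) * (n : ℝ) ^ (-(3 / 2) : ℝ) := by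
        have := ht0 K
        positivity
      linarith
    · rw [if_neg (by simpa using hn), zero_add]
      have h1 := raabe_bound (t := fun n => ‖balTerm (a x) (b x) (c x) (d x) (e x) (f x) (g x) n‖)
        hK (fun n => norm_nonneg _) (fun n hn => by
          rw [balTerm_succ, norm_mul]
          exact mul_le_mul_of_nonneg_left (hx n hn) (norm_nonneg _)) n (by omega)
      refine h1.trans ?_
      gcongr
      exact hx2 K (by simp)

theorem hyp_eq_tsum_balTerm (a b c d e f g : ℂ) :
    hyp ![a, b, c, d] ![e, f, g] 1 = ∑' n, balTerm a b c d e f g n :=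
  tsum_congr fun n => hypTerm_four a b c d e f g n

theorem tendsto_hyp (ha : Tendsto a l (𝓝 a₀)) (hb : Tendsto b l (𝓝 b₀))
    (hc : Tendsto c l (𝓝 c₀)) (hd : Tendsto d l (𝓝 d₀)) (he : Tendsto e l (𝓝 e₀))
    (hf : Tendsto f l (𝓝 f₀)) (hg : Tendsto g l (𝓝 g₀)) (pe : ∀ m : ℕ, e₀ ≠ -m)
    (pf : ∀ m : ℕ, f₀ ≠ -m) (pg : ∀ m : ℕ, g₀ ≠ -m)
    (bal : ∀ x, e x + f x + g x = a x + b x + c x + d x + 1) :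
    Tendsto (fun x => hyp ![a x, b x, c x, d x] ![e x, f x, g x] 1) l
      (𝓝 (hyp ![a₀, b₀, c₀, d₀] ![e₀, f₀, g₀] 1)) := by
  obtain ⟨B, hB, hb'⟩ := exists_summable_bound ha hb hc hd he hf hg pe pf pg bal
  simp only [hyp_eq_tsum_balTerm]
  exact tendsto_tsum_of_dominated_convergence hB
    (tendsto_balTerm ha hb hc hd he hf hg pe pf pg) hb'

end

theorem summable_norm_hypTerm {a b c d e f g : ℂ} (pe : ∀ m : ℕ, e ≠ -m)
    (pf : ∀ m : ℕ, f ≠ -m) (pg : ∀ m : ℕ, g ≠ -m) (bal : e + f + g = a + b + c + d + 1) :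
    Summable fun n => ‖hypTerm ![a, b, c, d] ![e, f, g] 1 n‖ := by
  -- A constant family turns the locally uniform bound into a pointwise one.
  obtain ⟨B, hB, hb⟩ := exists_summable_bound (X := Unit) (l := ⊤) (tendsto_const_nhds (x := a))
    (tendsto_const_nhds (x := b)) (tendsto_const_nhds (x := c)) (tendsto_const_nhds (x := d))
    (tendsto_const_nhds (x := e)) (tendsto_const_nhds (x := f)) (tendsto_const_nhds (x := g))
    pe pf pg (fun _ => bal)
  obtain ⟨_, hx⟩ := hb.exists
  refine Summable.of_nonneg_of_le (fun n => norm_nonneg _) (fun n => ?_) hB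
  rw [hypTerm_four]
  exact hx n

theorem bal_of_mem_V {x : Fin 7 → ℂ} (hx : x ∈ V) :
    x 4 + x 5 + x 6 = x 0 + x 1 + x 2 + x 3 + 1 := by
  have : x 4 + x 5 + x 6 - x 0 - x 1 - x 2 - x 3 = 1 := hx
  linear_combination this

theorem dual_bal_of_mem_V {x : Fin 7 → ℂ} (hx : x ∈ V) :
    1 + x 5 - x 4 + (1 + x 6 - x 4) + (2 - x 4) =
      1 + x 0 - x 4 + (1 + x 1 - x 4) + (1 + x 2 - x 4) + (1 + x 3 - x 4) + 1 := by
  have := bal_of_mem_V hx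
  linear_combination this

/-- `L` is continuous on `V` at the admissible points. -/
theorem tendsto_Lvec {X : Type*} {l : Filter X} {x : X → Fin 7 → ℂ} {x₀ : Fin 7 → ℂ}
    (hx : Tendsto x l (𝓝 x₀)) (hV : ∀ y, x y ∈ V) (hadm : Admissible x₀) :
    Tendsto (fun y => Lvec (x y)) l (𝓝 (Lvec x₀)) := by
  have hi : ∀ i, Tendsto (fun y => x y i) l (𝓝 (x₀ i)) := fun i => tendsto_pi_nhds.mp hx i
  -- 1/Γ is entire, so the Gammas of numerator parameters may have poles at the limit point.
  have hinv : ∀ {h : X → ℂ} {h₀ : ℂ}, Tendsto h l (𝓝 h₀) →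
      Tendsto (fun y => (Complex.Gamma (h y))⁻¹) l (𝓝 (Complex.Gamma h₀)⁻¹) := fun hh =>
    (Complex.differentiable_one_div_Gamma.continuous.tendsto _).comp hh
  have hs : Tendsto (fun y => (Complex.sin (Real.pi * x y 4))⁻¹) l
      (𝓝 (Complex.sin (Real.pi * x₀ 4))⁻¹) :=
    ((Complex.continuous_sin.tendsto _).comp ((hi 4).const_mul _)).inv₀ hadm.1
  have hsub : ∀ (z : ℂ) (i : Fin 7), Tendsto (fun y => z + x y i - x y 4) l
      (𝓝 (z + x₀ i - x₀ 4)) := fun z i => ((hi i).const_add z).sub (hi 4)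
  have h2 : Tendsto (fun y => 2 - x y 4) l (𝓝 (2 - x₀ 4)) := (hi 4).const_sub 2
  have H1 := tendsto_hyp (hi 0) (hi 1) (hi 2) (hi 3) (hi 4) (hi 5) (hi 6)
    (fun m => (hadm.2 m).1) (fun m => (hadm.2 m).2.1) (fun m => (hadm.2 m).2.2.1)
    (fun y => bal_of_mem_V (hV y))
  have H2 := tendsto_hyp (hsub 1 0) (hsub 1 1) (hsub 1 2) (hsub 1 3) (hsub 1 5) (hsub 1 6) h2
    (fun m => (hadm.2 m).2.2.2.1) (fun m => (hadm.2 m).2.2.2.2.1)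
    (fun m => (hadm.2 m).2.2.2.2.2) (fun y => dual_bal_of_mem_V (hV y))
  simp only [Lvec, L, div_eq_mul_inv, mul_inv]
  exact (H1.mul (((((((hs.mul (hinv (hi 4))).mul (hinv (hi 5))).mul (hinv (hi 6))).mul
    (hinv (hsub 1 0))).mul (hinv (hsub 1 1))).mul (hinv (hsub 1 2))).mul (hinv (hsub 1 3)))).sub
    (H2.mul (((((((hs.mul (hinv (hi 0))).mul (hinv (hi 1))).mul (hinv (hi 2))).mul
    (hinv (hi 3))).mul (hinv (hsub 1 5))).mul (hinv (hsub 1 6))).mul (hinv h2)))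

end SaalschutzL

/-! ### Permutation matrices and the group Σ -/

namespace SaalschutzL

theorem perm_apply (σ : Equiv.Perm (Fin 7)) (r k : Fin 7) :
    (perm σ : Matrix (Fin 7) (Fin 7) ℂ) r k = if r = σ k then 1 else 0 := by
  have h : (perm σ : Matrix (Fin 7) (Fin 7) ℂ) = σ⁻¹.permMatrix ℂ := rfl
  rw [h, Equiv.Perm.permMatrix, PEquiv.toMatrix_apply]
  simp [Equiv.symm_apply_eq]

theorem perm_mul_apply (σ : Equiv.Perm (Fin 7)) (M : Matrix (Fin 7) (Fin 7) ℂ) (r k : Fin 7) :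
    ((perm σ : Matrix (Fin 7) (Fin 7) ℂ) * M) r k = M (σ.symm r) k := by
  simp [Matrix.mul_apply, perm_apply, ← Equiv.symm_apply_eq]

theorem mul_perm_apply (σ : Equiv.Perm (Fin 7)) (M : Matrix (Fin 7) (Fin 7) ℂ) (r k : Fin 7) :
    (M * (perm σ : Matrix (Fin 7) (Fin 7) ℂ)) r k = M r (σ k) := by
  simp [Matrix.mul_apply, perm_apply]

theorem vecMul_perm (v : Fin 7 → ℂ) (σ : Equiv.Perm (Fin 7)) :
    v ᵥ* (perm σ : Matrix (Fin 7) (Fin 7) ℂ) = v ∘ σ := by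
  ext k
  simp [Matrix.vecMul, dotProduct, perm_apply]

theorem act_perm (σ : Equiv.Perm (Fin 7)) (x : Fin 7 → ℂ) : act (perm σ) x = x ∘ σ.symm := by
  ext k
  simp [act, Matrix.mulVec, dotProduct, perm_apply, ← Equiv.symm_apply_eq]

theorem act_one (x : Fin 7 → ℂ) : act 1 x = x := by
  simp [act]

theorem act_mul (α β : GL (Fin 7) ℂ) (x : Fin 7 → ℂ) : act (α * β) x = act α (act β x) := by
  simp [act, Matrix.mulVec_mulVec]

theorem perm_injective : Function.Injective perm := by
  intro σ τ h
  ext1 k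
  have h1 := congrArg (fun α : GL (Fin 7) ℂ => (α : Matrix (Fin 7) (Fin 7) ℂ) (σ k) k) h
  simp only [perm_apply, if_true] at h1
  by_contra hne
  rw [if_neg hne] at h1
  exact one_ne_zero h1

/-- `S₄ × S₂` as a group of permutations of the first four and the last two of seven indices. -/
def blockPerm : Equiv.Perm (Fin 4) × Equiv.Perm (Fin 2) →* Equiv.Perm (Fin 7) :=
  (((finSumFinEquiv (m := 4) (n := 1)).sumCongr (Equiv.refl (Fin 2))).trans
      (finSumFinEquiv (m := 5) (n := 2))).permCongrHom.toMonoidHom.comp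
    ((Equiv.Perm.sumCongrHom (Fin 4 ⊕ Fin 1) (Fin 2)).comp
      (((Equiv.Perm.sumCongrHom (Fin 4) (Fin 1)).comp (MonoidHom.inl _ _)).prodMap
        (MonoidHom.id (Equiv.Perm (Fin 2)))))

theorem blockPerm_injective : Function.Injective blockPerm := by
  rintro ⟨π, τ⟩ ⟨π', τ'⟩ h
  have h1 := (Equiv.permCongrHom _).injective h
  have h2 := Prod.mk.inj (Equiv.Perm.sumCongrHom_injective h1)
  have h3 := Prod.mk.inj (Equiv.Perm.sumCongrHom_injective h2.1)
  exact Prod.ext h3.1 h2.2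

theorem swap_mem_Sig {σ : Equiv.Perm (Fin 7)} (h : σ = Equiv.swap 0 1 ∨ σ = Equiv.swap 1 2 ∨
    σ = Equiv.swap 2 3 ∨ σ = Equiv.swap 5 6) : perm σ ∈ Sig := by
  apply Subgroup.subset_closure
  rcases h with rfl | rfl | rfl | rfl <;> simp

/-- Adjacent transpositions generate each symmetric factor. This description makes quantification
over Σ a finite, decidable matter. -/
theorem sig_eq_range : Sig = (perm.comp blockPerm).range := by
  apply le_antisymm
  · rw [Sig, Subgroup.closure_le]
    rintro _ (rfl | rfl | rfl | rfl)
    · exact ⟨(Equiv.swap 0 1, 1), congrArg perm (by decide)⟩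
    · exact ⟨(Equiv.swap 1 2, 1), congrArg perm (by decide)⟩
    · exact ⟨(Equiv.swap 2 3, 1), congrArg perm (by decide)⟩
    · exact ⟨(1, Equiv.swap 0 1), congrArg perm (by decide)⟩
  · have h1 : ∀ π : Equiv.Perm (Fin 4), perm (blockPerm (π, 1)) ∈ Sig := by
      have : (⊤ : Submonoid (Equiv.Perm (Fin 4))) ≤
          (Sig.comap ((perm.comp blockPerm).comp (MonoidHom.inl _ _))).toSubmonoid := by
        rw [← Equiv.Perm.mclosure_swap_castSucc_succ, Submonoid.closure_le]
        rintro _ ⟨i, rfl⟩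
        apply swap_mem_Sig
        revert i
        decide
      exact fun π => this (Submonoid.mem_top π)
    have h2 : ∀ τ : Equiv.Perm (Fin 2), perm (blockPerm (1, τ)) ∈ Sig := by
      have : (⊤ : Submonoid (Equiv.Perm (Fin 2))) ≤
          (Sig.comap ((perm.comp blockPerm).comp (MonoidHom.inr _ _))).toSubmonoid := by
        rw [← Equiv.Perm.mclosure_swap_castSucc_succ, Submonoid.closure_le]
        rintro _ ⟨i, rfl⟩
        apply swap_mem_Sig
        revert i
        decide
      exact fun π => this (Submonoid.mem_top π)
    rintro _ ⟨⟨π, τ⟩, rfl⟩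
    have : ((π, τ) : Equiv.Perm (Fin 4) × Equiv.Perm (Fin 2)) = (π, 1) * (1, τ) := by simp
    rw [this, map_mul]
    exact mul_mem (h1 π) (h2 τ)

theorem mem_Sig_iff {α : GL (Fin 7) ℂ} : α ∈ Sig ↔ ∃ p, perm (blockPerm p) = α := by
  rw [sig_eq_range]
  rfl

theorem nonempty_Sig_mulEquiv : Nonempty (Sig ≃* Equiv.Perm (Fin 4) × Equiv.Perm (Fin 2)) := by
  rw [sig_eq_range]
  have h : Function.Injective (perm.comp blockPerm) := perm_injective.comp blockPerm_injective
  exact ⟨(MonoidHom.ofInjective h).symm⟩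

theorem card_Sig : Nat.card Sig = 48 := by
  obtain ⟨e⟩ := nonempty_Sig_mulEquiv
  rw [Nat.card_congr e.toEquiv, Nat.card_eq_fintype_card, Fintype.card_prod, Fintype.card_perm,
    Fintype.card_perm]
  decide

end SaalschutzL

/-! ### The six double cosets exhaust G_L -/

namespace SaalschutzL

/-- The complex matrix with given integer entries. -/
def toC (M : Matrix (Fin 7) (Fin 7) ℤ) : Matrix (Fin 7) (Fin 7) ℂ := M.map (Int.cast : ℤ → ℂ)

theorem toC_mul (M N : Matrix (Fin 7) (Fin 7) ℤ) : toC (M * N) = toC M * toC N :=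
  Matrix.map_mul (f := Int.castRingHom ℂ)

/-- The matrix `A` over the integers. -/
def intA : Matrix (Fin 7) (Fin 7) ℤ :=
  !![1, 0, 0, 0, 0, 0, 0;
    0, 1, 0, 0, 0, 0, 0;
    0, 0, -1, 0, 0, 0, 1;
    0, 0, 0, -1, 0, 0, 1;
    0, 0, -1, -1, 1, 0, 1;
    0, 0, -1, -1, 0, 1, 1;
    0, 0, 0, 0, 0, 0, 1]

theorem matA_eq : matA = toC intA := by
  ext i j
  fin_cases i <;> fin_cases j <;> simp [matA, intA, toC]

theorem A_eq : (A : Matrix (Fin 7) (Fin 7) ℂ) = toC intA := matA_eq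

/-- The six representatives over the integers. -/
def intRep : Fin 6 → Matrix (Fin 7) (Fin 7) ℤ :=
  ![!![1, 0, 0, 0, 0, 0, 0;
      0, 1, 0, 0, 0, 0, 0;
      0, 0, 1, 0, 0, 0, 0;
      0, 0, 0, 1, 0, 0, 0;
      0, 0, 0, 0, 1, 0, 0;
      0, 0, 0, 0, 0, 1, 0;
      0, 0, 0, 0, 0, 0, 1],
    !![1, 0, 0, 0, 0, 0, 0;
      0, 1, 0, 0, 0, 0, 0;
      0, 0, -1, 0, 0, 0, 1;
      0, 0, 0, -1, 0, 0, 1;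
      0, 0, -1, -1, 1, 0, 1;
      0, 0, -1, -1, 0, 1, 1;
      0, 0, 0, 0, 0, 0, 1],
    !![0, -1, -1, -1, 0, 1, 1;
      0, 0, -1, 0, 0, 0, 1;
      1, 0, 0, 0, 0, 0, 0;
      0, 0, -1, 0, 0, 1, 0;
      0, -1, -2, -1, 1, 1, 1;
      0, 0, -1, -1, 0, 1, 1;
      0, -1, -1, 0, 0, 1, 1],
    !![-1, -1, -1, 0, 0, 1, 1;
      0, -1, -1, -1, 0, 1, 1;
      0, 0, -1, 0, 0, 0, 1;
      0, -1, 0, 0, 0, 0, 1;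
      -1, -2, -2, -1, 1, 1, 2;
      0, -1, -1, 0, 0, 1, 1;
      -1, -1, -1, -1, 0, 1, 2],
    !![-1, 0, 0, 0, 0, 0, 1;
      0, -1, 0, 0, 0, 0, 1;
      0, 0, -1, 0, 0, 0, 1;
      0, 0, 0, -1, 0, 0, 1;
      -1, -1, -1, -1, 1, 0, 2;
      -1, -1, -1, -1, 0, 1, 2;
      0, 0, 0, 0, 0, 0, 1],
    !![-1, -1, 0, -1, 0, 1, 1;
      -1, -1, -1, 0, 0, 1, 1;
      0, -1, -1, -1, 0, 1, 1;
      -1, 0, -1, -1, 0, 1, 1;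
      -2, -2, -2, -2, 1, 2, 2;
      -1, -1, -1, -1, 0, 1, 2;
      -1, -1, -1, -1, 0, 2, 1]]

theorem perm_mul_A {σ : Equiv.Perm (Fin 7)} {M : Matrix (Fin 7) (Fin 7) ℤ}
    (h : intA.submatrix σ.symm id = M) :
    ((perm σ * A : GL (Fin 7) ℂ) : Matrix (Fin 7) (Fin 7) ℂ) = toC M := by
  ext r k
  rw [Units.val_mul, perm_mul_apply, A_eq, toC, toC, Matrix.map_apply, Matrix.map_apply, ← h]
  rfl

/-- Integer models of the representatives: complex matrix identities become statements decidable by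
computation. -/
theorem rep_eq (i : Fin 6) : (rep i : Matrix (Fin 7) (Fin 7) ℂ) = toC (intRep i) := by
  have hB : ((perm (c[0, 1, 2] * c[5, 6]) * A : GL (Fin 7) ℂ) : Matrix (Fin 7) (Fin 7) ℂ) =
      toC !![0, 0, -1, 0, 0, 0, 1;
      1, 0, 0, 0, 0, 0, 0;
      0, 1, 0, 0, 0, 0, 0;
      0, 0, 0, -1, 0, 0, 1;
      0, 0, -1, -1, 1, 0, 1;
      0, 0, 0, 0, 0, 0, 1;
      0, 0, -1, -1, 0, 1, 1] := by
    apply perm_mul_A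
    decide +kernel
  have hD : ((perm c[0, 1, 2] * A : GL (Fin 7) ℂ) : Matrix (Fin 7) (Fin 7) ℂ) =
      toC !![0, 0, -1, 0, 0, 0, 1;
      1, 0, 0, 0, 0, 0, 0;
      0, 1, 0, 0, 0, 0, 0;
      0, 0, 0, -1, 0, 0, 1;
      0, 0, -1, -1, 1, 0, 1;
      0, 0, -1, -1, 0, 1, 1;
      0, 0, 0, 0, 0, 0, 1] := by
    apply perm_mul_A
    decide +kernel
  have hB2 : (((perm (c[0, 1, 2] * c[5, 6]) * A) ^ 2 : GL (Fin 7) ℂ) :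
      Matrix (Fin 7) (Fin 7) ℂ) = toC (intRep 2) := by
    rw [pow_two, Units.val_mul, hB, ← toC_mul]
    exact congrArg toC (by decide +kernel)
  have hD2 : (((perm c[0, 1, 2] * A) ^ 2 : GL (Fin 7) ℂ) :
      Matrix (Fin 7) (Fin 7) ℂ) = toC !![0, -1, 0, 0, 0, 0, 1;
      0, 0, -1, 0, 0, 0, 1;
      1, 0, 0, 0, 0, 0, 0;
      0, 0, 0, 1, 0, 0, 0;
      0, -1, -1, 0, 1, 0, 1;
      0, -1, -1, 0, 0, 1, 1;
      0, 0, 0, 0, 0, 0, 1] := by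
    rw [pow_two, Units.val_mul, hD, ← toC_mul]
    exact congrArg toC (by decide +kernel)
  fin_cases i
  · change ((1 : GL (Fin 7) ℂ) : Matrix (Fin 7) (Fin 7) ℂ) = toC (intRep 0)
    rw [Units.val_one, show intRep 0 = 1 by decide +kernel]
    exact (Matrix.map_one _ Int.cast_zero Int.cast_one).symm
  · exact A_eq
  · exact hB2
  · change (((perm (c[0, 1, 2] * c[5, 6]) * A) ^ 3 : GL (Fin 7) ℂ) :
      Matrix (Fin 7) (Fin 7) ℂ) = toC (intRep 3)
    rw [pow_succ, Units.val_mul, hB2, hB, ← toC_mul]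
    exact congrArg toC (by decide +kernel)
  · change (((perm c[0, 1, 2] * A) ^ 3 : GL (Fin 7) ℂ) :
      Matrix (Fin 7) (Fin 7) ℂ) = toC (intRep 4)
    rw [pow_succ, Units.val_mul, hD2, hD, ← toC_mul]
    exact congrArg toC (by decide +kernel)
  · change (((perm (c[0, 1, 2] * c[5, 6]) * A) ^ 4 : GL (Fin 7) ℂ) :
      Matrix (Fin 7) (Fin 7) ℂ) = toC (intRep 5)
    rw [show 4 = 2 + 2 from rfl, pow_add, Units.val_mul, hB2, ← toC_mul]
    exact congrArg toC (by decide +kernel)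

/-- The product of a word in the four generating transpositions of `Σ`. -/
def word (l : List (Fin 4)) : Equiv.Perm (Fin 7) :=
  (l.map ![Equiv.swap 0 1, Equiv.swap 1 2, Equiv.swap 2 3, Equiv.swap 5 6]).prod

theorem perm_word_mem (l : List (Fin 4)) : perm (word l) ∈ Sig := by
  induction l with
  | nil => exact (map_one perm).symm ▸ Sig.one_mem
  | cons i l ih =>
    have h : word (i :: l) =
        ![Equiv.swap 0 1, Equiv.swap 1 2, Equiv.swap 2 3, Equiv.swap 5 6] i * word l := by
      simp [word]
    rw [h, map_mul]
    refine mul_mem (swap_mem_Sig ?_) ih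
    fin_cases i <;> simp

/-- Coset representatives `t` of `⟨(12), (34)⟩` in `Σ`, each with the data `j`, `s`, `s'` such that
`ρᵢ t A = s ρⱼ s'` for the six representatives `ρᵢ`. -/
def reductions : List (List (Fin 4) × (Fin 6 → Fin 6 × List (Fin 4) × List (Fin 4))) :=
  [([], ![(1, [], []), (0, [], []), (1, [0, 1, 0, 3], [1, 3]),
      (2, [], [0, 1, 3]), (1, [1, 0, 2, 1], [1, 0, 2, 1]), (3, [], [0, 1, 3])]),
   ([1], ![(1, [1], []), (1, [1, 2, 1], [1, 2]), (2, [0, 1, 2, 1, 0], [1, 2]),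
      (2, [1, 2], [0, 1]), (1, [0, 2, 1], [1, 0, 2, 1]), (3, [0, 1, 2, 1], [0, 1, 2, 3])]),
   ([3], ![(1, [3], []), (1, [2, 3], [3]), (1, [1, 0, 2, 1, 3], [1, 3]),
      (3, [1, 2, 1], [2, 3]), (3, [3], [2, 1, 3]), (3, [3], [0, 1, 3])]),
   ([0, 1], ![(1, [0, 1], []), (1, [0, 1, 2, 1], [1, 2]), (3, [1, 2, 1], []),
      (3, [0, 3], [0, 1]), (1, [2, 1], [1, 0, 2, 1]), (3, [0, 1], [0, 1, 0, 2, 3])]),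
   ([1, 3], ![(1, [1, 3], []), (2, [0, 1, 0, 3], []), (2, [0], [1, 2, 3]),
      (3, [1], [1, 2, 3]), (3, [1, 3], [2, 1, 3]), (3, [0, 1, 2, 1, 0, 3], [0, 1, 3])]),
   ([2, 1], ![(1, [2, 1], []), (1, [1], [1, 2, 1]), (1, [0, 1], [0, 1, 2, 3]),
      (1, [1, 0, 2, 1, 0, 3], [1, 0, 2, 1, 3]), (1, [0, 1], [1, 0, 2, 1]), (3, [1, 2, 1], [0, 1, 2, 3])]),
   ([0, 1, 3], ![(1, [0, 1, 3], []), (2, [1, 0, 3], []), (3, [], []),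
      (5, [], []), (3, [0, 1, 3], [2, 1, 3]), (3, [0, 1, 0, 2, 3], [0, 1, 3])]),
   ([0, 2, 1], ![(1, [0, 2, 1], []), (1, [0, 1], [1, 2, 1]), (2, [1], [0, 1, 2, 1]),
      (2, [0], [0, 1, 0, 2, 3]), (1, [1], [1, 0, 2, 1]), (3, [1], [0, 1, 0, 2, 3])]),
   ([2, 1, 3], ![(1, [2, 1, 3], []), (2, [0, 2, 1, 0, 3], []), (1, [1, 0, 2, 1], [1, 2, 3]),
      (4, [3], [3]), (3, [2, 1, 3], [2, 1, 3]), (3, [1, 2, 1, 0, 3], [0, 1, 3])]),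
   ([0, 2, 1, 3], ![(1, [0, 2, 1, 3], []), (2, [2, 1, 0, 3], []), (2, [1, 2], [0, 1, 2, 1]),
      (3, [0, 1, 2, 1], [0, 3]), (3, [0, 2, 1, 3], [2, 1, 3]), (3, [1, 0, 2, 3], [0, 1, 3])]),
   ([1, 0, 2, 1], ![(1, [1, 0, 2, 1], []), (4, [], [1, 0, 2, 1]), (3, [1, 2, 1, 3], [0]),
      (2, [0, 1, 2], [0, 1, 0, 2]), (1, [], [1, 0, 2, 1]), (3, [1, 0, 2, 1], [0, 1, 3])]),
   ([1, 0, 2, 1, 3], ![(1, [1, 0, 2, 1, 3], []), (3, [0, 1, 0, 2, 1, 3], [2, 1]), (3, [3], [0]),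
      (3, [0, 1], [1, 0, 3]), (3, [1, 0, 2, 1, 3], [2, 1, 3]), (3, [1, 0, 2, 1, 3], [0, 1, 3])])]

theorem reductions_spec : ∀ x ∈ reductions, ∀ i, ∀ r k : Fin 7,
    ∑ m, intRep i r (word x.1 m) * intA m k =
      intRep (x.2 i).1 ((word (x.2 i).2.1).symm r) (word (x.2 i).2.2 k) := by
  decide +kernel

theorem reductions_cover : ∀ p, ∃ x ∈ reductions, ∃ v ∈ [[], [0], [2], [0, 2]],
    blockPerm p = word x.1 * word v := by
  decide +kernel

/-- A commutes with (12) and (34), so only the twelve cosets of ⟨(12),(34)⟩ in Σ have to be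
tabulated instead of all 48 elements. -/
theorem word_A_comm : ∀ v ∈ [[], [0], [2], [0, 2]], ∀ r k : Fin 7,
    intA ((word v).symm r) k = intA r (word v k) := by
  decide +kernel

theorem rep_mul_A {x : List (Fin 4) × (Fin 6 → Fin 6 × List (Fin 4) × List (Fin 4))}
    (hx : x ∈ reductions) (i : Fin 6) :
    rep i * perm (word x.1) * A =
      perm (word (x.2 i).2.1) * rep (x.2 i).1 * perm (word (x.2 i).2.2) := by
  apply Units.ext
  ext r k
  simp only [Units.val_mul]
  rw [mul_perm_apply, perm_mul_apply, Matrix.mul_apply]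
  simp only [mul_perm_apply, rep_eq, A_eq, toC, Matrix.map_apply]
  rw [← reductions_spec x hx i r k]
  push_cast
  rfl

theorem perm_word_A_comm {v : List (Fin 4)} (hv : v ∈ [[], [0], [2], [0, 2]]) :
    perm (word v) * A = A * perm (word v) := by
  apply Units.ext
  ext r k
  simp only [Units.val_mul]
  rw [mul_perm_apply, perm_mul_apply, A_eq, toC, Matrix.map_apply, Matrix.map_apply,
    word_A_comm v hv]

theorem mem_dcoset {α β : GL (Fin 7) ℂ} :
    β ∈ dcoset α ↔ ∃ σ ∈ Sig, ∃ τ ∈ Sig, β = σ * α * τ :=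
  DoubleCoset.mem_doubleCoset

theorem Sig_le_invGroup : Sig ≤ invGroup := by
  apply Subgroup.closure_mono
  intro x hx
  simp only [Set.mem_insert_iff, Set.mem_singleton_iff] at hx ⊢
  tauto

theorem A_mem_invGroup : A ∈ invGroup := Subgroup.subset_closure (by simp)

theorem rep_mem_invGroup (i : Fin 6) : rep i ∈ invGroup := by
  have h : ∀ p, perm (blockPerm p) * A ∈ invGroup := fun p =>
    mul_mem (Sig_le_invGroup (mem_Sig_iff.mpr ⟨p, rfl⟩)) A_mem_invGroup
  have h1 := h (c[0, 1, 2], c[0, 1])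
  have h2 := h (c[0, 1, 2], 1)
  rw [show blockPerm (c[0, 1, 2], c[0, 1]) = c[0, 1, 2] * c[5, 6] by decide +kernel] at h1
  rw [show blockPerm (c[0, 1, 2], 1) = c[0, 1, 2] by decide +kernel] at h2
  fin_cases i
  · exact one_mem _
  · exact A_mem_invGroup
  · exact pow_mem h1 2
  · exact pow_mem h1 3
  · exact pow_mem h2 3
  · exact pow_mem h1 4

/-- Writing the right factor as t v with v in ⟨(12),(34)⟩, v moves past A and the table rewrites ρᵢ
t A. -/
theorem dcoset_mul_A {α : GL (Fin 7) ℂ} {i : Fin 6} (h : α ∈ dcoset (rep i)) :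
    ∃ j, α * A ∈ dcoset (rep j) := by
  obtain ⟨σ, hσ, τ, hτ, rfl⟩ := mem_dcoset.mp h
  obtain ⟨p, rfl⟩ := mem_Sig_iff.mp hτ
  obtain ⟨x, hx, v, hv, hp⟩ := reductions_cover p
  refine ⟨(x.2 i).1, mem_dcoset.mpr ⟨σ * perm (word (x.2 i).2.1), mul_mem hσ (perm_word_mem _),
    perm (word (x.2 i).2.2) * perm (word v), mul_mem (perm_word_mem _) (perm_word_mem _), ?_⟩⟩
  have h1 := rep_mul_A hx i
  rw [hp, map_mul]
  calc σ * rep i * (perm (word x.1) * perm (word v)) * A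
      = σ * (rep i * perm (word x.1)) * (perm (word v) * A) := by group
    _ = σ * (rep i * perm (word x.1) * A) * perm (word v) := by
        rw [perm_word_A_comm hv]; group
    _ = _ := by rw [h1]; group

theorem A_inv : A⁻¹ = A := rfl

theorem mem_iUnion_dcoset {α : GL (Fin 7) ℂ} (h : α ∈ invGroup) : ∃ i, α ∈ dcoset (rep i) := by
  have h_sig : ∀ {β s : GL (Fin 7) ℂ}, (∃ i, β ∈ dcoset (rep i)) → s ∈ Sig →
      ∃ i, β * s ∈ dcoset (rep i) := by
    rintro β s ⟨i, hi⟩ hs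
    obtain ⟨σ, hσ, τ, hτ, rfl⟩ := mem_dcoset.mp hi
    exact ⟨i, mem_dcoset.mpr ⟨σ, hσ, τ * s, mul_mem hτ hs, by group⟩⟩
  have hgen : ∀ {s : GL (Fin 7) ℂ}, s ∈ ({perm (Equiv.swap 0 1), perm (Equiv.swap 1 2),
      perm (Equiv.swap 2 3), perm (Equiv.swap 5 6), A} : Set (GL (Fin 7) ℂ)) →
      s ∈ Sig ∨ s = A := by
    rintro s (rfl | rfl | rfl | rfl | rfl)
    · exact Or.inl (swap_mem_Sig (by simp))
    · exact Or.inl (swap_mem_Sig (by simp))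
    · exact Or.inl (swap_mem_Sig (by simp))
    · exact Or.inl (swap_mem_Sig (by simp))
    · exact Or.inr rfl
  induction h using Subgroup.closure_induction_right with
  | one => exact ⟨0, mem_dcoset.mpr ⟨1, one_mem _, 1, one_mem _, by simp [rep]⟩⟩
  | mul_right x hx y hy ih =>
    rcases hgen hy with hy | rfl
    · exact h_sig ih hy
    · exact dcoset_mul_A ih.choose_spec
  | mul_inv_cancel x hx y hy ih =>
    rcases hgen hy with hy | rfl
    · exact h_sig ih (inv_mem hy)
    · rw [A_inv]
      exact dcoset_mul_A ih.choose_spec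

theorem dcoset_rep_subset (i : Fin 6) : dcoset (rep i) ⊆ invGroup := by
  intro α h
  obtain ⟨σ, hσ, τ, hτ, rfl⟩ := mem_dcoset.mp h
  exact mul_mem (mul_mem (Sig_le_invGroup hσ) (rep_mem_invGroup i)) (Sig_le_invGroup hτ)

theorem invGroup_eq_iUnion : (invGroup : Set (GL (Fin 7) ℂ)) = ⋃ i, dcoset (rep i) := by
  ext α
  rw [Set.mem_iUnion]
  exact ⟨fun h => mem_iUnion_dcoset h, fun ⟨i, hi⟩ => dcoset_rep_subset i hi⟩

end SaalschutzL

/-! ### Separating and counting the double cosets by a row vector -/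

namespace SaalschutzL

/-- The rows `ρ * ρᵢ`, where `ρᵢ` are the six representatives and `ρ = (1, 1, 1, 1, 0, -1, -1)`
is a row vector whose stabilizer in `G_L` is `Σ`. -/
def row : Fin 6 → Fin 7 → ℤ :=
  ![![1, 1, 1, 1, 0, -1, -1],
    ![1, 1, 0, 0, 0, -1, 0],
    ![1, 0, -1, 0, 0, 0, 0],
    ![0, -1, -1, 0, 0, 0, 1],
    ![0, 0, 0, 0, 0, -1, 1],
    ![-1, -1, -1, -1, 0, 1, 1]]

theorem row_zero_vecMul_intRep (i : Fin 6) (k : Fin 7) :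
    ∑ m, row 0 m * intRep i m k = row i k := by
  revert i k
  decide +kernel

theorem row_zero_blockPerm (p) (k : Fin 7) : row 0 (blockPerm p k) = row 0 k := by
  revert p k
  decide +kernel

theorem eq_of_row_blockPerm_eq (i j : Fin 6) (p) (h : ∀ k, row i (blockPerm p k) = row j k) :
    i = j := by
  revert i j p
  decide +kernel

/-- The sums are 2, 1, 0, -1, 0, -2. They are unchanged by every permutation of the seven entries,
not only by those from Σ. -/
theorem eq_zero_of_sum_row (i : Fin 6) (h : ∑ k, row i k = ∑ k, row 0 k) : i = 0 := by
  revert i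
  decide +kernel

/-- These orbit sizes are the numbers of right cosets of Σ in the double cosets. -/
theorem card_image_row (i : Fin 6) :
    (Finset.univ.image fun p => fun k => row i (blockPerm p k)).card =
      (![1, 12, 12, 12, 2, 1] : Fin 6 → ℕ) i := by
  revert i
  decide +kernel

/-- The image of the row vector `(1, 1, 1, 1, 0, -1, -1)` under right multiplication by `α`. -/
def rowMul (α : GL (Fin 7) ℂ) : Fin 7 → ℂ :=
  (fun k => (row 0 k : ℂ)) ᵥ* (α : Matrix (Fin 7) (Fin 7) ℂ)

theorem rowMul_mul (α β : GL (Fin 7) ℂ) :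
    rowMul (α * β) = rowMul α ᵥ* (β : Matrix (Fin 7) (Fin 7) ℂ) := by
  rw [rowMul, rowMul, Units.val_mul, Matrix.vecMul_vecMul]

theorem rowMul_rep (i : Fin 6) : rowMul (rep i) = fun k => (row i k : ℂ) := by
  ext k
  rw [rowMul, rep_eq, ← row_zero_vecMul_intRep]
  simp [Matrix.vecMul, dotProduct, toC]

theorem rowMul_perm (σ : Equiv.Perm (Fin 7)) : rowMul (perm σ) = fun k => (row 0 (σ k) : ℂ) := by
  rw [rowMul, vecMul_perm]
  rfl

theorem rowMul_mem_Sig_mul {σ : GL (Fin 7) ℂ} (hσ : σ ∈ Sig) (α : GL (Fin 7) ℂ) :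
    rowMul (σ * α) = rowMul α := by
  obtain ⟨p, rfl⟩ := mem_Sig_iff.mp hσ
  rw [rowMul_mul, rowMul_perm]
  simp only [row_zero_blockPerm]
  rfl

theorem rowMul_coset {σ : GL (Fin 7) ℂ} (hσ : σ ∈ Sig) (i : Fin 6) (p) :
    rowMul (σ * rep i * perm (blockPerm p)) = fun k => (row i (blockPerm p k) : ℂ) := by
  rw [mul_assoc, rowMul_mem_Sig_mul hσ, rowMul_mul, rowMul_rep, vecMul_perm]
  rfl

theorem rep_zero : rep 0 = 1 := rfl

/-- Among the six rows only row 0 is Σ-equivalent to itself, so an element fixing the vector must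
lie in ΣΣ = Σ. -/
theorem mem_Sig_of_rowMul_eq {α : GL (Fin 7) ℂ} (hα : α ∈ invGroup)
    (h : rowMul α = rowMul 1) : α ∈ Sig := by
  obtain ⟨i, hi⟩ := mem_iUnion_dcoset hα
  obtain ⟨σ, hσ, τ, hτ, rfl⟩ := mem_dcoset.mp hi
  obtain ⟨p, rfl⟩ := mem_Sig_iff.mp hτ
  rw [rowMul_coset hσ, ← rep_zero, rowMul_rep] at h
  obtain rfl := eq_of_row_blockPerm_eq i 0 p fun k => by exact_mod_cast congrFun h k
  rw [rep_zero, mul_one]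
  exact mul_mem hσ hτ

theorem mul_inv_mem_Sig {α β : GL (Fin 7) ℂ} (hα : α ∈ invGroup) (hβ : β ∈ invGroup)
    (h : rowMul α = rowMul β) : α * β⁻¹ ∈ Sig := by
  apply mem_Sig_of_rowMul_eq (mul_mem hα (inv_mem hβ))
  rw [rowMul_mul, h, ← rowMul_mul, mul_inv_cancel]

theorem eq_of_mem_dcoset_rep {α : GL (Fin 7) ℂ} {i j : Fin 6} (hi : α ∈ dcoset (rep i))
    (hj : α ∈ dcoset (rep j)) : i = j := by
  obtain ⟨σ, hσ, τ, hτ, rfl⟩ := mem_dcoset.mp hi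
  obtain ⟨σ', hσ', τ', hτ', h⟩ := mem_dcoset.mp hj
  obtain ⟨p, hp⟩ := mem_Sig_iff.mp (mul_mem hτ (inv_mem hτ'))
  have h1 : σ * rep i * perm (blockPerm p) = σ' * rep j := by
    rw [hp, ← mul_assoc, h, mul_assoc, mul_inv_cancel, mul_one]
  have h2 := congrArg rowMul h1
  rw [rowMul_coset hσ, rowMul_mem_Sig_mul hσ', rowMul_rep] at h2
  exact eq_of_row_blockPerm_eq i j p fun k => by exact_mod_cast congrFun h2 k

theorem disjoint_dcoset_rep {i j : Fin 6} (h : i ≠ j) :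
    Disjoint (dcoset (rep i)) (dcoset (rep j)) :=
  Set.disjoint_left.mpr fun _ hi hj => h (eq_of_mem_dcoset_rep hi hj)

theorem rep_mem_dcoset (i : Fin 6) : rep i ∈ dcoset (rep i) :=
  mem_dcoset.mpr ⟨1, one_mem _, 1, one_mem _, by group⟩

theorem ncard_dcoset_rep (i : Fin 6) : (dcoset (rep i)).ncard =
    (![1 * 48, 12 * 48, 12 * 48, 12 * 48, 2 * 48, 1 * 48] : Fin 6 → ℕ) i := by
  set S := Finset.univ.image fun p => fun k => row i (blockPerm p k) with hS
  have hmem : ∀ w : S, ∃ p, (fun k => row i (blockPerm p k)) = w.1 := fun w => by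
    obtain ⟨p, -, hp⟩ := Finset.mem_image.mp w.2
    exact ⟨p, hp⟩
  choose q hq using hmem
  -- A bijection onto the double coset: the row vector recovers the right coset, and the Σ-factor is
  -- then recovered by cancellation.
  let F : Sig × S → GL (Fin 7) ℂ := fun x => x.1.1 * rep i * perm (blockPerm (q x.2))
  have hF : ∀ x, rowMul (F x) = fun k => (x.2.1 k : ℂ) := fun x => by
    rw [rowMul_coset x.1.2]
    ext k
    rw [← hq x.2]
  have hinj : Function.Injective F := by
    intro x y h
    have h1 : x.2 = y.2 := by
      have h2 := congrArg rowMul h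
      rw [hF, hF] at h2
      exact Subtype.ext (funext fun k => by exact_mod_cast congrFun h2 k)
    refine Prod.ext (Subtype.ext ?_) h1
    simp only [F, h1] at h
    exact mul_right_cancel (mul_right_cancel h)
  have hrange : dcoset (rep i) = Set.range F := by
    ext α
    constructor
    · intro hα
      have hG := dcoset_rep_subset i hα
      obtain ⟨σ, hσ, τ, hτ, rfl⟩ := mem_dcoset.mp hα
      obtain ⟨p, rfl⟩ := mem_Sig_iff.mp hτ
      let w : S := ⟨fun k => row i (blockPerm p k), Finset.mem_image_of_mem _ (Finset.mem_univ p)⟩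
      have h1 := mul_inv_mem_Sig hG
        (mul_mem (rep_mem_invGroup i) (Sig_le_invGroup (mem_Sig_iff.mpr ⟨q w, rfl⟩))) (by
          rw [rowMul_coset hσ, ← hF ⟨1, w⟩]
          simp [F])
      refine ⟨⟨⟨_, h1⟩, w⟩, ?_⟩
      simp only [F]
      group
    · rintro ⟨x, rfl⟩
      exact mem_dcoset.mpr ⟨x.1, x.1.2, _, mem_Sig_iff.mpr ⟨q x.2, rfl⟩, rfl⟩
  rw [hrange, ← Set.image_univ, Set.ncard_image_of_injective _ hinj, Set.ncard_univ, Nat.card_prod,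
    card_Sig, Nat.card_eq_fintype_card, Fintype.card_coe, hS, card_image_row, mul_comm]
  fin_cases i <;> rfl

theorem Sig_eq_perm_mem_invGroup : (Sig : Set (GL (Fin 7) ℂ)) =
    {α | α ∈ invGroup ∧ ∃ σ : Equiv.Perm (Fin 7), α = perm σ} := by
  ext α
  constructor
  · intro h
    obtain ⟨p, rfl⟩ := mem_Sig_iff.mp h
    exact ⟨Sig_le_invGroup h, _, rfl⟩
  · rintro ⟨hα, π, h⟩
    obtain ⟨i, hi⟩ := mem_iUnion_dcoset hα
    obtain ⟨σ, hσ, τ, hτ, rfl⟩ := mem_dcoset.mp hi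
    obtain ⟨p, rfl⟩ := mem_Sig_iff.mp hτ
    have h1 := congrArg rowMul h
    rw [rowMul_coset hσ, rowMul_perm] at h1
    have h2 : ∀ k, row i (blockPerm p k) = row 0 (π k) := fun k => by
      exact_mod_cast congrFun h1 k
    -- A permutation matrix sends the row vector to a rearrangement of itself, and the entry sum
    -- then excludes every double coset but Σ.
    obtain rfl := eq_zero_of_sum_row i (by
      rw [← Equiv.sum_comp (blockPerm p) (row i), ← Equiv.sum_comp π (row 0)]
      exact Finset.sum_congr rfl fun k _ => h2 k)
    rw [rep_zero, mul_one]
    exact mul_mem hσ hτ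

theorem ncard_dcosets :
    {D : Set (GL (Fin 7) ℂ) | ∃ α ∈ invGroup, D = dcoset α}.ncard = 6 := by
  have hinj : Function.Injective fun i => dcoset (rep i) := fun i j h =>
    eq_of_mem_dcoset_rep (rep_mem_dcoset i) (h.le (rep_mem_dcoset i))
  have h : {D : Set (GL (Fin 7) ℂ) | ∃ α ∈ invGroup, D = dcoset α} =
      (fun i => dcoset (rep i)) '' Set.univ := by
    ext D
    constructor
    · rintro ⟨α, hα, rfl⟩
      obtain ⟨i, hi⟩ := mem_iUnion_dcoset hα
      exact ⟨i, trivial, (DoubleCoset.doubleCoset_eq_of_mem hi).symm⟩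
    · rintro ⟨i, -, rfl⟩
      exact ⟨rep i, rep_mem_invGroup i, rfl⟩
  rw [h, Set.ncard_image_of_injective _ hinj, Set.ncard_univ, Nat.card_eq_fintype_card,
    Fintype.card_fin]

end SaalschutzL

/-! ### The representatives act by the listed substitutions -/

namespace SaalschutzL

theorem act_apply_of_eq_toC {α : GL (Fin 7) ℂ} {M : Matrix (Fin 7) (Fin 7) ℤ}
    (h : (α : Matrix (Fin 7) (Fin 7) ℂ) = toC M) (x : Fin 7 → ℂ) (k : Fin 7) :
    act α x k = ∑ m, (M k m : ℂ) * x m := by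
  rw [act, h]
  simp [toC, Matrix.mulVec, dotProduct]

theorem act_rep (i : Fin 6) {x : Fin 7 → ℂ} (hx : x ∈ V) : act (rep i) x = rhsVec i x := by
  -- The constants 1 and 2 in the substitutions come only from the equation of V; a linear map has
  -- none.
  have h : x 6 = 1 + x 0 + x 1 + x 2 + x 3 - x 4 - x 5 := by
    have h1 : x 4 + x 5 + x 6 - x 0 - x 1 - x 2 - x 3 = 1 := hx
    linear_combination h1
  ext k
  rw [act_apply_of_eq_toC (rep_eq i), rhsVec]
  fin_cases i <;> fin_cases k <;> simp [Fin.sum_univ_succ, intRep, rhs, h] <;> ring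

end SaalschutzL

/-! ### Invariance at generic points -/

namespace SaalschutzL

open Filter Topology

/-- The linear form on `ℂ⁷` whose level set at `1` is `V`. -/
def normal : Fin 7 → ℤ := ![-1, -1, -1, -1, 1, 1, 1]

/-- Points whose real parts satisfy no integral affine relations except multiples of the
equation of `V`. -/
def Generic (x : Fin 7 → ℂ) : Prop :=
  ∀ (q : Fin 7 → ℤ) (n : ℤ), ∑ i, (q i : ℝ) * (x i).re = n → ∃ m : ℤ, ∀ i, q i = m * normal i

theorem mem_V_iff {x : Fin 7 → ℂ} : x ∈ V ↔ ∑ i, (normal i : ℂ) * x i = 1 := by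
  have h : ∑ i, (normal i : ℂ) * x i = x 4 + x 5 + x 6 - x 0 - x 1 - x 2 - x 3 := by
    simp [Fin.sum_univ_succ, normal]
    ring
  rw [h]
  rfl

theorem Generic.eq_neg {x : Fin 7 → ℂ} (h : Generic x) {q : Fin 7 → ℤ} {n : ℤ}
    (hq : ∑ i, (q i : ℝ) * (x i).re = n) :
    q 0 = q 1 ∧ q 1 = q 2 ∧ q 2 = q 3 ∧ q 4 = q 5 ∧ q 5 = q 6 ∧ q 0 = -q 4 := by
  obtain ⟨m, hm⟩ := h q n hq
  simp [hm, normal]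

theorem Generic.nonInt {x : Fin 7 → ℂ} (h : Generic x) (q : Fin 7 → ℤ) {z : ℂ}
    (hz : z = ∑ i, (q i : ℂ) * x i)
    (hq : ¬(q 0 = q 1 ∧ q 1 = q 2 ∧ q 2 = q 3 ∧ q 4 = q 5 ∧ q 5 = q 6 ∧ q 0 = -q 4)) :
    NonInt z := by
  intro n hn
  refine hq (h.eq_neg (n := n) ?_)
  have h1 := congrArg Complex.re (hz.symm.trans hn)
  rw [Complex.re_sum, Complex.intCast_re] at h1
  rw [← h1]
  exact Finset.sum_congr rfl fun i _ => by simp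

theorem Generic.reflGeneric {x : Fin 7 → ℂ} (h : Generic x) (hx : x ∈ V) :
    ReflGeneric (x 0) (x 1) (x 2) (x 3) (x 4) (x 5) (x 6) where
  bal := bal_of_mem_V hx
  na := h.nonInt ![1, 0, 0, 0, 0, 0, 0] (by simp [Fin.sum_univ_succ]) (by decide)
  nb := h.nonInt ![0, 1, 0, 0, 0, 0, 0] (by simp [Fin.sum_univ_succ]) (by decide)
  nc := h.nonInt ![0, 0, 1, 0, 0, 0, 0] (by simp [Fin.sum_univ_succ]) (by decide)
  nd := h.nonInt ![0, 0, 0, 1, 0, 0, 0] (by simp [Fin.sum_univ_succ]) (by decide)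
  ne := h.nonInt ![0, 0, 0, 0, 1, 0, 0] (by simp [Fin.sum_univ_succ]) (by decide)
  nf := h.nonInt ![0, 0, 0, 0, 0, 1, 0] (by simp [Fin.sum_univ_succ]) (by decide)
  ng := h.nonInt ![0, 0, 0, 0, 0, 0, 1] (by simp [Fin.sum_univ_succ]) (by decide)
  ea := h.nonInt ![-1, 0, 0, 0, 1, 0, 0] (by simp [Fin.sum_univ_succ]; ring) (by decide)
  eb := h.nonInt ![0, -1, 0, 0, 1, 0, 0] (by simp [Fin.sum_univ_succ]; ring) (by decide)
  ec := h.nonInt ![0, 0, -1, 0, 1, 0, 0] (by simp [Fin.sum_univ_succ]; ring) (by decide)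
  ed := h.nonInt ![0, 0, 0, -1, 1, 0, 0] (by simp [Fin.sum_univ_succ]; ring) (by decide)
  fa := h.nonInt ![-1, 0, 0, 0, 0, 1, 0] (by simp [Fin.sum_univ_succ]; ring) (by decide)
  fb := h.nonInt ![0, -1, 0, 0, 0, 1, 0] (by simp [Fin.sum_univ_succ]; ring) (by decide)
  gc := h.nonInt ![0, 0, -1, 0, 0, 0, 1] (by simp [Fin.sum_univ_succ]; ring) (by decide)
  gd := h.nonInt ![0, 0, 0, -1, 0, 0, 1] (by simp [Fin.sum_univ_succ]; ring) (by decide)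
  fe := h.nonInt ![0, 0, 0, 0, -1, 1, 0] (by simp [Fin.sum_univ_succ]; ring) (by decide)
  ge := h.nonInt ![0, 0, 0, 0, -1, 0, 1] (by simp [Fin.sum_univ_succ]; ring) (by decide)
  nu := h.nonInt ![0, 0, -1, -1, 0, 0, 1] (by simp [Fin.sum_univ_succ]; ring) (by decide)
  eu := h.nonInt ![0, 0, -1, -1, 1, 0, 1] (by simp [Fin.sum_univ_succ]; ring) (by decide)
  fu := h.nonInt ![0, 0, -1, -1, 0, 1, 1] (by simp [Fin.sum_univ_succ]; ring) (by decide)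
  geu := h.nonInt ![0, 0, 1, 1, -1, 0, 0] (by simp [Fin.sum_univ_succ]; ring) (by decide)

theorem Generic.re_ne_zero {x : Fin 7 → ℂ} (h : Generic x) : (x 6 - x 2 - x 3).re ≠ 0 := by
  intro h0
  have := h.eq_neg (q := ![0, 0, -1, -1, 0, 0, 1]) (n := 0) (by
    rw [Complex.sub_re, Complex.sub_re] at h0
    simp [Fin.sum_univ_succ]
    linear_combination h0)
  revert this
  decide

theorem act_A (x : Fin 7 → ℂ) : act A x = ![x 0, x 1, x 6 - x 2, x 6 - x 3,
    x 4 + (x 6 - x 2 - x 3), x 5 + (x 6 - x 2 - x 3), x 6] := by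
  ext k
  rw [act_apply_of_eq_toC A_eq]
  fin_cases k <;> simp [Fin.sum_univ_succ, intA] <;> ring

theorem act_A_mem_V {x : Fin 7 → ℂ} (hx : x ∈ V) : act A x ∈ V := by
  have h := bal_of_mem_V hx
  rw [act_A]
  change x 4 + (x 6 - x 2 - x 3) + (x 5 + (x 6 - x 2 - x 3)) + x 6 - x 0 - x 1 - (x 6 - x 2) -
    (x 6 - x 3) = 1
  linear_combination h

theorem Generic.act_A {x : Fin 7 → ℂ} (h : Generic x) : Generic (act A x) := by
  intro q n hq
  -- This is the row vector qA: a relation q at Ax is the relation qA at x. Being a multiple of the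
  -- normal vector is preserved because A fixes that vector.
  obtain ⟨m, hm⟩ := h ![q 0, q 1, -q 2 - q 4 - q 5, -q 3 - q 4 - q 5, q 4, q 5,
    q 2 + q 3 + q 4 + q 5 + q 6] n (by
      rw [← hq, SaalschutzL.act_A]
      simp [Fin.sum_univ_succ]
      ring)
  refine ⟨m, ?_⟩
  simp [Fin.forall_fin_succ, normal] at hm ⊢
  omega

theorem Lvec_act_A {x : Fin 7 → ℂ} (hx : x ∈ V) (h : Generic x) : Lvec (act A x) = Lvec x := by
  rw [act_A]
  exact (L_reflect (h.reflGeneric hx) h.re_ne_zero).symm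

/-- The adjacent transpositions generating `Σ`. -/
def IsGenSwap (σ : Equiv.Perm (Fin 7)) : Prop :=
  σ = Equiv.swap 0 1 ∨ σ = Equiv.swap 1 2 ∨ σ = Equiv.swap 2 3 ∨ σ = Equiv.swap 5 6

theorem normal_genSwap {σ : Equiv.Perm (Fin 7)} (hσ : IsGenSwap σ) (i : Fin 7) :
    normal (σ i) = normal i := by
  rcases hσ with rfl | rfl | rfl | rfl <;> revert i <;> decide

theorem comp_mem_V {σ : Equiv.Perm (Fin 7)} (hσ : IsGenSwap σ) {x : Fin 7 → ℂ} (hx : x ∈ V) :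
    x ∘ σ ∈ V := by
  rw [mem_V_iff] at hx ⊢
  rw [← hx, ← Equiv.sum_comp σ fun i => (normal i : ℂ) * x i]
  exact Finset.sum_congr rfl fun i _ => by rw [normal_genSwap hσ]; rfl

theorem Generic.comp {σ : Equiv.Perm (Fin 7)} (hσ : IsGenSwap σ) {x : Fin 7 → ℂ}
    (h : Generic x) : Generic (x ∘ σ) := by
  intro q n hq
  obtain ⟨m, hm⟩ := h (q ∘ σ.symm) n (by
    rw [← hq, ← Equiv.sum_comp σ]
    simp)
  refine ⟨m, fun i => ?_⟩
  have := hm (σ i)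
  rwa [Function.comp_apply, Equiv.symm_apply_apply, normal_genSwap hσ] at this

theorem hyp_comp_perm {p : ℕ} (a : Fin (p + 1) → ℂ) (b : Fin p → ℂ) (z : ℂ)
    (σ : Equiv.Perm (Fin (p + 1))) (τ : Equiv.Perm (Fin p)) :
    hyp (a ∘ σ) (b ∘ τ) z = hyp a b z := by
  refine tsum_congr fun n => ?_
  simp only [hypTerm, Function.comp_apply]
  rw [Equiv.prod_comp σ fun i => (ascPochhammer ℂ n).eval (a i),
    Equiv.prod_comp τ fun j => (ascPochhammer ℂ n).eval (b j)]

theorem L_swap_ab (a b c d e f g : ℂ) : L b a c d e f g = L a b c d e f g := by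
  have h : ∀ a b c d e f g : ℂ, hyp ![b, a, c, d] ![e, f, g] 1 = hyp ![a, b, c, d] ![e, f, g] 1 :=
    fun a b c d e f g => by
    rw [← hyp_comp_perm ![a, b, c, d] _ _ (Equiv.swap 0 1) 1]
    congr 1
    ext i
    fin_cases i <;> rfl
  rw [L, L, h a, h (1 + a - e)]
  congr 2 <;> ring

theorem L_swap_bc (a b c d e f g : ℂ) : L a c b d e f g = L a b c d e f g := by
  have h : ∀ a b c d e f g : ℂ, hyp ![a, c, b, d] ![e, f, g] 1 = hyp ![a, b, c, d] ![e, f, g] 1 :=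
    fun a b c d e f g => by
    rw [← hyp_comp_perm ![a, b, c, d] _ _ (Equiv.swap 1 2) 1]
    congr 1
    ext i
    fin_cases i <;> rfl
  rw [L, L, h a, h (1 + a - e)]
  congr 2 <;> ring

theorem L_swap_cd (a b c d e f g : ℂ) : L a b d c e f g = L a b c d e f g := by
  have h : ∀ a b c d e f g : ℂ, hyp ![a, b, d, c] ![e, f, g] 1 = hyp ![a, b, c, d] ![e, f, g] 1 :=
    fun a b c d e f g => by
    rw [← hyp_comp_perm ![a, b, c, d] _ _ (Equiv.swap 2 3) 1]
    congr 1
    ext i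
    fin_cases i <;> rfl
  rw [L, L, h a, h (1 + a - e)]
  congr 2 <;> ring

theorem L_swap_fg (a b c d e f g : ℂ) : L a b c d e g f = L a b c d e f g := by
  have h : hyp ![a, b, c, d] ![e, g, f] 1 = hyp ![a, b, c, d] ![e, f, g] 1 := by
    rw [← hyp_comp_perm _ ![e, f, g] _ 1 (Equiv.swap 1 2)]
    congr 1
    ext i
    fin_cases i <;> rfl
  have h' : ∀ a b c d f g e : ℂ, hyp ![a, b, c, d] ![g, f, e] 1 = hyp ![a, b, c, d] ![f, g, e] 1 :=
    fun a b c d f g e => by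
    rw [← hyp_comp_perm _ ![f, g, e] _ 1 (Equiv.swap 0 1)]
    congr 1
    ext i
    fin_cases i <;> rfl
  rw [L, L, h, h' (1 + a - e)]
  congr 2 <;> ring

theorem Lvec_comp {σ : Equiv.Perm (Fin 7)} (hσ : IsGenSwap σ) (x : Fin 7 → ℂ) :
    Lvec (x ∘ σ) = Lvec x := by
  rcases hσ with rfl | rfl | rfl | rfl
  · exact L_swap_ab ..
  · exact L_swap_bc ..
  · exact L_swap_cd ..
  · exact L_swap_fg ..

/-- A set and a function on it are invariant under `G_L` if they are invariant under its
generators. -/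
theorem act_invariant {Y : Type*} {W : Set (Fin 7 → ℂ)} {F : (Fin 7 → ℂ) → Y}
    (h_swap : ∀ σ, IsGenSwap σ → ∀ x ∈ W, x ∘ σ ∈ W ∧ F (x ∘ σ) = F x)
    (hA : ∀ x ∈ W, act A x ∈ W ∧ F (act A x) = F x) {α : GL (Fin 7) ℂ} (hα : α ∈ invGroup) :
    ∀ x ∈ W, act α x ∈ W ∧ F (act α x) = F x := by
  have h_perm : ∀ σ, IsGenSwap σ → ∀ x ∈ W, act (perm σ) x ∈ W ∧ F (act (perm σ) x) = F x := by
    intro σ hσ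
    have h : σ.symm = σ := by rcases hσ with rfl | rfl | rfl | rfl <;> rfl
    intro x hx
    rw [act_perm, h]
    exact h_swap σ hσ x hx
  have h_inv : ∀ σ, IsGenSwap σ → (perm σ)⁻¹ = perm σ := by
    intro σ hσ
    rw [← map_inv]
    rcases hσ with rfl | rfl | rfl | rfl <;> rfl
  have h_gen : ∀ s ∈ ({perm (Equiv.swap 0 1), perm (Equiv.swap 1 2), perm (Equiv.swap 2 3),
      perm (Equiv.swap 5 6), A} : Set (GL (Fin 7) ℂ)),
      s⁻¹ = s ∧ ∀ x ∈ W, act s x ∈ W ∧ F (act s x) = F x := by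
    have h1 : ∀ σ, IsGenSwap σ → (perm σ)⁻¹ = perm σ ∧
        ∀ x ∈ W, act (perm σ) x ∈ W ∧ F (act (perm σ) x) = F x :=
      fun σ hσ => ⟨h_inv σ hσ, h_perm σ hσ⟩
    rintro s (rfl | rfl | rfl | rfl | rfl)
    · exact h1 _ (Or.inl rfl)
    · exact h1 _ (Or.inr (Or.inl rfl))
    · exact h1 _ (Or.inr (Or.inr (Or.inl rfl)))
    · exact h1 _ (Or.inr (Or.inr (Or.inr rfl)))
    · exact ⟨A_inv, hA⟩
  have h_mul : ∀ {α s : GL (Fin 7) ℂ}, (∀ x ∈ W, act α x ∈ W ∧ F (act α x) = F x) →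
      (∀ x ∈ W, act s x ∈ W ∧ F (act s x) = F x) →
      ∀ x ∈ W, act (α * s) x ∈ W ∧ F (act (α * s) x) = F x := by
    intro α s h1 h2 x hx
    rw [act_mul]
    have h3 := h2 x hx
    have h4 := h1 _ h3.1
    exact ⟨h4.1, h4.2.trans h3.2⟩
  induction hα using Subgroup.closure_induction_right with
  | one =>
    intro x hx
    rw [act_one]
    exact ⟨hx, rfl⟩
  | mul_right α _ s hs ih => exact h_mul ih (h_gen s hs).2
  | mul_inv_cancel α _ s hs ih =>
    rw [(h_gen s hs).1]
    exact h_mul ih (h_gen s hs).2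

theorem act_mem_V {α : GL (Fin 7) ℂ} (hα : α ∈ invGroup) {x : Fin 7 → ℂ} (hx : x ∈ V) :
    act α x ∈ V :=
  (act_invariant (F := fun _ => ()) (fun _ hσ _ hx => ⟨comp_mem_V hσ hx, rfl⟩)
    (fun _ hx => ⟨act_A_mem_V hx, rfl⟩) hα x hx).1

theorem Lvec_act_of_generic {α : GL (Fin 7) ℂ} (hα : α ∈ invGroup) {x : Fin 7 → ℂ} (hx : x ∈ V)
    (h : Generic x) : Lvec (act α x) = Lvec x :=
  (act_invariant (W := {x | x ∈ V ∧ Generic x}) (F := Lvec)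
    (fun _ hσ x hx => ⟨⟨comp_mem_V hσ hx.1, hx.2.comp hσ⟩, Lvec_comp hσ x⟩)
    (fun _ hx => ⟨⟨act_A_mem_V hx.1, hx.2.act_A⟩, Lvec_act_A hx.1 hx.2⟩) hα x ⟨hx, h⟩).2

end SaalschutzL

/-! ### From generic points to all admissible points -/

namespace SaalschutzL

open Filter Topology

/-- A direction parallel to `V` whose coordinates satisfy no other integral linear relation. -/
noncomputable def direction : Fin 7 → ℝ :=
  let t := liouvilleNumber 2
  ![1, t, t ^ 2, t ^ 3, t ^ 4, t ^ 5, 1 + t + t ^ 2 + t ^ 3 - t ^ 4 - t ^ 5]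

/-- Such a relation is an integer polynomial of degree at most 5 vanishing at a transcendental
number, so all its coefficients vanish. They express the other entries of q through q 6. -/
theorem exists_eq_mul_normal_of_sum_direction {q : Fin 7 → ℤ}
    (h : ∑ i, (q i : ℝ) * direction i = 0) : ∃ m : ℤ, ∀ i, q i = m * normal i := by
  have ht : Transcendental ℤ (liouvilleNumber (2 : ℕ)) := transcendental_liouvilleNumber le_rfl
  push_cast at ht
  let p : Polynomial ℤ := Polynomial.C (q 0 + q 6) + Polynomial.C (q 1 + q 6) * Polynomial.X +
    Polynomial.C (q 2 + q 6) * Polynomial.X ^ 2 + Polynomial.C (q 3 + q 6) * Polynomial.X ^ 3 +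
    Polynomial.C (q 4 - q 6) * Polynomial.X ^ 4 + Polynomial.C (q 5 - q 6) * Polynomial.X ^ 5
  have hp : p = 0 := by
    refine transcendental_iff.mp ht p ?_
    rw [← h]
    simp [p, Fin.sum_univ_succ, direction]
    ring
  have hc : ∀ n, p.coeff n = 0 := fun n => by rw [hp, Polynomial.coeff_zero]
  have h0 := hc 0
  have h1 := hc 1
  have h2 := hc 2
  have h3 := hc 3
  have h4 := hc 4
  have h5 := hc 5
  simp only [p, Polynomial.coeff_add, Polynomial.coeff_C_mul, Polynomial.coeff_X_pow,
    Polynomial.coeff_X, Polynomial.coeff_C] at h0 h1 h2 h3 h4 h5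
  norm_num at h0 h1 h2 h3 h4 h5
  refine ⟨q 6, ?_⟩
  simp [Fin.forall_fin_succ, normal]
  omega

/-- Each of the countably many forbidden relations (q, n) is affine and nonconstant in s, so it
excludes at most one value. -/
theorem countable_not_generic (x : Fin 7 → ℂ) :
    {s : ℝ | ¬Generic fun i => x i + (s * direction i : ℝ)}.Countable := by
  refine (Set.countable_range fun r : (Fin 7 → ℤ) × ℤ =>
    (r.2 - ∑ i, (r.1 i : ℝ) * (x i).re) / ∑ i, (r.1 i : ℝ) * direction i).mono ?_
  intro s hs
  simp only [Set.mem_ofPred_eq, Generic, not_forall] at hs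
  obtain ⟨q, n, h, hq⟩ := hs
  refine ⟨(q, n), ?_⟩
  have h0 : ∑ i, (q i : ℝ) * direction i ≠ 0 := fun h0 =>
    hq (exists_eq_mul_normal_of_sum_direction h0)
  rw [div_eq_iff h0, ← h, ← Finset.sum_sub_distrib, Finset.mul_sum]
  refine Finset.sum_congr rfl fun i _ => ?_
  rw [Complex.add_re, Complex.ofReal_re]
  ring

theorem line_mem_V {x : Fin 7 → ℂ} (hx : x ∈ V) (s : ℝ) :
    (fun i => x i + (s * direction i : ℝ)) ∈ V := by
  have h := bal_of_mem_V hx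
  simp only [V, Set.mem_ofPred_eq, direction]
  simp
  linear_combination h

theorem Lvec_act {α : GL (Fin 7) ℂ} (hα : α ∈ invGroup) {x : Fin 7 → ℂ} (hx : x ∈ V)
    (h : Admissible x) (h' : Admissible (act α x)) : Lvec x = Lvec (act α x) := by
  let y : ℝ → Fin 7 → ℂ := fun s i => x i + (s * direction i : ℝ)
  have hy : Continuous y := by fun_prop
  have hy0 : y 0 = x := by
    ext i
    simp [y]
  have hay : Continuous fun s => act α (y s) := by
    simp only [act]
    fun_prop
  -- The complement of a countable set of reals is dense, so 0 is approached through generic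
  -- parameters, where the two sides agree; continuity at both admissible endpoints gives equality
  -- in the limit.
  set S : Set ℝ := {s | ¬Generic (y s)}ᶜ with hS
  have : (𝓝[S] (0 : ℝ)).NeBot :=
    mem_closure_iff_nhdsWithin_neBot.mp
      (Set.Countable.dense_compl ℝ (countable_not_generic x) (0 : ℝ))
  have h1 : Tendsto (fun s => Lvec (y s)) (𝓝[S] 0) (𝓝 (Lvec x)) :=
    tendsto_Lvec ((hy0 ▸ hy.tendsto 0).mono_left nhdsWithin_le_nhds) (fun s => line_mem_V hx s) h
  have h2 : Tendsto (fun s => Lvec (act α (y s))) (𝓝[S] 0) (𝓝 (Lvec (act α x))) :=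
    tendsto_Lvec ((hy0 ▸ hay.tendsto 0).mono_left nhdsWithin_le_nhds)
      (fun s => act_mem_V hα (line_mem_V hx s)) h'
  refine tendsto_nhds_unique h1 (h2.congr' ?_)
  filter_upwards [self_mem_nhdsWithin] with s hs
  exact Lvec_act_of_generic hα (line_mem_V hx s) (not_not.mp hs)

end SaalschutzL

theorem theorem4p2 :
    -- `Σ ≅ S₄ × S₂`, and `Σ` is the set of all permutation matrices in `G_L`
    Nonempty (SaalschutzL.Sig ≃* Equiv.Perm (Fin 4) × Equiv.Perm (Fin 2)) ∧
    (SaalschutzL.Sig : Set (GL (Fin 7) ℂ)) =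
      {α | α ∈ SaalschutzL.invGroup ∧ ∃ σ : Equiv.Perm (Fin 7), α = SaalschutzL.perm σ} ∧
    -- there are exactly six double cosets of `Σ` in `G_L`
    {D : Set (GL (Fin 7) ℂ) | ∃ α ∈ SaalschutzL.invGroup, D = SaalschutzL.dcoset α}.ncard = 6 ∧
    -- the six listed matrices represent them
    (∀ i, SaalschutzL.rep i ∈ SaalschutzL.invGroup) ∧
    (SaalschutzL.invGroup : Set (GL (Fin 7) ℂ)) = ⋃ i, SaalschutzL.dcoset (SaalschutzL.rep i) ∧
    (∀ i j, i ≠ j →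
      Disjoint (SaalschutzL.dcoset (SaalschutzL.rep i)) (SaalschutzL.dcoset (SaalschutzL.rep j))) ∧
    -- the sizes of the double cosets
    (∀ i, (SaalschutzL.dcoset (SaalschutzL.rep i)).ncard =
      (![1 * 48, 12 * 48, 12 * 48, 12 * 48, 2 * 48, 1 * 48] : Fin 6 → ℕ) i) ∧
    -- at admissible points of `V` both series in `L` converge absolutely
    (∀ x ∈ SaalschutzL.V, SaalschutzL.Admissible x →
      Summable (fun n => ‖SaalschutzL.hypTerm
        ![x 0, x 1, x 2, x 3] ![x 4, x 5, x 6] 1 n‖) ∧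
      Summable (fun n => ‖SaalschutzL.hypTerm
        ![1 + x 0 - x 4, 1 + x 1 - x 4, 1 + x 2 - x 4, 1 + x 3 - x 4]
        ![1 + x 5 - x 4, 1 + x 6 - x 4, 2 - x 4] 1 n‖)) ∧
    -- on `V` the `i`-th representative acts by the `i`-th listed substitution,
    -- and the `i`-th listed invariance relation holds
    (∀ i, ∀ x ∈ SaalschutzL.V,
      SaalschutzL.act (SaalschutzL.rep i) x = SaalschutzL.rhsVec i x) ∧
    (∀ i, ∀ x ∈ SaalschutzL.V, SaalschutzL.Admissible x →
      SaalschutzL.Admissible (SaalschutzL.rhsVec i x) →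
      SaalschutzL.Lvec x = SaalschutzL.Lvec (SaalschutzL.rhsVec i x)) ∧
    -- every element of `G_L` preserves `V`, gives an invariance of `L`, and is obtained from one of
    -- the six listed substitutions by permutations from `Σ` of its output and of the variables
    (∀ α ∈ SaalschutzL.invGroup,
      (∀ x ∈ SaalschutzL.V, SaalschutzL.act α x ∈ SaalschutzL.V) ∧
      (∀ x ∈ SaalschutzL.V, SaalschutzL.Admissible x →
        SaalschutzL.Admissible (SaalschutzL.act α x) →
        SaalschutzL.Lvec x = SaalschutzL.Lvec (SaalschutzL.act α x)) ∧
      ∃ i, ∃ σ ∈ SaalschutzL.Sig, ∃ τ ∈ SaalschutzL.Sig,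
        α = σ * SaalschutzL.rep i * τ ∧
        ∀ x ∈ SaalschutzL.V, SaalschutzL.act α x =
          SaalschutzL.act σ (SaalschutzL.rhsVec i (SaalschutzL.act τ x))) := by
  refine ⟨SaalschutzL.nonempty_Sig_mulEquiv, SaalschutzL.Sig_eq_perm_mem_invGroup,
    SaalschutzL.ncard_dcosets, SaalschutzL.rep_mem_invGroup, SaalschutzL.invGroup_eq_iUnion,
    fun i j h => SaalschutzL.disjoint_dcoset_rep h, SaalschutzL.ncard_dcoset_rep, ?_,
    fun i x hx => SaalschutzL.act_rep i hx, ?_, ?_⟩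
  · intro x hx h
    exact ⟨SaalschutzL.summable_norm_hypTerm (fun m => (h.2 m).1) (fun m => (h.2 m).2.1)
        (fun m => (h.2 m).2.2.1) (SaalschutzL.bal_of_mem_V hx),
      SaalschutzL.summable_norm_hypTerm (fun m => (h.2 m).2.2.2.1)
        (fun m => (h.2 m).2.2.2.2.1) (fun m => (h.2 m).2.2.2.2.2)
        (SaalschutzL.dual_bal_of_mem_V hx)⟩
  · intro i x hx h h'
    rw [← SaalschutzL.act_rep i hx] at h' ⊢
    exact SaalschutzL.Lvec_act (SaalschutzL.rep_mem_invGroup i) hx h h'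
  · intro α hα
    refine ⟨fun x hx => SaalschutzL.act_mem_V hα hx,
      fun x hx h h' => SaalschutzL.Lvec_act hα hx h h', ?_⟩
    obtain ⟨i, hi⟩ := SaalschutzL.mem_iUnion_dcoset hα
    obtain ⟨σ, hσ, τ, hτ, rfl⟩ := SaalschutzL.mem_dcoset.mp hi
    refine ⟨i, σ, hσ, τ, hτ, rfl, fun x hx => ?_⟩
    rw [SaalschutzL.act_mul, SaalschutzL.act_mul,
      SaalschutzL.act_rep i (SaalschutzL.act_mem_V (SaalschutzL.Sig_le_invGroup hτ) hx)]
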